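/- Let $q\in\mathbf C^*$ with $|q|>1$, and let $K$ be one of the fields $\mathcal M(\mathbf C)$ (meromorphic functions on $\mathbf C$), $\mathbf C(\{z\})$ (germs at $0$ of meromorphic functions), $\mathbf C((z))$, with the automorphism $\sigma_q:f(z)\mapsto f(qz)$ and the $z$-adic valuation $v_0$. A $q$-difference module over $K$ is a pair $(M,\Phi)$ of a finite-dimensional $K$-vector space and a $\sigma_q$-linear automorphism $\Phi$ of $M$; morphisms are the $K$-linear maps commuting with $\Phi$, submodules are the subspaces stable under $\Phi^{\pm1}$, and $(M_1,\Phi_1)\otimes(M_2,\Phi_2)=(M_1\otimes_K M_2,\Phi_1\otimes\Phi_2)$; this is a symmetric monoidal category $DiffMod(K,\sigma_q)$ with unit $(K,\sigma_q)$. Fix compatible roots $(q_l)_{l\ge1}$ of $q$ ($q_1=q$, $q_{lm}^l=q_m$), and let $K_l=K[z_l]$, $z_l^l=z$, with $\sigma_{q_l}:f(z_l)\mapsto f(q_lz_l)$ and the $z_l$-adic valuation. The slopes of $M$ are defined as follows: for some $l\ge1$ the module $K_l\otimes_K M$ has a filtration by submodules whose quotients are of rank one, isomorphic to $(K_l,a_i\sigma_{q_l})$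 with $a_i\in K_l^*$; the slopes of $M$, with multiplicities, are the rational numbers $v(a_i)/l$. The module $M$ is pure of slope $\mu$ if its set of slopes is $\{\mu\}$, and moderately irregular if it is a direct sum of pure submodules. For $\mu\in\mathbf Q$ let $F^{\ge\mu}(M)$ (resp. $F^{>\mu}(M)$) be the largest submodule of $M$ all of whose slopes are $\ge\mu$ (resp. $>\mu$), and put $$M^{(\mu)}=F^{\ge\mu}(M)/F^{>\mu}(M),\qquad gr(M)=\bigoplus_{\mu\in\mathbf Q}M^{(\mu)}.$$ Morphisms respect these filtrations, so that $gr$ is a functor on $DiffMod(K,\sigma_q)$. Theorem. The functor $gr$ takes its values in the full subcategory $DiffMod_{mi}(K,\sigma_q)$ of moderately irregular modules; it is faithful; and it is compatible with tensor products: it is a symmetric monoidal functor, with natural isomorphisms $gr(M_1)\otimes gr(M_2)\cong gr(M_1\otimes M_2)$ that send $\bar x\otimes\bar y$, where $\bar x\in M_1^{(\mu_1)}$ and $\bar y\in M_2^{(\mu_2)}$ are the classes of $x\in F^{\ge\mu_1}(M_1)$ and $y\in F^{\ge\mu_2}(M_2)$, to the class of $x\otimes y\in F^{\ge\mu_1+\mu_2}(M_1\otimes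 M_2)$ in $(M_1\otimes M_2)^{(\mu_1+\mu_2)}$. -/

import Mathlib

noncomputable section

open CategoryTheory MonoidalCategory TensorProduct DirectSum Filter Topology

namespace QDiff

/-- A difference module over the difference field `(K, σ)`: a finite-dimensional `K`-vector space
with a `σ`-linear automorphism `Φ`. For `σ = σ_q` these are the `q`-difference modules. -/
structure DiffMod (K : Type) [Field K] (σ : K ≃+* K) where
  carrier : Type
  [addCommGroup : AddCommGroup carrier]
  [module : Module K carrier]
  [finite : Module.Finite K carrier]
  Φ : carrier →ₛₗ[(σ : K →+* K)] carrier
  bijective : Function.Bijective Φ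

namespace DiffMod

variable {K : Type} [Field K] {σ : K ≃+* K}

instance : CoeSort (DiffMod K σ) Type := ⟨carrier⟩

attribute [instance] addCommGroup module finite

/-- Morphisms are the `K`-linear maps that commute with `Φ`. -/
@[ext] structure Hom (M N : DiffMod K σ) where
  toLin : M →ₗ[K] N
  comm : ∀ x, toLin (M.Φ x) = N.Φ (toLin x)

instance : Category (DiffMod K σ) where
  Hom M N := Hom M N
  id M := ⟨LinearMap.id, fun _ => rfl⟩
  comp f g := ⟨g.toLin ∘ₗ f.toLin, fun x => by simp [f.comm, g.comm]⟩

@[ext] theorem hom_ext {M N : DiffMod K σ} {f g : M ⟶ N} (h : f.toLin = g.toLin) : f = g :=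
  Hom.ext h

@[simp] theorem id_toLin (M : DiffMod K σ) : Hom.toLin (𝟙 M) = LinearMap.id := rfl

@[simp] theorem comp_toLin {M N P : DiffMod K σ} (f : M ⟶ N) (g : N ⟶ P) :
    (f ≫ g).toLin = g.toLin ∘ₗ f.toLin := rfl

theorem exists_inverse_of_bijective {V : Type} [AddCommGroup V] [Module K V]
    (φ : V →ₛₗ[(σ : K →+* K)] V) (hφ : Function.Bijective φ) :
    ∃ g : V →ₛₗ[(σ.symm : K →+* K)] V, (∀ x, g (φ x) = x) ∧ ∀ x, φ (g x) = x := by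
  let e := Equiv.ofBijective φ hφ
  have he : ∀ x, e x = φ x := fun _ => rfl
  refine ⟨{ toFun := e.symm, map_add' := fun x y => ?_, map_smul' := fun c x => ?_ },
    fun x => e.symm_apply_apply x, fun x => e.apply_symm_apply x⟩
  · rw [Equiv.symm_apply_eq, he, map_add, ← he, ← he]; simp
  · rw [Equiv.symm_apply_eq, he, map_smulₛₗ, ← he]; simp

theorem bijective_tensorProduct_map {V W : Type} [AddCommGroup V] [Module K V] [AddCommGroup W]
    [Module K W] (φ : V →ₛₗ[(σ : K →+* K)] V) (ψ : W →ₛₗ[(σ : K →+* K)] W)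
    (hφ : Function.Bijective φ) (hψ : Function.Bijective ψ) :
    Function.Bijective (TensorProduct.map φ ψ) := by
  obtain ⟨g, h₁, h₂⟩ := exists_inverse_of_bijective φ hφ
  obtain ⟨g', h₁', h₂'⟩ := exists_inverse_of_bijective ψ hψ
  refine Function.bijective_iff_has_inverse.2 ⟨TensorProduct.map g g', fun x => ?_, fun x => ?_⟩
  · induction x with
    | zero => simp
    | tmul x y => simp [h₁, h₁']
    | add x y hx hy => rw [map_add, map_add, hx, hy]
  · induction x with
    | zero => simp
    | tmul x y => simp [h₂, h₂']
    | add x y hx hy => rw [map_add, map_add, hx, hy]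

/-- The unit object `(K, σ)`. -/
def unit : DiffMod K σ where
  carrier := K
  Φ := { toFun := σ, map_add' := map_add σ, map_smul' := fun c x => by simp }
  bijective := σ.bijective

/-- The tensor product over `K`, with `Φ (x ⊗ y) = Φ x ⊗ Φ y`. -/
def tensor (M N : DiffMod K σ) : DiffMod K σ where
  carrier := M ⊗[K] N
  Φ := TensorProduct.map M.Φ N.Φ
  bijective := bijective_tensorProduct_map M.Φ N.Φ M.bijective N.bijective

def isoMk {M N : DiffMod K σ} (e : M ≃ₗ[K] N) (he : ∀ x, e (M.Φ x) = N.Φ (e x)) : M ≅ N where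
  hom := ⟨e, he⟩
  inv := ⟨e.symm, fun x => by
    apply e.injective
    have := he (e.symm x)
    simp at this
    simp [this]⟩
  hom_inv_id := by ext x; simp
  inv_hom_id := by ext x; simp

theorem semilinear_ext {V W U : Type} [AddCommGroup V] [Module K V] [AddCommGroup W] [Module K W]
    [AddCommGroup U] [Module K U] (φ : V →ₛₗ[(σ : K →+* K)] V) (ψ : W →ₛₗ[(σ : K →+* K)] W)
    (χ : U →ₛₗ[(σ : K →+* K)] U) (f : V ⊗[K] W →ₗ[K] U)
    (h : ∀ x y, f (φ x ⊗ₜ ψ y) = χ (f (x ⊗ₜ y))) (t : V ⊗[K] W) :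
    f (TensorProduct.map φ ψ t) = χ (f t) := by
  induction t with
  | zero => simp
  | tmul x y => simpa using h x y
  | add x y hx hy => simp only [map_add, hx, hy]

def tensorMap {M M' N N' : DiffMod K σ} (f : M ⟶ M') (g : N ⟶ N') : tensor M N ⟶ tensor M' N' :=
  ⟨TensorProduct.map f.toLin g.toLin,
    semilinear_ext M.Φ N.Φ (TensorProduct.map M'.Φ N'.Φ) (TensorProduct.map f.toLin g.toLin)
      fun x y => by simp [f.comm, g.comm]⟩

def assoc (M N P : DiffMod K σ) : tensor (tensor M N) P ≅ tensor M (tensor N P) :=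
  isoMk (M := tensor (tensor M N) P) (N := tensor M (tensor N P)) (TensorProduct.assoc K M N P) <|
    semilinear_ext (TensorProduct.map M.Φ N.Φ) P.Φ (TensorProduct.map M.Φ (TensorProduct.map N.Φ P.Φ))
      (TensorProduct.assoc K M N P).toLinearMap fun t z => by
        induction t with
        | zero => simp
        | tmul x y => simp
        | add a b ha hb => simp only [map_add, TensorProduct.add_tmul, ha, hb]

def leftUnit (M : DiffMod K σ) : tensor unit M ≅ M :=
  isoMk (M := tensor unit M) (TensorProduct.lid K M) <|
    semilinear_ext unit.Φ M.Φ M.Φ (TensorProduct.lid K M).toLinearMap fun x y =>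
      (map_smulₛₗ M.Φ x y).symm

def rightUnit (M : DiffMod K σ) : tensor M unit ≅ M :=
  isoMk (M := tensor M unit) (TensorProduct.rid K M) <|
    semilinear_ext M.Φ unit.Φ M.Φ (TensorProduct.rid K M).toLinearMap fun x y =>
      (map_smulₛₗ M.Φ y x).symm

def swap (M N : DiffMod K σ) : tensor M N ≅ tensor N M :=
  isoMk (M := tensor M N) (N := tensor N M) (TensorProduct.comm K M N) <|
    semilinear_ext M.Φ N.Φ (TensorProduct.map N.Φ M.Φ) (TensorProduct.comm K M N).toLinearMap
      fun x y => by simp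

instance : MonoidalCategoryStruct (DiffMod K σ) where
  tensorObj := tensor
  whiskerLeft M _ _ f := tensorMap (𝟙 M) f
  whiskerRight f M := tensorMap f (𝟙 M)
  tensorHom := tensorMap
  tensorUnit := unit
  associator := assoc
  leftUnitor := leftUnit
  rightUnitor := rightUnit

/-- The underlying vector space. -/
def forget (K : Type) [Field K] (σ : K ≃+* K) : DiffMod K σ ⥤ ModuleCat.{0} K where
  obj M := ModuleCat.of K M
  map f := ModuleCat.ofHom f.toLin

instance : (forget K σ).Faithful where
  map_injective h := hom_ext (ModuleCat.hom_ext_iff.1 h)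

instance : MonoidalCategory (DiffMod K σ) :=
  Monoidal.induced (forget K σ)
    { μIso := fun _ _ => Iso.refl _
      εIso := Iso.refl _
      whiskerLeft_eq := fun _ _ _ _ => rfl
      whiskerRight_eq := fun _ _ => rfl
      tensorHom_eq := fun _ _ => rfl
      associator_eq := fun M N P =>
        ModuleCat.hom_ext (TensorProduct.ext_threefold (M := M) (N := N) (P := P) fun _ _ _ => rfl)
      leftUnitor_eq := fun M =>
        ModuleCat.hom_ext (TensorProduct.ext' (M := K) (N := M) fun _ _ => rfl)
      rightUnitor_eq := fun M =>
        ModuleCat.hom_ext (TensorProduct.ext' (M := M) (N := K) fun _ _ => rfl) }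

instance : SymmetricCategory (DiffMod K σ) where
  braiding M N := swap M N
  braiding_naturality_right M N _ _ :=
    hom_ext (TensorProduct.ext' (M := M) (N := N) fun _ _ => rfl)
  braiding_naturality_left {M _} _ P :=
    hom_ext (TensorProduct.ext' (M := M) (N := P) fun _ _ => rfl)
  hexagon_forward M N P :=
    hom_ext (TensorProduct.ext_threefold (M := M) (N := N) (P := P) fun _ _ _ => rfl)
  hexagon_reverse M N P :=
    hom_ext (TensorProduct.ext_threefold' (M := M) (N := N) (P := P) fun _ _ _ => rfl)
  symmetry M N :=
    hom_ext (TensorProduct.ext' (M := M) (N := N) fun _ _ => rfl)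

end DiffMod

/-- The function `F` is, on a punctured neighbourhood of `0`, the sum of the Laurent series `f`. -/
def IsExpansion (f : LaurentSeries ℂ) (F : ℂ → ℂ) : Prop :=
  ∀ᶠ z in 𝓝[≠] (0 : ℂ), HasSum (fun n : ℤ => f.coeff n * z ^ n) (F z)

theorem hasSum_coeff_mul (f g : LaurentSeries ℂ) (n : ℤ) :
    HasSum (fun j : ℤ => f.coeff (n - j) * g.coeff j) ((f * g).coeff n) := by
  rw [HahnSeries.coeff_mul]
  have hs : ∀ x : ℤ × ℤ, x ∈ Finset.antidiagonal f.isPWO_support g.isPWO_support n ↔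
      f.coeff x.1 ≠ 0 ∧ g.coeff x.2 ≠ 0 ∧ x.1 + x.2 = n := fun x => by simp
  generalize Finset.antidiagonal f.isPWO_support g.isPWO_support n = s at hs
  have h1 : ∑ x ∈ s, f.coeff x.1 * g.coeff x.2 =
      ∑ j ∈ s.image Prod.snd, f.coeff (n - j) * g.coeff j := by
    rw [Finset.sum_image]
    · refine Finset.sum_congr rfl fun x hx => ?_
      rw [← ((hs x).1 hx).2.2, add_sub_cancel_right]
    · intro x hx y hy h
      have hx := ((hs x).1 hx).2.2
      have hy := ((hs y).1 hy).2.2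
      refine Prod.ext ?_ h
      linarith [show x.2 = y.2 from h]
  rw [h1]
  refine hasSum_sum_of_ne_finset_zero fun j hj => ?_
  by_contra hne
  exact hj (Finset.mem_image.2 ⟨(n - j, j), (hs _).2 ⟨left_ne_zero_of_mul hne,
    right_ne_zero_of_mul hne, sub_add_cancel n j⟩, rfl⟩)

def shearEquiv : ℤ × ℤ ≃ ℤ × ℤ where
  toFun x := (x.1 - x.2, x.2)
  invFun x := (x.1 + x.2, x.2)
  left_inv x := by simp
  right_inv x := by simp

theorem hasSum_mul_zpow {f g : LaurentSeries ℂ} {a b z : ℂ} (hz : z ≠ 0)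
    (hf : HasSum (fun n : ℤ => f.coeff n * z ^ n) a)
    (hg : HasSum (fun n : ℤ => g.coeff n * z ^ n) b) :
    HasSum (fun n : ℤ => (f * g).coeff n * z ^ n) (a * b) := by
  have h : HasSum (fun x : ℤ × ℤ => f.coeff x.1 * z ^ x.1 * (g.coeff x.2 * z ^ x.2)) (a * b) :=
    HasSum.mul (f := fun n : ℤ => f.coeff n * z ^ n) (g := fun n : ℤ => g.coeff n * z ^ n) hf hg
      (summable_mul_of_summable_norm (f := fun n : ℤ => f.coeff n * z ^ n)
        (g := fun n : ℤ => g.coeff n * z ^ n) hf.summable.norm hg.summable.norm)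
  have h2 : HasSum (fun x : ℤ × ℤ => f.coeff (x.1 - x.2) * g.coeff x.2 * z ^ x.1) (a * b) := by
    rw [← shearEquiv.hasSum_iff] at h
    have he : (fun x : ℤ × ℤ => f.coeff x.1 * z ^ x.1 * (g.coeff x.2 * z ^ x.2)) ∘ shearEquiv =
        fun x : ℤ × ℤ => f.coeff (x.1 - x.2) * g.coeff x.2 * z ^ x.1 := by
      funext ⟨n, j⟩
      have hn : z ^ n = z ^ (n - j) * z ^ j := by rw [← zpow_add₀ hz, sub_add_cancel]
      show f.coeff (n - j) * z ^ (n - j) * (g.coeff j * z ^ j) = f.coeff (n - j) * g.coeff j * z ^ n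
      rw [hn]
      ring
    rwa [he] at h
  exact HasSum.prod_fiberwise (g := fun n => (f * g).coeff n * z ^ n) h2
    fun n => (hasSum_coeff_mul f g n).mul_right (z ^ n)

theorem IsExpansion.mul {f g : LaurentSeries ℂ} {F G : ℂ → ℂ} (hf : IsExpansion f F)
    (hg : IsExpansion g G) : IsExpansion (f * g) (F * G) := by
  filter_upwards [hf, hg, self_mem_nhdsWithin] with z hf hg hz
  exact hasSum_mul_zpow hz hf hg

theorem IsExpansion.exists_of_meromorphicAt {F : ℂ → ℂ} (hF : MeromorphicAt F 0) :
    ∃ f, IsExpansion f F := by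
  obtain ⟨n, p, hp⟩ := hF
  rw [hasFPowerSeriesAt_iff] at hp
  refine ⟨HahnSeries.ofSuppBddBelow
    (fun m : ℤ => if -(n : ℤ) ≤ m then p.coeff (m + n).toNat else 0) ⟨-n, fun m hm => ?_⟩, ?_⟩
  · by_contra h
    simp [h] at hm
  · filter_upwards [nhdsWithin_le_nhds hp, self_mem_nhdsWithin] with z hp hz
    have hz : z ≠ 0 := hz
    have hinj : Function.Injective (fun k : ℕ => (k : ℤ) - n) := fun a b h => by
      have h : (a : ℤ) - n = (b : ℤ) - n := h
      omega
    rw [← hinj.hasSum_iff]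
    · have := hp.mul_left (z ^ (-(n : ℤ)))
      simp only [zero_add, sub_zero, smul_eq_mul] at this
      convert! this using 1
      · ext k
        simp only [Function.comp_apply, HahnSeries.ofSuppBddBelow]
        simp [zpow_sub₀ hz]
        field_simp
      · simp [hz]
    · intro m hm
      have : ¬ (-(n : ℤ) ≤ m) := fun h => hm ⟨(m + n).toNat, by simp; omega⟩
      simp only [HahnSeries.ofSuppBddBelow, if_neg this, zero_mul]

theorem IsExpansion.eq_zero {f : LaurentSeries ℂ} (hf : IsExpansion f 0) : f = 0 := by
  by_contra h0
  let p : FormalMultilinearSeries ℂ ℂ ℂ :=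
    FormalMultilinearSeries.ofScalars ℂ fun k : ℕ => f.coeff (f.order + k)
  have hc : ∀ k, p.coeff k = f.coeff (f.order + k) := fun k =>
    FormalMultilinearSeries.coeff_ofScalars
  have hp : HasFPowerSeriesAt (fun z => if z = 0 then f.coeff f.order else 0) p 0 := by
    rw [hasFPowerSeriesAt_iff]
    have := eventually_nhdsWithin_iff.1 hf
    filter_upwards [this] with z hz
    by_cases hz0 : z = 0
    · subst hz0
      have h1 := hasSum_single (f := fun n : ℕ => (0 : ℂ) ^ n • p.coeff n) 0 fun n hn => by simp [hn]
      simpa [hc] using h1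
    · have hz := hz hz0
      have hinj : Function.Injective (fun k : ℕ => f.order + (k : ℤ)) := fun a b h => by
        have h : f.order + (a : ℤ) = f.order + (b : ℤ) := h
        omega
      rw [← hinj.hasSum_iff] at hz
      · have := hz.mul_left (z ^ (-f.order))
        simp only [Pi.zero_apply, mul_zero] at this
        simp only [zero_add, hz0, if_false]
        convert! this using 1
        ext k
        simp [hc, zpow_add₀ hz0]
        field_simp
      · intro m hm
        have : m < f.order := by
          by_contra h
          exact hm ⟨(m - f.order).toNat, by simp; omega⟩
        simp [HahnSeries.coeff_eq_zero_of_lt_order this]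
  have h1 := hp.continuousAt.tendsto.mono_left (nhdsWithin_le_nhds (s := {0}ᶜ))
  have h2 : Tendsto (fun z : ℂ => if z = 0 then f.coeff f.order else 0) (𝓝[≠] 0) (𝓝 0) := by
    refine tendsto_const_nhds.congr' ?_
    filter_upwards [self_mem_nhdsWithin] with z hz
    simp [show z ≠ 0 from hz]
  have := tendsto_nhds_unique h1 h2
  simp at this
  exact h0 this

theorem IsExpansion.zero : IsExpansion 0 0 := by
  refine Eventually.of_forall fun z => ?_
  simp

theorem IsExpansion.one : IsExpansion 1 1 := by
  refine Eventually.of_forall fun z => ?_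
  convert! hasSum_single (α := ℂ) (0 : ℤ) _ using 1
  · simp
  · intro n hn
    simp [HahnSeries.coeff_one, hn]

theorem IsExpansion.add {f g : LaurentSeries ℂ} {F G : ℂ → ℂ} (hf : IsExpansion f F)
    (hg : IsExpansion g G) : IsExpansion (f + g) (F + G) := by
  filter_upwards [hf, hg] with z hf hg
  simpa [add_mul] using hf.add hg

theorem IsExpansion.neg {f : LaurentSeries ℂ} {F : ℂ → ℂ} (hf : IsExpansion f F) :
    IsExpansion (-f) (-F) := by
  filter_upwards [hf] with z hf
  simpa using hf.neg

theorem IsExpansion.inv {f : LaurentSeries ℂ} {F : ℂ → ℂ} (hf : IsExpansion f F)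
    (hF : MeromorphicAt F 0) : IsExpansion f⁻¹ F⁻¹ := by
  by_cases h0 : f = 0
  · subst h0
    filter_upwards [hf] with z hf
    have : F z = 0 := hf.unique (by simp)
    simp [this]
  · obtain ⟨g, hg⟩ := IsExpansion.exists_of_meromorphicAt hF.inv
    have hne : ∀ᶠ z in 𝓝[≠] (0 : ℂ), F z ≠ 0 := by
      rcases hF.eventually_eq_zero_or_eventually_ne_zero with h | h
      · refine absurd (IsExpansion.eq_zero ?_) h0
        filter_upwards [hf, h] with z hf h
        simpa [h] using hf
      · exact h
    have h1 : f * g + -1 = 0 := by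
      apply IsExpansion.eq_zero
      filter_upwards [(hf.mul hg).add IsExpansion.one.neg, hne] with z h hne
      simpa [hne] using h
    have : g = f⁻¹ := by
      refine eq_inv_of_mul_eq_one_right ?_
      linear_combination h1
    rwa [← this]

/-- The Laurent expansions at `0` of the functions that are meromorphic on `S`, where `0 ∈ S`. -/
def meromorphicSubfield (S : Set ℂ) (h0 : (0 : ℂ) ∈ S) : Subfield (LaurentSeries ℂ) where
  carrier := {f | ∃ F : ℂ → ℂ, MeromorphicOn F S ∧ IsExpansion f F}
  zero_mem' := ⟨0, fun _ _ => MeromorphicAt.const 0 _, .zero⟩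
  one_mem' := ⟨1, fun _ _ => MeromorphicAt.const 1 _, .one⟩
  add_mem' := fun ⟨F, hF, hf⟩ ⟨G, hG, hg⟩ => ⟨F + G, hF.add hG, hf.add hg⟩
  mul_mem' := fun ⟨F, hF, hf⟩ ⟨G, hG, hg⟩ => ⟨F * G, hF.mul hG, hf.mul hg⟩
  neg_mem' := fun ⟨F, hF, hf⟩ => ⟨-F, hF.neg, hf.neg⟩
  inv_mem' := fun _ ⟨F, hF, hf⟩ => ⟨F⁻¹, hF.inv, hf.inv (hF 0 h0)⟩

/-- The automorphism `f(z) ↦ f(qz)` of `ℂ((z))`. -/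
def dilate (q : ℂˣ) : LaurentSeries ℂ →+* LaurentSeries ℂ where
  toFun f := ⟨fun n => ((q ^ n : ℂˣ) : ℂ) * f.coeff n,
    f.isPWO_support.mono fun n hn h => hn (by simp [h])⟩
  map_zero' := by ext; simp
  map_one' := by
    ext n
    by_cases h : n = 0 <;> simp [HahnSeries.coeff_one, h]
  map_add' f g := by ext; simp [mul_add]
  map_mul' f g := by
    ext n
    simp only [HahnSeries.coeff_mul, Finset.mul_sum]
    refine Finset.sum_congr ?_ fun x hx => ?_
    · ext x
      have h1 : (q : ℂ) ^ x.1 ≠ 0 := zpow_ne_zero _ q.ne_zero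
      have h2 : (q : ℂ) ^ x.2 ≠ 0 := zpow_ne_zero _ q.ne_zero
      simp [h1, h2]
    · have hx := (Finset.mem_antidiagonal.1 hx).2.2
      rw [← hx, zpow_add]
      push_cast
      ring

@[simp] theorem dilate_coeff (q : ℂˣ) (f : LaurentSeries ℂ) (n : ℤ) :
    (dilate q f).coeff n = ((q ^ n : ℂˣ) : ℂ) * f.coeff n := rfl

theorem dilate_dilate_inv (q : ℂˣ) (f : LaurentSeries ℂ) : dilate q (dilate q⁻¹ f) = f := by
  ext n
  have h : (q : ℂ) ^ n ≠ 0 := zpow_ne_zero _ q.ne_zero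
  simp [h]

theorem dilate_inv_dilate (q : ℂˣ) (f : LaurentSeries ℂ) : dilate q⁻¹ (dilate q f) = f := by
  ext n
  have h : (q : ℂ) ^ n ≠ 0 := zpow_ne_zero _ q.ne_zero
  simp [h]

/-- The substitution `f(z) ↦ f(z^l)` in `ℂ((z))`. -/
def powSubst (l : ℕ+) : LaurentSeries ℂ →+* LaurentSeries ℂ :=
  HahnSeries.embDomainRingHom (AddMonoidHom.mulLeft ((l : ℕ) : ℤ))
    (fun a b h => by simpa using h) (fun a b => by simp)

theorem powSubst_coeff_mul (l : ℕ+) (f : LaurentSeries ℂ) (n : ℤ) :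
    (powSubst l f).coeff (((l : ℕ) : ℤ) * n) = f.coeff n :=
  HahnSeries.embDomain_coeff (f := ⟨⟨AddMonoidHom.mulLeft ((l : ℕ) : ℤ), _⟩, _⟩)

theorem powSubst_coeff_of_not_dvd (l : ℕ+) (f : LaurentSeries ℂ) {n : ℤ}
    (h : ¬ ((l : ℕ) : ℤ) ∣ n) : (powSubst l f).coeff n = 0 :=
  HahnSeries.embDomain_of_notMem_range fun ⟨m, hm⟩ => h ⟨m, hm.symm⟩

/-- The three possible base fields `K`: `global` is the field of meromorphic functions on `ℂ`,
`convergent` is the field `ℂ({z})` of germs at `0` of meromorphic functions, `formal` is `ℂ((z))`. -/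
inductive BaseField
  | global
  | convergent
  | formal

/-- The base field as a field of Laurent series at `0`. -/
def BaseField.toSubfield : BaseField → Subfield (LaurentSeries ℂ)
  | .global => meromorphicSubfield Set.univ trivial
  | .convergent => meromorphicSubfield {0} rfl
  | .formal => ⊤

theorem IsExpansion.dilate {f : LaurentSeries ℂ} {F : ℂ → ℂ} (hf : IsExpansion f F) (q : ℂˣ) :
    IsExpansion (QDiff.dilate q f) (F ∘ fun z => q * z) := by
  have ht : Tendsto (fun z : ℂ => (q : ℂ) * z) (𝓝[≠] 0) (𝓝[≠] 0) := by
    refine tendsto_nhdsWithin_iff.2 ⟨?_, ?_⟩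
    · refine Tendsto.mono_left ?_ nhdsWithin_le_nhds
      exact Continuous.tendsto' (by fun_prop) _ _ (by simp)
    · filter_upwards [self_mem_nhdsWithin] with z hz
      simpa using hz
  filter_upwards [ht.eventually hf] with z hz
  simpa [mul_zpow, mul_comm, mul_left_comm, mul_assoc] using hz

theorem IsExpansion.powSubst {f : LaurentSeries ℂ} {F : ℂ → ℂ} (hf : IsExpansion f F) (l : ℕ+) :
    IsExpansion (QDiff.powSubst l f) (F ∘ fun z => z ^ (l : ℕ)) := by
  have ht : Tendsto (fun z : ℂ => z ^ (l : ℕ)) (𝓝[≠] 0) (𝓝[≠] 0) := by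
    refine tendsto_nhdsWithin_iff.2 ⟨?_, ?_⟩
    · refine Tendsto.mono_left ?_ nhdsWithin_le_nhds
      exact Continuous.tendsto' (by fun_prop) _ _ (by simp)
    · filter_upwards [self_mem_nhdsWithin] with z hz
      simpa using hz
  filter_upwards [ht.eventually hf] with z hz
  have hinj : Function.Injective (fun k : ℤ => ((l : ℕ) : ℤ) * k) := fun a b h => by
    simpa using h
  rw [← hinj.hasSum_iff]
  · simpa [Function.comp_def, powSubst_coeff_mul, zpow_mul] using hz
  · intro n hn
    rw [powSubst_coeff_of_not_dvd l f fun ⟨m, hm⟩ => hn ⟨m, hm.symm⟩, zero_mul]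

theorem dilate_mem (B : BaseField) (q : ℂˣ) {f : LaurentSeries ℂ} (hf : f ∈ B.toSubfield) :
    dilate q f ∈ B.toSubfield := by
  cases B with
  | global =>
    obtain ⟨F, hF, h⟩ := hf
    exact ⟨_, fun z _ => (hF _ trivial).comp_analyticAt (by fun_prop), h.dilate q⟩
  | convergent =>
    obtain ⟨F, hF, h⟩ := hf
    exact ⟨_, fun z hz => (hF _ (by simp [show z = 0 from hz])).comp_analyticAt (by fun_prop), h.dilate q⟩
  | formal => trivial

theorem powSubst_mem (B : BaseField) (l : ℕ+) {f : LaurentSeries ℂ} (hf : f ∈ B.toSubfield) :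
    powSubst l f ∈ B.toSubfield := by
  cases B with
  | global =>
    obtain ⟨F, hF, h⟩ := hf
    exact ⟨_, fun z _ => (hF _ trivial).comp_analyticAt (by fun_prop), h.powSubst l⟩
  | convergent =>
    obtain ⟨F, hF, h⟩ := hf
    exact ⟨_, fun z hz => (hF _ (by simp [show z = 0 from hz])).comp_analyticAt (by fun_prop), h.powSubst l⟩
  | formal => trivial

/-- The base field `K`. -/
abbrev BaseField.Carrier (B : BaseField) : Type := B.toSubfield

/-- The automorphism `σ_q : f(z) ↦ f(qz)` of `K`. -/
def BaseField.shift (B : BaseField) (q : ℂˣ) : B.Carrier ≃+* B.Carrier where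
  toFun f := ⟨dilate q f, dilate_mem B q f.2⟩
  invFun f := ⟨dilate q⁻¹ f, dilate_mem B q⁻¹ f.2⟩
  left_inv f := Subtype.ext (dilate_inv_dilate q f)
  right_inv f := Subtype.ext (dilate_dilate_inv q f)
  map_mul' f g := Subtype.ext (map_mul (dilate q) (f : LaurentSeries ℂ) g)
  map_add' f g := Subtype.ext (map_add (dilate q) (f : LaurentSeries ℂ) g)

/-- The ramified extension `K_l = K[z_l]`, `z_l ^ l = z`. Its elements are the series in the variable
`z_l` of the same kind as the elements of `K`; it is an extension of `K` through `z = z_l ^ l`. -/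
def BaseField.Ramified (B : BaseField) (_l : ℕ+) : Type := B.Carrier

instance (B : BaseField) (l : ℕ+) : Field (B.Ramified l) := inferInstanceAs (Field B.Carrier)

/-- The inclusion `K → K_l`, `f(z) ↦ f(z_l ^ l)`. -/
def BaseField.ramHom (B : BaseField) (l : ℕ+) : B.Carrier →+* B.Ramified l :=
  ((powSubst l).comp B.toSubfield.subtype).codRestrict B.toSubfield fun f => powSubst_mem B l f.2

instance (B : BaseField) (l : ℕ+) : Algebra B.Carrier (B.Ramified l) := (B.ramHom l).toAlgebra

/-- The automorphism `f(z_l) ↦ f(q_l z_l)` of `K_l`, for a number `q_l`. -/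
def BaseField.ramShift (B : BaseField) (l : ℕ+) (q : ℂˣ) : B.Ramified l ≃+* B.Ramified l :=
  B.shift q

/-- The `z_l`-adic valuation of a nonzero element of `K_l`. -/
def BaseField.valuation (B : BaseField) (l : ℕ+) (a : B.Ramified l) : ℤ :=
  HahnSeries.order (Subtype.val a : LaurentSeries ℂ)

/-- A compatible family of roots of `q`: `q_1 = q` and `q_{lm} ^ l = q_m`. -/
structure RootSystem (q : ℂˣ) where
  root : ℕ+ → ℂˣ
  root_one : root 1 = q
  root_mul_pow : ∀ l m : ℕ+, root (l * m) ^ (l : ℕ) = root m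

theorem RootSystem.root_pow {q : ℂˣ} (ρ : RootSystem q) (l : ℕ+) : ρ.root l ^ (l : ℕ) = q := by
  simpa [ρ.root_one] using ρ.root_mul_pow l 1

theorem BaseField.ramShift_ramHom (B : BaseField) {q : ℂˣ} (ρ : RootSystem q) (l : ℕ+)
    (f : B.Carrier) : B.ramShift l (ρ.root l) (B.ramHom l f) = B.ramHom l (B.shift q f) := by
  apply Subtype.ext
  show dilate (ρ.root l) (powSubst l f) = powSubst l (dilate q f)
  ext n
  rw [dilate_coeff]
  by_cases h : ((l : ℕ) : ℤ) ∣ n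
  · obtain ⟨m, rfl⟩ := h
    rw [powSubst_coeff_mul, powSubst_coeff_mul, dilate_coeff, zpow_mul, zpow_natCast, ρ.root_pow]
  · rw [powSubst_coeff_of_not_dvd l _ h, powSubst_coeff_of_not_dvd l _ h, mul_zero]

/-- The map `f(z_l) ↦ f(q_l z_l)`, as a `σ_q`-linear map of `K`-vector spaces. -/
def BaseField.ramSemilinear (B : BaseField) {q : ℂˣ} (ρ : RootSystem q) (l : ℕ+) :
    B.Ramified l →ₛₗ[(B.shift q : B.Carrier →+* B.Carrier)] B.Ramified l where
  toFun := B.ramShift l (ρ.root l)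
  map_add' := map_add _
  map_smul' c x := by
    rw [Algebra.smul_def, map_mul, Algebra.smul_def]
    exact congrArg (· * _) (B.ramShift_ramHom ρ l c)

namespace DiffMod

section Generic

variable {K : Type} [Field K] {σ : K ≃+* K}

/-- The subspace `N` is a submodule of the difference module `M`: it is stable by `Φ` and `Φ⁻¹`. -/
def IsStable (M : DiffMod K σ) (N : Submodule K M) : Prop := ∀ x, M.Φ x ∈ N ↔ x ∈ N

/-- A submodule, as a difference module. -/
def sub (M : DiffMod K σ) (N : Submodule K M) (h : M.IsStable N) : DiffMod K σ where
  carrier := N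
  Φ :=
    { toFun := fun x => ⟨M.Φ x, (h x).2 x.2⟩
      map_add' := fun x y => Subtype.ext (map_add M.Φ x.1 y.1)
      map_smul' := fun c x => Subtype.ext (map_smulₛₗ M.Φ c x.1) }
  bijective :=
    ⟨fun x y hxy => Subtype.ext (M.bijective.1 (Subtype.ext_iff.1 hxy)), fun y => by
      obtain ⟨x, hx⟩ := M.bijective.2 y
      exact ⟨⟨x, (h x).1 (hx ▸ y.2)⟩, Subtype.ext hx⟩⟩

/-- The quotient by a submodule. -/
def quot (M : DiffMod K σ) (N : Submodule K M) (h : M.IsStable N) : DiffMod K σ where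
  carrier := M ⧸ N
  Φ := N.mapQ N M.Φ fun x hx => (h x).2 hx
  bijective := by
    constructor
    · refine (injective_iff_map_eq_zero _).2 fun x hx => ?_
      obtain ⟨x, rfl⟩ := N.mkQ_surjective x
      exact (Submodule.Quotient.mk_eq_zero N).2
        ((h x).1 ((Submodule.Quotient.mk_eq_zero N).1 hx))
    · intro y
      obtain ⟨y, rfl⟩ := N.mkQ_surjective y
      obtain ⟨x, rfl⟩ := M.bijective.2 y
      exact ⟨N.mkQ x, rfl⟩

theorem IsStable.sSup {M : DiffMod K σ} {S : Set (Submodule K M)} (hS : ∀ N ∈ S, M.IsStable N) :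
    M.IsStable (sSup S) := by
  intro x
  obtain ⟨g, hg, -⟩ := exists_inverse_of_bijective M.Φ M.bijective
  constructor
  · intro hx
    rw [← hg x]
    have : SupSet.sSup S ≤ (SupSet.sSup S).comap g := sSup_le fun N hN y hy => by
      refine Submodule.mem_sSup_of_mem hN ?_
      obtain ⟨z, rfl⟩ := M.bijective.2 y
      rw [hg]
      exact (hS N hN z).1 hy
    exact this hx
  · intro hx
    have : SupSet.sSup S ≤ (SupSet.sSup S).comap M.Φ := sSup_le fun N hN y hy =>
      Submodule.mem_sSup_of_mem hN ((hS N hN y).2 hy)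
    exact this hx

theorem IsStable.map {M M' : DiffMod K σ} (f : M ⟶ M') {N : Submodule K M} (h : M.IsStable N) :
    M'.IsStable (N.map f.toLin) := by
  intro y
  constructor
  · rintro ⟨x, hx, hxy⟩
    obtain ⟨x, rfl⟩ := M.bijective.2 x
    refine ⟨x, (h x).1 hx, M'.bijective.1 ?_⟩
    rw [← f.comm, hxy]
  · rintro ⟨x, hx, rfl⟩
    exact ⟨M.Φ x, (h x).2 hx, f.comm x⟩

/-- `Devissage v M W s`: there is a tower `0 = W_0 ⊂ W_1 ⊂ ⋯ ⊂ W_r = W` of submodules of `M` whose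
quotients `W_i / W_{i-1}` are of rank one, with a basis vector `e_i` such that `Φ e_i = a_i e_i`,
and `s` is the multiset of the `v a_i`. The module `M` is triangularisable if this holds for `W = M`. -/
inductive Devissage (v : K → ℤ) (M : DiffMod K σ) : Submodule K M → Multiset ℤ → Prop
  | bot : Devissage v M ⊥ 0
  | step {W : Submodule K M} {s : Multiset ℤ} (hW : Devissage v M W s) (e : M) (a : K)
      (he : e ∉ W) (ha : a ≠ 0) (hΦ : M.Φ e - a • e ∈ W) :
      Devissage v M (W ⊔ K ∙ e) (v a ::ₘ s)

theorem Devissage.map {v : K → ℤ} {M M' : DiffMod K σ} (f : M ⟶ M') {W : Submodule K M}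
    {s : Multiset ℤ} (h : Devissage v M W s) :
    ∃ s' ≤ s, Devissage v M' (W.map f.toLin) s' := by
  induction h with
  | bot => exact ⟨0, le_rfl, by simpa using Devissage.bot⟩
  | @step W s hW e a he ha hΦ ih =>
    obtain ⟨s', hs, hd⟩ := ih
    rw [Submodule.map_sup, Submodule.map_span, Set.image_singleton]
    by_cases hm : f.toLin e ∈ W.map f.toLin
    · rw [sup_eq_left.2 ((Submodule.span_singleton_le_iff_mem _ _).2 hm)]
      exact ⟨s', hs.trans (Multiset.le_cons_self _ _), hd⟩
    · refine ⟨v a ::ₘ s', Multiset.cons_le_cons _ hs, hd.step _ a hm ha ⟨_, hΦ, ?_⟩⟩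
      rw [map_sub, map_smul, f.comm]

/-- The direct sum of a family of difference modules, when it is of finite dimension. -/
def directSum (X : ℚ → DiffMod K σ) (hX : Module.Finite K (⨁ μ, X μ)) : DiffMod K σ where
  carrier := ⨁ μ, X μ
  finite := hX
  Φ :=
    { toFun := DFinsupp.mapRange (fun μ => (X μ).Φ) fun μ => map_zero _
      map_add' := DFinsupp.mapRange_add _ _ fun μ x y => map_add _ x y
      map_smul' := fun c x => by
        ext μ
        exact map_smulₛₗ (X μ).Φ c (x μ) }
  bijective :=
    ⟨(DFinsupp.mapRange_injective _ fun μ => map_zero _).2 fun μ => (X μ).bijective.1,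
      (DFinsupp.mapRange_surjective _ fun μ => map_zero _).2 fun μ => (X μ).bijective.2⟩

end Generic

variable {B : BaseField} {q : ℂˣ}

/-- Extension of scalars: `K_l ⊗ M` with `Φ (f ⊗ x) = f(q_l z_l) ⊗ Φ x`, a `q_l`-difference module
over `K_l`. -/
def ramify (ρ : RootSystem q) (l : ℕ+) (M : DiffMod B.Carrier (B.shift q)) :
    DiffMod (B.Ramified l) (B.ramShift l (ρ.root l)) where
  carrier := B.Ramified l ⊗[B.Carrier] M
  Φ :=
    { toFun := TensorProduct.map (B.ramSemilinear ρ l) M.Φ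
      map_add' := map_add _
      map_smul' := fun c x => by
        induction x with
        | zero => rw [smul_zero, map_zero, smul_zero]
        | tmul x y =>
          rw [TensorProduct.smul_tmul', TensorProduct.map_tmul, TensorProduct.map_tmul,
            TensorProduct.smul_tmul']
          exact congrArg (· ⊗ₜ[B.Carrier] M.Φ y) (map_mul (B.ramShift l (ρ.root l)) c x)
        | add x y hx hy => rw [smul_add, map_add, map_add, hx, hy, smul_add] }
  bijective := bijective_tensorProduct_map (B.ramSemilinear ρ l) M.Φ
    (B.ramShift l (ρ.root l)).bijective M.bijective

/-- Extension of scalars of a morphism. -/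
def ramifyMap (ρ : RootSystem q) (l : ℕ+) {M N : DiffMod B.Carrier (B.shift q)} (f : M ⟶ N) :
    M.ramify ρ l ⟶ N.ramify ρ l :=
  ⟨LinearMap.baseChange (B.Ramified l) f.toLin,
    semilinear_ext (B.ramSemilinear ρ l) M.Φ (TensorProduct.map (B.ramSemilinear ρ l) N.Φ)
      (f.toLin.lTensor (B.Ramified l)) fun x y => by
        rw [LinearMap.lTensor_tmul, LinearMap.lTensor_tmul, TensorProduct.map_tmul, f.comm]⟩

/-- The slopes of `M`, counted with multiplicity, form the multiset `t`: for some ramification level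
`l` the module `K_l ⊗ M` has a tower of submodules with quotients of rank one `(K_l, a_i σ_{q_l})`,
and `t` consists of the `v(a_i) / l`. By Jordan-Hölder there is at most one such `t`; the Newton
function of `M` maps `μ` to the multiplicity of `μ` in `t`. -/
def HasSlopes (ρ : RootSystem q) (M : DiffMod B.Carrier (B.shift q)) (t : Multiset ℚ) : Prop :=
  ∃ (l : ℕ+) (s : Multiset ℤ), Devissage (B.valuation l) (M.ramify ρ l) ⊤ s ∧
    t = s.map fun k : ℤ => (k : ℚ) / (l : ℕ)

/-- All slopes of `M` belong to `I`. -/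
def SlopesIn (ρ : RootSystem q) (M : DiffMod B.Carrier (B.shift q)) (I : Set ℚ) : Prop :=
  ∃ t, HasSlopes ρ M t ∧ ∀ ν ∈ t, ν ∈ I

/-- `M` is pure of slope `μ`: its set of slopes is `{μ}`. -/
def IsPure (ρ : RootSystem q) (M : DiffMod B.Carrier (B.shift q)) (μ : ℚ) : Prop :=
  ∃ t, HasSlopes ρ M t ∧ t ≠ 0 ∧ ∀ ν ∈ t, ν = μ

/-- `M` is moderately irregular: it is a direct sum of pure submodules. -/
def IsModeratelyIrregular (ρ : RootSystem q) (M : DiffMod B.Carrier (B.shift q)) : Prop :=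
  ∃ (n : ℕ) (N : Fin n → Submodule B.Carrier M) (h : ∀ i, M.IsStable (N i)),
    DirectSum.IsInternal N ∧ ∀ i, ∃ μ, IsPure ρ (M.sub (N i) (h i)) μ

theorem SlopesIn.of_surjective {ρ : RootSystem q} {M N : DiffMod B.Carrier (B.shift q)}
    {I : Set ℚ} (h : SlopesIn ρ M I) (f : M ⟶ N) (hf : Function.Surjective f.toLin) :
    SlopesIn ρ N I := by
  obtain ⟨_, ⟨l, s, hs, rfl⟩, ht⟩ := h
  obtain ⟨s', hle, hs'⟩ := hs.map (ramifyMap ρ l f)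
  have htop : Submodule.map (Hom.toLin (ramifyMap ρ l f)) ⊤ = ⊤ := by
    rw [Submodule.map_top, LinearMap.range_eq_top]
    exact LinearMap.lTensor_surjective _ hf
  exact ⟨_, ⟨l, s', htop ▸ hs', rfl⟩, fun ν hν =>
    ht ν (Multiset.mem_of_le (Multiset.map_le_map hle) hν)⟩

/-- The largest submodule of `M` with all slopes in `I`, i.e. the sum of all submodules with all
slopes in `I`. -/
def largestSub (ρ : RootSystem q) (M : DiffMod B.Carrier (B.shift q)) (I : Set ℚ) :
    Submodule B.Carrier M :=
  sSup {N | ∃ h : M.IsStable N, SlopesIn ρ (M.sub N h) I}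

theorem largestSub_stable (ρ : RootSystem q) (M : DiffMod B.Carrier (B.shift q)) (I : Set ℚ) :
    M.IsStable (M.largestSub ρ I) :=
  IsStable.sSup fun _ hN => hN.1

theorem largestSub_mono (ρ : RootSystem q) (M : DiffMod B.Carrier (B.shift q)) {I J : Set ℚ}
    (h : I ⊆ J) : M.largestSub ρ I ≤ M.largestSub ρ J :=
  sSup_le_sSup fun _ ⟨hN, t, ht, hI⟩ => ⟨hN, t, ht, fun ν hν => h (hI ν hν)⟩

theorem map_largestSub (ρ : RootSystem q) {M N : DiffMod B.Carrier (B.shift q)} (f : M ⟶ N)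
    (I : Set ℚ) : M.largestSub ρ I ≤ (N.largestSub ρ I).comap f.toLin := by
  refine sSup_le fun W ⟨hW, hs⟩ => Submodule.map_le_iff_le_comap.1 (le_sSup ?_)
  refine ⟨hW.map f, hs.of_surjective (M := M.sub W hW) (N := N.sub _ (hW.map f))
    ⟨f.toLin.submoduleMap W, fun x => Subtype.ext (f.comm x.1)⟩ ?_⟩
  exact f.toLin.submoduleMap_surjective W

/-- The step `F^{≥ μ}(M)` of the canonical filtration by the slopes. -/
def filtGE (ρ : RootSystem q) (M : DiffMod B.Carrier (B.shift q)) (μ : ℚ) :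
    Submodule B.Carrier M := M.largestSub ρ (Set.Ici μ)

/-- The step `F^{> μ}(M)` of the canonical filtration by the slopes. -/
def filtGT (ρ : RootSystem q) (M : DiffMod B.Carrier (B.shift q)) (μ : ℚ) :
    Submodule B.Carrier M := M.largestSub ρ (Set.Ioi μ)

/-- The subquotient `M^{(μ)} = F^{≥ μ}(M) / F^{> μ}(M)`. -/
def slopePart (ρ : RootSystem q) (M : DiffMod B.Carrier (B.shift q)) (μ : ℚ) :
    DiffMod B.Carrier (B.shift q) :=
  (M.sub (M.filtGE ρ μ) (M.largestSub_stable ρ _)).quot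
    ((M.filtGT ρ μ).comap (M.filtGE ρ μ).subtype) fun x => M.largestSub_stable ρ _ x.1

/-- The map `M^{(μ)} → N^{(μ)}` induced by a morphism `M → N`. -/
def slopePartMap (ρ : RootSystem q) {M N : DiffMod B.Carrier (B.shift q)} (f : M ⟶ N) (μ : ℚ) :
    M.slopePart ρ μ ⟶ N.slopePart ρ μ :=
  ⟨Submodule.mapQ _ _ (f.toLin.restrict (map_largestSub ρ f (Set.Ici μ)))
      fun x hx => map_largestSub ρ f (Set.Ioi μ) hx,
    fun x => by
      obtain ⟨x, rfl⟩ := Submodule.mkQ_surjective _ x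
      exact congrArg (Submodule.mkQ _) (Subtype.ext (f.comm x.1))⟩

theorem finite_slopeParts (ρ : RootSystem q) (M : DiffMod B.Carrier (B.shift q)) :
    Module.Finite B.Carrier (⨁ μ, M.slopePart ρ μ) := by
  have key : ∀ μ ν, μ < ν → M.filtGE ρ ν ≤ M.filtGT ρ μ := fun μ ν h =>
    M.largestSub_mono ρ fun x hx => lt_of_lt_of_le h hx
  have hle : ∀ μ, M.filtGT ρ μ ≤ M.filtGE ρ μ := fun μ => M.largestSub_mono ρ Set.Ioi_subset_Ici_self
  let S : Set ℚ := {μ | M.filtGT ρ μ ≠ M.filtGE ρ μ}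
  have hS : S.Finite := by
    refine Set.Finite.of_finite_image (f := fun μ => Module.finrank B.Carrier (M.filtGE ρ μ))
      ((Set.finite_Iic (Module.finrank B.Carrier M)).subset ?_) ?_
    · rintro _ ⟨μ, -, rfl⟩
      exact Submodule.finrank_le _
    · have hlt : ∀ μ ∈ S, ∀ ν, μ < ν → Module.finrank B.Carrier (M.filtGE ρ ν) <
          Module.finrank B.Carrier (M.filtGE ρ μ) := fun μ hμ ν h =>
        Submodule.finrank_lt_finrank_of_lt ((key μ ν h).trans_lt (lt_of_le_of_ne (hle μ) hμ))
      intro μ hμ ν hν h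
      rcases lt_trichotomy μ ν with h' | h' | h'
      · exact absurd h (hlt μ hμ ν h').ne'
      · exact h'
      · exact absurd h (hlt ν hν μ h').ne
  refine ⟨?_⟩
  have htop : (⊤ : Submodule B.Carrier (⨁ μ, M.slopePart ρ μ)) =
      ⨆ μ ∈ hS.toFinset,
        LinearMap.range (DirectSum.lof B.Carrier ℚ (fun μ => M.slopePart ρ μ) μ) := by
    refine (eq_top_iff.2 fun x _ => ?_).symm
    induction x using DirectSum.induction_on with
    | zero => exact zero_mem _
    | of μ x =>
      by_cases hμ : μ ∈ S
      · exact Submodule.mem_iSup_of_mem μ (Submodule.mem_iSup_of_mem (hS.mem_toFinset.2 hμ) ⟨x, rfl⟩)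
      · have hx : x = 0 := by
          obtain ⟨x, rfl⟩ := Submodule.mkQ_surjective _ x
          refine (Submodule.Quotient.mk_eq_zero _).2 ?_
          have : M.filtGT ρ μ = M.filtGE ρ μ := not_not.1 hμ
          exact this.ge x.2
        rw [hx, map_zero]
        exact zero_mem _
    | add x y hx hy => exact add_mem (hx trivial) (hy trivial)
  rw [htop]
  exact Submodule.fg_biSup _ _ fun μ _ => Module.Finite.iff_fg.1 inferInstance

/-- The associated graded module `gr(M)`, the direct sum of the `M^{(μ)}` over all rational `μ`. -/
def grObj (ρ : RootSystem q) (M : DiffMod B.Carrier (B.shift q)) :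
    DiffMod B.Carrier (B.shift q) :=
  directSum (fun μ => M.slopePart ρ μ) (M.finite_slopeParts ρ)

/-- The functor `gr`. -/
def gr (B : BaseField) {q : ℂˣ} (ρ : RootSystem q) :
    DiffMod B.Carrier (B.shift q) ⥤ DiffMod B.Carrier (B.shift q) where
  obj M := M.grObj ρ
  map {M N} f := ⟨DirectSum.lmap fun μ => (slopePartMap ρ f μ).toLin,
    fun x : ⨁ μ, M.slopePart ρ μ => DFinsupp.ext fun μ => (slopePartMap ρ f μ).comm (x μ)⟩
  map_id M := hom_ext <| LinearMap.ext fun x : ⨁ μ, M.slopePart ρ μ => DFinsupp.ext fun μ => by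
    obtain ⟨y, hy⟩ := Submodule.mkQ_surjective _ (x μ)
    show Hom.toLin (slopePartMap ρ (𝟙 M) μ) (x μ) = x μ
    rw [← hy]
    rfl
  map_comp {M _ _} f g := hom_ext <| LinearMap.ext fun x : ⨁ μ, M.slopePart ρ μ =>
    DFinsupp.ext fun μ => by
      obtain ⟨y, hy⟩ := Submodule.mkQ_surjective _ (x μ)
      show Hom.toLin (slopePartMap ρ (f ≫ g) μ) (x μ) =
        Hom.toLin (slopePartMap ρ g μ) (Hom.toLin (slopePartMap ρ f μ) (x μ))
      rw [← hy]
      rfl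

/-- The class in `M^{(μ)} ⊆ gr(M)` of an element of `F^{≥ μ}(M)`. -/
def grMk (ρ : RootSystem q) (M : DiffMod B.Carrier (B.shift q)) (μ : ℚ) :
    M.filtGE ρ μ →ₗ[B.Carrier] (gr B ρ).obj M :=
  DirectSum.lof B.Carrier ℚ (fun μ => M.slopePart ρ μ) μ ∘ₗ
    ((M.filtGT ρ μ).comap (M.filtGE ρ μ).subtype).mkQ

end DiffMod

end QDiff

end

/-! The theorem rests on a clean splitting by slopes: for every upper set `I` of rationals, `M` has
a submodule with slopes in `I` whose quotient has slopes outside `I` (`exists_slope_splitting`).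
Slopes enter only through statements "some tower of `M` has all its slopes in `I`". These pass to
submodules, quotients, extensions and tensor products, and two of them, for `I` and for `J`, give
one for `I ∩ J` (`SlopesIn.inter`). This replaces Jordan-Hölder and shows that morphisms between
modules without common slopes vanish.

Towers exist by the Newton polygon method (`exists_towerAt`). A cyclic module is a linear
q-difference equation. After ramification its smallest slope is an integer `k`, and a solution `e f`
with `σ e = c z^k e` is the same as a nonzero morphism to a module of rank one. The series `f` is
found by a recursion on its coefficients, which meets no resonance if `c` is a nonzero root of
largest modulus of the characteristic polynomial. Because `|q| > 1`, the leading term of the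
recursion dominates, so `f` converges when the data do; and the equation continues `f`
meromorphically from a disc of radius `R` to one of radius `|q| R`. One statement,
`BaseField.exists_solution`, thus serves all three base fields.

Its first-order case solves `a σ f - b f = u` for `v(a) < v(b)`. It lets a step of large slope be
moved below steps of smaller slope, which yields the splitting over `K_l` (`Tower.exists_split`).
The submodule obtained is preserved by the roots of unity acting on `K_l`, since its image has
slopes disjoint from those of the quotient; by Galois descent it comes from `K`.

Consequently `M^{(μ)}` has slopes both `≥ μ` and `≤ μ`, so it is zero or pure, and `gr(M)` has the
dimension of `M`. If `gr(f) = 0` and `μ` is the smallest slope of a nonzero image `f(M)`, then `f(M)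
= f(F^{≥ μ}(M))` is contained in `F^{> μ}(N)`, a contradiction; this is faithfulness. Slopes add
under tensor products, so `x ⊗ y` induces a map `gr(M₁) ⊗ gr(M₂) → gr(M₁ ⊗ M₂)`. It is injective
because `F^{> μ+ν}(M₁ ⊗ M₂)` dies in `M₁/F^{> μ} ⊗ M₂/F^{> ν}`, whose slopes are `≤ μ + ν`, and
bijective by dimension. The coherence diagrams are checked on classes of homogeneous elements. -/

noncomputable section

open CategoryTheory MonoidalCategory TensorProduct DirectSum Filter Topology

namespace QDiff

namespace DiffMod

/-! ### Towers of rank-one steps over a general difference field. -/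

section Towers

variable {K : Type} [Field K] {σ : K ≃+* K}

/-- A tower of submodules of `M` from `N` to `W`, whose steps are generated by one element that is
an eigenvector modulo the previous step, with an eigenvalue `a` such that `v a ∈ I`. In contrast to
`Devissage` the steps need not be strict. -/
inductive Tower (v : K → ℤ) (M : DiffMod K σ) (I : Set ℤ) (N : Submodule K M) :
    Submodule K M → Prop
  | refl : Tower v M I N N
  | step {W : Submodule K M} (hW : Tower v M I N W) (e : M) (a : K) (ha : a ≠ 0) (hv : v a ∈ I)
      (hΦ : M.Φ e - a • e ∈ W) : Tower v M I N (W ⊔ K ∙ e)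

/-- Steps with `e` already in the previous stage can be dropped. Allowing them makes towers stable
under images and under joining a fixed submodule. -/
theorem tower_iff_devissage {v : K → ℤ} {M : DiffMod K σ} {I : Set ℤ} {W : Submodule K M} :
    Tower v M I ⊥ W ↔ ∃ s, Devissage v M W s ∧ ∀ k ∈ s, k ∈ I := by
  constructor
  · intro h
    induction h with
    | refl => exact ⟨0, .bot, by simp⟩
    | @step W hW e a ha hv hΦ ih =>
      obtain ⟨s, hs, hI⟩ := ih
      by_cases he : e ∈ W
      · rw [sup_eq_left.2 ((Submodule.span_singleton_le_iff_mem _ _).2 he)]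
        exact ⟨s, hs, hI⟩
      · refine ⟨_, hs.step e a he ha hΦ, fun k hk => ?_⟩
        rcases Multiset.mem_cons.1 hk with rfl | hk
        exacts [hv, hI k hk]
  · rintro ⟨s, hs, hI⟩
    induction hs with
    | bot => exact .refl
    | step hW e a he ha hΦ ih =>
      exact (ih fun k hk => hI k (Multiset.mem_cons_of_mem hk)).step e a ha
        (hI _ (Multiset.mem_cons_self _ _)) hΦ

namespace Tower

variable {v : K → ℤ} {M : DiffMod K σ} {I J : Set ℤ} {N W X : Submodule K M}

theorem trans (h : Tower v M I N W) (h' : Tower v M I W X) : Tower v M I N X := by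
  induction h' with
  | refl => exact h
  | step _ e a ha hv hΦ ih => exact ih.step e a ha hv hΦ

theorem mono (h : Tower v M I N W) (hIJ : I ⊆ J) : Tower v M J N W := by
  induction h with
  | refl => exact .refl
  | step _ e a ha hv hΦ ih => exact ih.step e a ha (hIJ hv) hΦ

theorem sup_right (h : Tower v M I N W) (X : Submodule K M) : Tower v M I (N ⊔ X) (W ⊔ X) := by
  induction h with
  | refl => exact .refl
  | step _ e a ha hv hΦ ih =>
    rw [sup_right_comm]
    exact ih.step e a ha hv (Submodule.mem_sup_left hΦ)

theorem isStable (h : Tower v M I N W) (hN : M.IsStable N) : M.IsStable W := by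
  induction h with
  | refl => exact hN
  | @step W _ e a ha _ hΦ ih =>
    have key : ∀ c, M.Φ (c • e) - (σ c * a) • e ∈ W := fun c => by
      rw [map_smulₛₗ, mul_smul, RingHom.coe_coe, ← smul_sub]
      exact W.smul_mem _ hΦ
    intro x
    simp only [Submodule.mem_sup, Submodule.mem_span_singleton]
    constructor
    · rintro ⟨w, hw, _, ⟨c, rfl⟩, h⟩
      -- Modulo `W`, `Φ` sends `σ⁻¹(c / a) e` to `c e`; this is where `a ≠ 0` matters.
      refine ⟨x - σ.symm (c / a) • e, (ih _).1 ?_, _, ⟨_, rfl⟩, sub_add_cancel _ _⟩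
      have := key (σ.symm (c / a))
      rw [RingEquiv.apply_symm_apply, div_mul_cancel₀ _ ha] at this
      rw [map_sub, ← h, show w + c • e - M.Φ (σ.symm (c / a) • e) =
        w - (M.Φ (σ.symm (c / a) • e) - c • e) by abel]
      exact W.sub_mem hw this
    · rintro ⟨w, hw, _, ⟨c, rfl⟩, rfl⟩
      refine ⟨M.Φ w + (M.Φ (c • e) - (σ c * a) • e), W.add_mem ((ih w).2 hw) (key c), _,
        ⟨σ c * a, rfl⟩, ?_⟩
      rw [map_add]
      abel

/-- Towers are compatible with base change along a homomorphism of difference fields. -/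
theorem span_image {K' : Type} [Field K'] {σ' : K' ≃+* K'} {v' : K' → ℤ} {M' : DiffMod K' σ'}
    {I' : Set ℤ} {τ : K →+* K'} (γ : M →ₛₗ[τ] M') (hγ : ∀ x, γ (M.Φ x) = M'.Φ (γ x))
    (hv : ∀ a, a ≠ 0 → v a ∈ I → v' (τ a) ∈ I') (h : Tower v M I N W) :
    Tower v' M' I' (Submodule.span K' (γ '' N)) (Submodule.span K' (γ '' W)) := by
  induction h with
  | refl => exact .refl
  | @step W _ e a ha hva hΦ ih =>
    have : Submodule.span K' (γ '' (W ⊔ K ∙ e : Submodule K M)) =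
        Submodule.span K' (γ '' W) ⊔ K' ∙ γ e := by
      apply le_antisymm
      · refine Submodule.span_le.2 ?_
        rintro _ ⟨x, hx, rfl⟩
        obtain ⟨w, hw, y, hy, rfl⟩ := Submodule.mem_sup.1 hx
        obtain ⟨c, rfl⟩ := Submodule.mem_span_singleton.1 hy
        rw [SetLike.mem_coe, map_add, map_smulₛₗ]
        exact add_mem (Submodule.mem_sup_left (Submodule.subset_span ⟨w, hw, rfl⟩))
          (Submodule.mem_sup_right (Submodule.smul_mem _ _ (Submodule.mem_span_singleton_self _)))
      · refine sup_le (Submodule.span_mono (Set.image_mono ?_)) ?_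
        · exact fun x hx => Submodule.mem_sup_left hx
        · rw [Submodule.span_singleton_le_iff_mem]
          exact Submodule.subset_span
            ⟨e, Submodule.mem_sup_right (Submodule.mem_span_singleton_self _), rfl⟩
    rw [this]
    refine ih.step (γ e) (τ a) ((map_ne_zero τ).2 ha) (hv a ha hva) ?_
    rw [← hγ, ← map_smulₛₗ, ← map_sub]
    exact Submodule.subset_span ⟨_, hΦ, rfl⟩

theorem map {M' : DiffMod K σ} (f : M ⟶ M') (h : Tower v M I N W) :
    Tower v M' I (N.map f.toLin) (W.map f.toLin) := by
  have := h.span_image (v' := v) (I' := I) f.toLin f.comm fun a _ h => h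
  rwa [← Submodule.map_coe, ← Submodule.map_coe, Submodule.span_eq, Submodule.span_eq] at this

/-- Either `e` is congruent modulo `W` to some `f n`, and `n` spans the step of the preimage; or the
step adds nothing to the preimage, because a vector `w + c e` in the image of `f` with `c ≠ 0` would
lift `e` modulo `W`. -/
theorem comap {M' : DiffMod K σ} (f : M ⟶ M') {N W : Submodule K M'} (h : Tower v M' I N W)
    (hN : M'.IsStable N) : Tower v M I (N.comap f.toLin) (W.comap f.toLin) := by
  induction h with
  | refl => exact .refl
  | @step W hW e a ha hva hΦ ih =>
    by_cases hex : ∃ n, f.toLin n - e ∈ W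
    · obtain ⟨n, hn⟩ := hex
      have : (W ⊔ K ∙ e).comap f.toLin = W.comap f.toLin ⊔ K ∙ n := by
        apply le_antisymm
        · intro x hx
          obtain ⟨w, hw, y, hy, h⟩ := Submodule.mem_sup.1 (Submodule.mem_comap.1 hx)
          obtain ⟨c, rfl⟩ := Submodule.mem_span_singleton.1 hy
          refine Submodule.mem_sup.2 ⟨x - c • n, ?_, c • n, Submodule.smul_mem _ _
            (Submodule.mem_span_singleton_self _), sub_add_cancel _ _⟩
          rw [Submodule.mem_comap, map_sub, map_smul, ← h,
            show w + c • e - c • f.toLin n = w - c • (f.toLin n - e) by module]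
          exact W.sub_mem hw (W.smul_mem _ hn)
        · refine sup_le (Submodule.comap_mono le_sup_left) ?_
          rw [Submodule.span_singleton_le_iff_mem, Submodule.mem_comap]
          exact Submodule.mem_sup.2
            ⟨_, hn, e, Submodule.mem_span_singleton_self _, sub_add_cancel _ _⟩
      rw [this]
      refine ih.step n a ha hva ?_
      rw [Submodule.mem_comap, map_sub, f.comm, map_smul,
        show M'.Φ (f.toLin n) - a • f.toLin n =
          M'.Φ (f.toLin n - e) - a • (f.toLin n - e) + (M'.Φ e - a • e) by
            rw [map_sub]; module]
      exact W.add_mem (W.sub_mem ((hW.isStable hN _).2 hn) (W.smul_mem _ hn)) hΦ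
    · have : (W ⊔ K ∙ e).comap f.toLin = W.comap f.toLin := by
        refine le_antisymm (fun x hx => ?_) (Submodule.comap_mono le_sup_left)
        obtain ⟨w, hw, y, hy, h⟩ := Submodule.mem_sup.1 (Submodule.mem_comap.1 hx)
        obtain ⟨c, rfl⟩ := Submodule.mem_span_singleton.1 hy
        by_cases hc : c = 0
        · rw [Submodule.mem_comap, ← h, hc, zero_smul, add_zero]
          exact hw
        · refine absurd ⟨c⁻¹ • x, ?_⟩ hex
          rw [map_smul, ← h, smul_add, inv_smul_smul₀ hc, add_sub_cancel_right]
          exact W.smul_mem _ hw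
      rw [this]
      exact ih

/-- Eigenvalues multiply: `Φβ(e, e') - ab β(e, e') = β(Φe - ae, Φe') + a β(e, Φe' - be')`, so `β(e,
e')` is an eigenvector modulo the earlier products. -/
theorem map₂ {M' T : DiffMod K σ} {J L : Set ℤ} {W : Submodule K M} {W' : Submodule K M'}
    (hv : ∀ a b, a ≠ 0 → b ≠ 0 → v a ∈ I → v b ∈ J → v (a * b) ∈ L)
    (β : M →ₗ[K] M' →ₗ[K] T) (hβ : ∀ x y, β (M.Φ x) (M'.Φ y) = T.Φ (β x y))
    (h : Tower v M I ⊥ W) (h' : Tower v M' J ⊥ W') :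
    Tower v T L ⊥ (Submodule.map₂ β W W') := by
  induction h with
  | refl =>
    rw [Submodule.map₂_bot_left]
    exact .refl
  | @step W _ e a ha hva hΦ ih =>
    rw [Submodule.map₂_sup_left]
    -- The stages `V` are kept inside `W'` because the first error term, `β(Φe - ae, Φe')`, is
    -- absorbed by `map₂ β W W'` only when `Φe' ∈ W'`.
    suffices H : ∀ V ≤ W', Tower v M' J ⊥ V →
        Tower v T L ⊥ (Submodule.map₂ β W W' ⊔ Submodule.map₂ β (K ∙ e) V) from H W' le_rfl h'
    intro V hVW hV
    induction hV with
    | refl => rwa [Submodule.map₂_bot_right, sup_bot_eq]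
    | @step V _ e' b hb hvb hΦ' ih' =>
      rw [Submodule.map₂_sup_right, Submodule.map₂_span_span, Set.image2_singleton, ← sup_assoc]
      have he' : e' ∈ W' := hVW (Submodule.mem_sup_right (Submodule.mem_span_singleton_self _))
      have hΦe' : M'.Φ e' ∈ W' := by
        rw [← sub_add_cancel (M'.Φ e') (b • e')]
        exact W'.add_mem (hVW (Submodule.mem_sup_left hΦ')) (W'.smul_mem _ he')
      refine (ih' (le_sup_left.trans hVW)).step (β e e') (a * b) (mul_ne_zero ha hb)
        (hv a b ha hb hva hvb) ?_
      have : T.Φ (β e e') - (a * b) • β e e' =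
          β (M.Φ e - a • e) (M'.Φ e') + a • β e (M'.Φ e' - b • e') := by
        rw [← hβ, map_sub, map_sub, LinearMap.sub_apply, map_smul, map_smul, LinearMap.smul_apply,
          smul_sub, smul_smul]
        abel
      rw [this]
      exact Submodule.add_mem _ (Submodule.mem_sup_left (Submodule.apply_mem_map₂ _ hΦ hΦe'))
        (Submodule.smul_mem _ _ (Submodule.mem_sup_right (Submodule.apply_mem_map₂ _
          (Submodule.mem_span_singleton_self _) hΦ')))

end Tower

/-- The inclusion of a submodule. -/
def subι (M : DiffMod K σ) (N : Submodule K M) (h : M.IsStable N) : M.sub N h ⟶ M :=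
  ⟨N.subtype, fun _ => rfl⟩

/-- The projection to a quotient module. -/
def quotπ (M : DiffMod K σ) (N : Submodule K M) (h : M.IsStable N) : M ⟶ M.quot N h :=
  ⟨N.mkQ, fun _ => rfl⟩

theorem stable_bot (M : DiffMod K σ) : M.IsStable ⊥ := fun x => by
  rw [Submodule.mem_bot, Submodule.mem_bot]
  exact ⟨fun h => M.bijective.1 (h.trans (map_zero M.Φ).symm), fun h => h ▸ map_zero M.Φ⟩

/-- The valuation `v` is multiplicative and invariant under `σ`. -/
structure IsInvariantValuation (σ : K ≃+* K) (v : K → ℤ) : Prop where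
  map_mul : ∀ a b, a ≠ 0 → b ≠ 0 → v (a * b) = v a + v b
  map_shift : ∀ a, v (σ a) = v a

namespace Tower

variable {v : K → ℤ} {M : DiffMod K σ} {I J : Set ℤ} {N W X : Submodule K M}

/-- At the step that first contains `e = w + c e'`, comparing the coefficients of `e'` in `Φ e = a
e` gives `σ(c) b = a c`, hence `v b = v a` by invariance of `v` under `σ`. -/
theorem mem_of_eigenvector (hσ : IsInvariantValuation σ v) (h : Tower v M I ⊥ W) {e : M} {a : K}
    (heW : e ∈ W) (he : e ≠ 0) (ha : a ≠ 0) (hΦ : M.Φ e = a • e) : v a ∈ I := by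
  induction h with
  | refl => exact absurd ((Submodule.mem_bot K).1 heW) he
  | @step W hW e' b hb hvb hΦ' ih =>
    obtain ⟨w, hw, y, hy, hwy⟩ := Submodule.mem_sup.1 heW
    obtain ⟨c, rfl⟩ := Submodule.mem_span_singleton.1 hy
    by_cases he'W : e' ∈ W
    · exact ih (hwy ▸ W.add_mem hw (W.smul_mem _ he'W))
    by_cases hc : c = 0
    · exact ih (hwy ▸ by simpa [hc] using hw)
    have hst := hW.isStable (stable_bot M)
    have hmem : (σ c * b - a * c) • e' ∈ W := by
      have h1 : M.Φ (w + c • e') = a • (w + c • e') := by rw [hwy, hΦ]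
      rw [map_add, map_smulₛₗ, RingHom.coe_coe] at h1
      have h2 : (σ c * b - a * c) • e' = a • w - M.Φ w - σ c • (M.Φ e' - b • e') := by
        rw [eq_sub_of_add_eq h1]
        module
      rw [h2]
      exact W.sub_mem (W.sub_mem (W.smul_mem _ hw) ((hst w).2 hw)) (W.smul_mem _ hΦ')
    have h0 : σ c * b = a * c := by
      by_contra hne
      exact he'W ((W.smul_mem_iff (sub_ne_zero.2 hne)).1 hmem)
    have hσc : σ c ≠ 0 := (map_ne_zero σ).2 hc
    have h3 := congrArg v h0
    rw [hσ.map_mul _ _ hσc hb, hσ.map_mul _ _ ha hc, hσ.map_shift, add_comm,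
      add_left_inj] at h3
    exact h3 ▸ hvb

/-- The substitute for Jordan-Hölder: a strict step of the second tower is an eigenvector in `M /
W`, a module that inherits the slopes `I`, so its slope belongs to both sets. -/
theorem inter (hσ : IsInvariantValuation σ v) (hI : Tower v M I ⊥ ⊤) (hJ : Tower v M J N W)
    (hN : M.IsStable N) : Tower v M (I ∩ J) N W := by
  induction hJ with
  | refl => exact .refl
  | @step W hW e a ha hva hΦ ih =>
    by_cases he : e ∈ W
    · rwa [sup_eq_left.2 ((Submodule.span_singleton_le_iff_mem _ _).2 he)]
    · refine ih.step e a ha ⟨?_, hva⟩ hΦ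
      have h := hI.map (M.quotπ W (hW.isStable hN))
      rw [Submodule.map_bot] at h
      refine h.mem_of_eigenvector hσ (e := W.mkQ e) ⟨e, trivial, rfl⟩
        (fun h => he ((Submodule.Quotient.mk_eq_zero W).1 h)) ha ?_
      have := (Submodule.Quotient.mk_eq_zero W).2 hΦ
      rw [Submodule.Quotient.mk_sub, Submodule.Quotient.mk_smul, sub_eq_zero] at this
      exact this

theorem eq_of_empty (h : Tower v M ∅ N W) : W = N := by
  induction h with
  | refl => rfl
  | step _ _ _ _ hv => exact hv.elim

/-- A submodule with slopes in `I` is contained in every submodule with cokernel of slopes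
outside `I`. -/
theorem le_of_disjoint (hσ : IsInvariantValuation σ v) (hI : Tower v M I ⊥ W)
    (hJ : Tower v M J N ⊤) (hN : M.IsStable N) (hIJ : I ∩ J = ∅) : W ≤ N := by
  have h1 := hI.map (M.quotπ N hN)
  have h2 := hJ.map (M.quotπ N hN)
  have e1 : N.map (M.quotπ N hN).toLin = ⊥ := N.mkQ_map_self
  have e2 : (⊤ : Submodule K M).map (M.quotπ N hN).toLin = ⊤ := by
    rw [Submodule.map_top]
    exact N.range_mkQ
  rw [e1, e2] at h2
  rw [Submodule.map_bot] at h1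
  have h3 := h2.inter hσ h1 (stable_bot _)
  rw [Set.inter_comm, hIJ] at h3
  have := h3.eq_of_empty
  intro x hx
  have hx : (M.quotπ N hN).toLin x ∈ W.map (M.quotπ N hN).toLin := ⟨x, hx, rfl⟩
  rw [this] at hx
  exact (Submodule.Quotient.mk_eq_zero N).1 hx

/-- Solves `(Φ - b) x = w` modulo `N` from the top step down: the coefficient `c` of `e` is removed
by a solution of the rank-one equation `a σ f - b f = c`, and the remainder lies in the smaller
stage. -/
theorem exists_smul_sub (hI : Tower v M I N W)
    (hE : ∀ a b : K, a ≠ 0 → b ≠ 0 → v a < v b → ∀ u, ∃ f, a * σ f - b * f = u) {b : K}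
    (hb : b ≠ 0) (hvb : ∀ k ∈ I, k < v b) :
    ∀ w ∈ W, ∃ x ∈ W, M.Φ x - b • x - w ∈ N := by
  induction hI with
  | refl => exact fun w hw => ⟨0, zero_mem _, by simpa using hw⟩
  | @step W hW e a ha hva hΦ ih =>
    intro w hw
    obtain ⟨w, hwW, y, hy, rfl⟩ := Submodule.mem_sup.1 hw
    obtain ⟨c, rfl⟩ := Submodule.mem_span_singleton.1 hy
    obtain ⟨f, hf⟩ := hE a b ha hb (hvb _ hva) c
    obtain ⟨x, hx, hxN⟩ := ih (w - σ f • (M.Φ e - a • e)) (W.sub_mem hwW (W.smul_mem _ hΦ))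
    refine ⟨x + f • e, Submodule.add_mem_sup hx
      (Submodule.smul_mem _ _ (Submodule.mem_span_singleton_self _)), ?_⟩
    convert hxN using 1
    rw [map_add, map_smulₛₗ, RingHom.coe_coe, ← hf]
    module

/-- The canonical splitting of a tower according to an upper set of slopes. -/
theorem exists_split (hE : ∀ a b : K, a ≠ 0 → b ≠ 0 → v a < v b → ∀ u, ∃ f, a * σ f - b * f = u)
    (hJ : IsUpperSet J) (h : Tower v M I ⊥ W) :
    ∃ N ≤ W, Tower v M J ⊥ N ∧ Tower v M Jᶜ N W := by
  induction h with
  | refl => exact ⟨⊥, le_rfl, .refl, .refl⟩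
  | @step W hW e a ha hva hΦ ih =>
    obtain ⟨N, hNW, hN, hNW'⟩ := ih
    by_cases haJ : v a ∈ J
    · obtain ⟨x, hx, hxN⟩ := hNW'.exists_smul_sub hE ha
        (fun k hk => by
          by_contra! hle
          exact hk (hJ hle haJ)) _ (W.neg_mem hΦ)
      have hW' : W ⊔ K ∙ e = W ⊔ K ∙ (e + x) := by
        apply le_antisymm <;> refine sup_le le_sup_left ?_ <;>
          rw [Submodule.span_singleton_le_iff_mem]
        · have := Submodule.add_mem_sup (W.neg_mem hx) (Submodule.mem_span_singleton_self (R := K)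
            (e + x))
          rwa [neg_add_cancel_comm_assoc] at this
        · exact Submodule.add_mem _ (Submodule.mem_sup_right (Submodule.mem_span_singleton_self _))
            (Submodule.mem_sup_left hx)
      rw [hW']
      refine ⟨N ⊔ K ∙ (e + x), sup_le_sup_right hNW _, hN.step _ a ha haJ ?_, hNW'.sup_right _⟩
      convert hxN using 1
      rw [map_add]
      module
    · exact ⟨N, hNW.trans le_sup_left, hN, hNW'.step e a ha haJ hΦ⟩

end Tower

end Towers
end DiffMod

/-! ### Linear recursions and coefficients of products. -/

section LinearRecursion

/-- The solution of the linear recursion `D k * f k = ∑ j < k, A k j * f j + u k`. -/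
def linearRecursion (D : ℕ → ℂ) (A : ℕ → ℕ → ℂ) (u : ℕ → ℂ) : ℕ → ℂ
  | k => (∑ j : Fin k, A k j * linearRecursion D A u j + u k) / D k

theorem linearRecursion_eq (D : ℕ → ℂ) (A : ℕ → ℕ → ℂ) (u : ℕ → ℂ) (k : ℕ) :
    linearRecursion D A u k =
      (∑ j ∈ Finset.range k, A k j * linearRecursion D A u j + u k) / D k := by
  rw [linearRecursion, Finset.sum_range fun j => A k j * linearRecursion D A u j]

/-- A majorant that reproduces itself: `∑_{j<k} C (1 + C)^j = (1 + C)^k - 1`, and the inhomogeneous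
term supplies the missing `1`. -/
theorem norm_linearRecursion_le {D : ℕ → ℂ} {A : ℕ → ℕ → ℂ} {u : ℕ → ℂ} {C r : ℝ} (hC : 0 ≤ C)
    (hr : 0 ≤ r) (hA : ∀ k, ∀ j < k, ‖A k j / D k‖ ≤ C * r ^ (k - j))
    (hu : ∀ k, ‖u k / D k‖ ≤ C * r ^ k) (k : ℕ) :
    ‖linearRecursion D A u k‖ ≤ C * ((1 + C) * r) ^ k := by
  induction k using Nat.strong_induction_on with
  | _ k ih =>
    have hgeom : ∑ j ∈ Finset.range k, C * (1 + C) ^ j = (1 + C) ^ k - 1 := by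
      have := mul_geom_sum (1 + C) k
      rw [add_sub_cancel_left, Finset.mul_sum] at this
      exact this
    rw [linearRecursion_eq, add_div, Finset.sum_div]
    calc _ ≤ ∑ j ∈ Finset.range k, C * r ^ k * (C * (1 + C) ^ j) + C * r ^ k := by
          refine (norm_add_le _ _).trans (add_le_add ((norm_sum_le _ _).trans
            (Finset.sum_le_sum fun j hj => ?_)) (hu k))
          have hj := Finset.mem_range.1 hj
          rw [mul_div_right_comm, norm_mul]
          refine (mul_le_mul (hA k j hj) (ih j hj) (norm_nonneg _) (by positivity)).trans_eq ?_
          rw [mul_pow, ← Nat.sub_add_cancel hj.le, pow_add, Nat.add_sub_cancel]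
          ring
      _ = C * ((1 + C) * r) ^ k := by
          rw [← Finset.mul_sum, hgeom, mul_pow]
          ring

end LinearRecursion

section Coefficients

theorem coeff_mul_of_coeff_eq_zero {c f : LaurentSeries ℂ} {m₀ : ℤ}
    (hc : ∀ m < 0, c.coeff m = 0) (hf : ∀ m < m₀, f.coeff m = 0) (k : ℕ) :
    (c * f).coeff (m₀ + k) =
      ∑ j ∈ Finset.range (k + 1), c.coeff ((k - j : ℕ) : ℤ) * f.coeff (m₀ + j) := by
  have hinj : Function.Injective (fun j : ℕ => m₀ + (j : ℤ)) := fun a b h => by simpa using h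
  have h := hasSum_coeff_mul c f (m₀ + k)
  rw [← hinj.hasSum_iff] at h
  · refine h.unique ?_
    have : ∑ j ∈ Finset.range (k + 1), c.coeff ((k - j : ℕ) : ℤ) * f.coeff (m₀ + j) =
        ∑ j ∈ Finset.range (k + 1), ((fun j : ℤ => c.coeff (m₀ + k - j) * f.coeff j) ∘
          fun j : ℕ => m₀ + (j : ℤ)) j := by
      refine Finset.sum_congr rfl fun j hj => ?_
      have := Finset.mem_range.1 hj
      simp only [Function.comp_apply]
      congr 2
      omega
    rw [this]
    refine hasSum_sum_of_ne_finset_zero fun j hj => ?_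
    have : ¬ j < k + 1 := fun h => hj (Finset.mem_range.2 h)
    simp only [Function.comp_apply]
    rw [hc _ (by omega), zero_mul]
  · intro j hj
    have : j < m₀ := by
      by_contra h
      exact hj ⟨(j - m₀).toNat, by simp; omega⟩
    rw [hf j this, mul_zero]

theorem coeff_mul_eq_zero_of_lt {c f : LaurentSeries ℂ} {m₀ : ℤ}
    (hc : ∀ m < 0, c.coeff m = 0) (hf : ∀ m < m₀, f.coeff m = 0) {m : ℤ} (hm : m < m₀) :
    (c * f).coeff m = 0 := by
  refine (hasSum_coeff_mul c f m).unique ?_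
  convert! hasSum_zero using 2 with j
  by_cases hj : j < m₀
  · rw [hf j hj, mul_zero]
  · rw [hc _ (by omega), zero_mul]

/-- The Laurent series `∑ a k z ^ (m₀ + k)`. -/
def seriesOf (m₀ : ℤ) (a : ℕ → ℂ) : LaurentSeries ℂ :=
  HahnSeries.ofSuppBddBelow (fun m : ℤ => if m₀ ≤ m then a (m - m₀).toNat else 0) ⟨m₀, fun m hm => by
    by_contra h
    simp [h] at hm⟩

theorem seriesOf_coeff_add (m₀ : ℤ) (a : ℕ → ℂ) (k : ℕ) : (seriesOf m₀ a).coeff (m₀ + k) = a k := by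
  simp [seriesOf, HahnSeries.ofSuppBddBelow]

theorem seriesOf_coeff_of_lt {m₀ m : ℤ} (a : ℕ → ℂ) (h : m < m₀) : (seriesOf m₀ a).coeff m = 0 := by
  simp [seriesOf, HahnSeries.ofSuppBddBelow, h]

end Coefficients

/-! ### Convergence as geometric growth of the coefficients. -/

section Convergence

/-- Convergence at a single `z ≠ 0` suffices, because the terms of a convergent sum are bounded. -/
theorem exists_coeff_bound_of_mem {f : LaurentSeries ℂ} (hf : f ∈ meromorphicSubfield {0} rfl)
    (m₀ : ℤ) : ∃ C r : ℝ, 0 ≤ C ∧ 0 ≤ r ∧ ∀ k : ℕ, ‖f.coeff (m₀ + k)‖ ≤ C * r ^ k := by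
  obtain ⟨F, -, hF⟩ := hf
  obtain ⟨z, hz, hz0⟩ := (hF.and self_mem_nhdsWithin).exists
  have hz0 : z ≠ 0 := hz0
  obtain ⟨b, hb⟩ := (hz.summable.tendsto_cofinite_zero.norm.isBoundedUnder_le).bddAbove_range_of_cofinite
  have hb : ∀ n : ℤ, ‖f.coeff n * z ^ n‖ ≤ b := fun n => hb ⟨n, rfl⟩
  refine ⟨b * ‖z‖ ^ (-m₀), ‖z‖⁻¹, mul_nonneg ((norm_nonneg _).trans (hb 0)) (by positivity),
    by positivity, fun k => ?_⟩
  have h := hb (m₀ + k)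
  rw [norm_mul, norm_zpow] at h
  have hpos : 0 < ‖z‖ := norm_pos_iff.2 hz0
  rw [← le_div_iff₀ (by positivity)] at h
  refine h.trans_eq ?_
  rw [zpow_add₀ hpos.ne', zpow_neg, zpow_natCast, inv_pow]
  field_simp

/-- A geometric bound gives a power series of positive radius; the germ is its sum times `z ^ m₀`.
-/
theorem mem_of_coeff_bound {f : LaurentSeries ℂ} {m₀ : ℤ} (hf : ∀ m < m₀, f.coeff m = 0)
    {C r : ℝ} (h : ∀ k : ℕ, ‖f.coeff (m₀ + k)‖ ≤ C * r ^ k) :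
    f ∈ meromorphicSubfield {0} rfl := by
  let p : FormalMultilinearSeries ℂ ℂ ℂ :=
    FormalMultilinearSeries.ofScalars ℂ fun k : ℕ => f.coeff (m₀ + k)
  have hc : ∀ k, p.coeff k = f.coeff (m₀ + k) := fun k => FormalMultilinearSeries.coeff_ofScalars
  have hr : 0 < (|r| + 1)⁻¹ := by positivity
  have hrad : 0 < p.radius := by
    refine lt_of_lt_of_le ?_ (p.le_radius_of_bound (r := (|r| + 1)⁻¹.toNNReal) |C| fun k => ?_)
    · rwa [ENNReal.coe_pos, Real.toNNReal_pos]
    · rw [FormalMultilinearSeries.norm_apply_eq_norm_coef, hc, Real.coe_toNNReal _ hr.le]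
      have h1 : ‖f.coeff (m₀ + k)‖ ≤ |C| * (|r| + 1) ^ k := by
        refine (h k).trans ((le_abs_self _).trans ?_)
        rw [abs_mul, abs_pow]
        gcongr
        linarith
      calc _ ≤ |C| * (|r| + 1) ^ k * ((|r| + 1)⁻¹) ^ k := by
            exact mul_le_mul_of_nonneg_right h1 (by positivity)
        _ = |C| := by rw [mul_assoc, ← mul_pow, mul_inv_cancel₀ (by positivity), one_pow, mul_one]
  have hp := (p.hasFPowerSeriesOnBall hrad).hasFPowerSeriesAt
  refine ⟨fun z => z ^ m₀ * p.sum z, fun z hz => ?_, ?_⟩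
  · rw [show z = 0 from hz]
    exact (MeromorphicAt.id 0).zpow m₀ |>.mul hp.analyticAt.meromorphicAt
  · rw [hasFPowerSeriesAt_iff] at hp
    filter_upwards [nhdsWithin_le_nhds hp, self_mem_nhdsWithin] with z hz hz0
    have hz0 : z ≠ 0 := hz0
    have hinj : Function.Injective (fun j : ℕ => m₀ + (j : ℤ)) := fun a b h => by simpa using h
    rw [← hinj.hasSum_iff]
    · convert! hz.mul_left (z ^ m₀) using 1
      · ext k
        rw [Function.comp_apply, hc, zpow_add₀ hz0, zpow_natCast, smul_eq_mul]
        ring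
      · rw [zero_add]
    · intro j hj
      have : j < m₀ := by
        by_contra h
        exact hj ⟨(j - m₀).toNat, by simp; omega⟩
      rw [hf j this, zero_mul]

theorem toSubfield_le_convergent {B : BaseField} (hB : B ≠ .formal) :
    B.toSubfield ≤ meromorphicSubfield {0} rfl := by
  cases B with
  | global => exact fun f ⟨F, hF, h⟩ => ⟨F, fun z _ => hF z trivial, h⟩
  | convergent => exact le_rfl
  | formal => exact absurd rfl hB

end Convergence

/-! ### The formal solution of a linear q-difference equation and its convergence. -/

section FormalSolution

variable (q : ℂˣ) (n : ℕ) (c : ℕ → LaurentSeries ℂ) (u : LaurentSeries ℂ) (m₀ : ℤ)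

/-- The coefficients, from degree `m₀` on, of the solution of
`σ ^ n f = ∑ i < n, c i * σ ^ i f + u`. -/
def solutionCoeff : ℕ → ℂ :=
  linearRecursion
    (fun k => ((q : ℂ) ^ n) ^ (m₀ + k) - ∑ i ∈ Finset.range n,
      (c i).coeff 0 * ((q : ℂ) ^ i) ^ (m₀ + k))
    (fun k j => ∑ i ∈ Finset.range n, (c i).coeff ((k - j : ℕ) : ℤ) * ((q : ℂ) ^ i) ^ (m₀ + j))
    (fun k => u.coeff (m₀ + k))

variable {q n c u m₀}

/-- In degree `m₀ + k` the unknown coefficient appears with the factor that `hQ` assumes to be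
nonzero (nonresonance); all other terms involve earlier coefficients or `u`. -/
theorem seriesOf_solutionCoeff (hc : ∀ i < n, ∀ m < 0, (c i).coeff m = 0)
    (hu : ∀ m < m₀, u.coeff m = 0)
    (hQ : ∀ m ≥ m₀, ((q : ℂ) ^ n) ^ m - ∑ i ∈ Finset.range n, (c i).coeff 0 * ((q : ℂ) ^ i) ^ m ≠ 0) :
    dilate (q ^ n) (seriesOf m₀ (solutionCoeff q n c u m₀)) = ∑ i ∈ Finset.range n,
      c i * dilate (q ^ i) (seriesOf m₀ (solutionCoeff q n c u m₀)) + u := by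
  set a := solutionCoeff q n c u m₀ with ha
  have hlow : ∀ i, ∀ m < m₀, (dilate (q ^ i) (seriesOf m₀ a)).coeff m = 0 := fun i m hm => by
    rw [dilate_coeff, seriesOf_coeff_of_lt a hm, mul_zero]
  ext m
  rw [HahnSeries.coeff_add, HahnSeries.coeff_sum]
  by_cases hm : m < m₀
  · rw [hlow n m hm, hu m hm, add_zero]
    refine (Finset.sum_eq_zero fun i hi => ?_).symm
    exact coeff_mul_eq_zero_of_lt (hc i (Finset.mem_range.1 hi)) (hlow i) hm
  · obtain ⟨k, rfl⟩ : ∃ k : ℕ, m = m₀ + k := ⟨(m - m₀).toNat, by omega⟩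
    have h1 : ∑ i ∈ Finset.range n, (c i * dilate (q ^ i) (seriesOf m₀ a)).coeff (m₀ + k) =
        ∑ j ∈ Finset.range (k + 1), (∑ i ∈ Finset.range n,
          (c i).coeff ((k - j : ℕ) : ℤ) * ((q : ℂ) ^ i) ^ (m₀ + j)) * a j := by
      simp only [Finset.sum_mul]
      rw [Finset.sum_comm]
      refine Finset.sum_congr rfl fun i hi => ?_
      rw [coeff_mul_of_coeff_eq_zero (hc i (Finset.mem_range.1 hi)) (hlow i)]
      refine Finset.sum_congr rfl fun j _ => ?_
      rw [dilate_coeff, seriesOf_coeff_add]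
      push_cast
      ring
    have h2 := linearRecursion_eq
      (fun k => ((q : ℂ) ^ n) ^ (m₀ + k) - ∑ i ∈ Finset.range n,
        (c i).coeff 0 * ((q : ℂ) ^ i) ^ (m₀ + k))
      (fun k j => ∑ i ∈ Finset.range n, (c i).coeff ((k - j : ℕ) : ℤ) * ((q : ℂ) ^ i) ^ (m₀ + j))
      (fun k => u.coeff (m₀ + k)) k
    change a k = (∑ j ∈ Finset.range k, _ * a j + u.coeff (m₀ + k)) / _ at h2
    rw [eq_div_iff (hQ _ (by omega))] at h2
    rw [h1, Finset.sum_range_succ, dilate_coeff, seriesOf_coeff_add, Nat.sub_self, Nat.cast_zero]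
    push_cast
    linear_combination h2

/-- Since `|q| > 1`, `q ^ (n m)` dominates the `q ^ (i m)` with `i < n`, so the quotient tends to
`1` as `k` grows. A vanishing denominator is harmless: the quotient is then `0` by convention. -/
theorem exists_norm_inv_le (hq : 1 < ‖(q : ℂ)‖) :
    ∃ b : ℝ, 0 ≤ b ∧ ∀ k : ℕ, ‖((q : ℂ) ^ n) ^ (m₀ + k) / (((q : ℂ) ^ n) ^ (m₀ + k) -
      ∑ i ∈ Finset.range n, (c i).coeff 0 * ((q : ℂ) ^ i) ^ (m₀ + k))‖ ≤ b := by
  have hq0 : (q : ℂ) ≠ 0 := q.ne_zero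
  have ht : Tendsto (fun k : ℕ => 1 - ∑ i ∈ Finset.range n, (c i).coeff 0 *
      (((q : ℂ) ^ i / (q : ℂ) ^ n) ^ m₀ * ((q : ℂ) ^ i / (q : ℂ) ^ n) ^ k)) atTop
      (𝓝 (1 - ∑ i ∈ Finset.range n, (c i).coeff 0 * (((q : ℂ) ^ i / (q : ℂ) ^ n) ^ m₀ * 0))) := by
    refine tendsto_const_nhds.sub (tendsto_finsetSum _ fun i hi => ?_)
    refine ((tendsto_pow_atTop_nhds_zero_of_norm_lt_one ?_).const_mul _).const_mul _
    rw [norm_div, norm_pow, norm_pow, div_lt_one (by positivity)]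
    exact pow_lt_pow_right₀ hq (Finset.mem_range.1 hi)
  simp only [mul_zero, Finset.sum_const_zero, sub_zero] at ht
  have ht := (ht.inv₀ one_ne_zero).norm
  obtain ⟨b, hb⟩ := ht.bddAbove_range
  have hb : ∀ k : ℕ, _ ≤ b := fun k => hb ⟨k, rfl⟩
  refine ⟨b, (norm_nonneg _).trans (hb 0), fun k => le_of_eq_of_le ?_ (hb k)⟩
  congr 1
  rw [← inv_div, sub_div, div_self (zpow_ne_zero _ (pow_ne_zero _ hq0)), Finset.sum_div]
  congr 2
  refine Finset.sum_congr rfl fun i _ => ?_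
  rw [mul_div_assoc, ← div_zpow, zpow_add₀ (div_ne_zero (pow_ne_zero _ hq0) (pow_ne_zero _ hq0)),
    zpow_natCast]

/-- There are no small divisors: after division of numerator and denominator by `q ^ (n (m₀ + k))`,
the reciprocal of the denominator is bounded by `exists_norm_inv_le`, and the numerators keep
geometric growth because `|q|^(ij) ≤ |q|^(nk)` for `i < n`, `j < k`. -/
theorem seriesOf_solutionCoeff_mem (hq : 1 < ‖(q : ℂ)‖)
    (hc : ∀ i < n, c i ∈ meromorphicSubfield {0} rfl) (hu : u ∈ meromorphicSubfield {0} rfl) :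
    seriesOf m₀ (solutionCoeff q n c u m₀) ∈ meromorphicSubfield {0} rfl := by
  obtain ⟨b, hb0, hb⟩ := exists_norm_inv_le (n := n) (c := c) (m₀ := m₀) hq
  have hq0 : (q : ℂ) ≠ 0 := q.ne_zero
  have hqn : 0 < ‖(q : ℂ)‖ := norm_pos_iff.2 hq0
  have hcb : ∀ i : Fin n, ∃ C r : ℝ, 0 ≤ C ∧ 0 ≤ r ∧ ∀ k : ℕ, ‖(c i).coeff k‖ ≤ C * r ^ k :=
    fun i => by simpa using exists_coeff_bound_of_mem (hc i i.2) 0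
  choose C r hC hr hCr using hcb
  obtain ⟨C', r', hC', hr', hu'⟩ := exists_coeff_bound_of_mem hu m₀
  let R : ℝ := r' + ∑ i, r i
  have hrR : ∀ i, r i ≤ R := fun i => by
    have := Finset.single_le_sum (fun i _ => hr i) (Finset.mem_univ i)
    simp only [R]
    linarith
  have hr'R : r' ≤ R := le_add_of_nonneg_right (Finset.sum_nonneg fun i _ => hr i)
  have hR : 0 ≤ R := hr'.trans hr'R
  let E : ℝ := ∑ i : Fin n, C i * ‖((q : ℂ) ^ (i : ℕ)) ^ m₀ / ((q : ℂ) ^ n) ^ m₀‖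
  have hE : 0 ≤ E := Finset.sum_nonneg fun i _ => mul_nonneg (hC i) (norm_nonneg _)
  -- One constant for both hypotheses of `norm_linearRecursion_le`: `E` accounts for the
  -- coefficients `c i`, the other summand for `u`.
  let G : ℝ := (E + C' * ‖((q : ℂ) ^ n) ^ m₀‖⁻¹) * b
  have hG : 0 ≤ G := by positivity
  have hqn1 : 1 ≤ ‖(q : ℂ) ^ n‖ := by
    rw [norm_pow]
    exact one_le_pow₀ hq.le
  have h0 : ∀ k : ℕ, ((q : ℂ) ^ n) ^ (m₀ + k) ≠ 0 := fun k => zpow_ne_zero _ (pow_ne_zero _ hq0)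
  refine mem_of_coeff_bound (fun m => seriesOf_coeff_of_lt _) (C := G) (r := (1 + G) * R)
    fun k => ?_
  rw [seriesOf_coeff_add]
  refine norm_linearRecursion_le hG hR (fun k j hj => ?_) (fun k => ?_) k
  · rw [← div_mul_div_cancel₀ (h0 k), norm_mul]
    refine (mul_le_mul (b := E * R ^ (k - j)) ?_ (hb k) (norm_nonneg _) (by positivity)).trans ?_
    · rw [Finset.sum_range, Finset.sum_div, Finset.sum_mul]
      refine (norm_sum_le _ _).trans (Finset.sum_le_sum fun i _ => ?_)
      rw [mul_div_assoc, norm_mul, mul_right_comm]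
      refine mul_le_mul ((hCr i _).trans ?_) ?_ (norm_nonneg _)
        (mul_nonneg (hC i) (by positivity))
      · exact mul_le_mul_of_nonneg_left (pow_le_pow_left₀ (hr i) (hrR i) _) (hC i)
      · rw [zpow_add₀ (pow_ne_zero _ hq0), zpow_add₀ (pow_ne_zero _ hq0), mul_div_mul_comm, norm_mul]
        refine mul_le_of_le_one_right (norm_nonneg _) ?_
        rw [norm_div, zpow_natCast, zpow_natCast, norm_pow, norm_pow, norm_pow, norm_pow,
          ← pow_mul, ← pow_mul]
        refine div_le_one_of_le₀ (pow_le_pow_right₀ hq.le ?_) (by positivity)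
        exact Nat.mul_le_mul i.2.le hj.le
    · have : E * b ≤ G := by
        have : 0 ≤ C' * ‖((q : ℂ) ^ n) ^ m₀‖⁻¹ * b := by positivity
        simp only [G]
        linarith
      calc _ = E * b * R ^ (k - j) := by ring
        _ ≤ _ := mul_le_mul_of_nonneg_right this (by positivity)
  · rw [← div_mul_div_cancel₀ (h0 k), norm_mul]
    refine (mul_le_mul (b := C' * ‖((q : ℂ) ^ n) ^ m₀‖⁻¹ * R ^ k) ?_ (hb k) (norm_nonneg _)
      (by positivity)).trans ?_
    · rw [norm_div, div_eq_mul_inv, mul_right_comm]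
      refine mul_le_mul ((hu' k).trans ?_) ?_ (by positivity) (by positivity)
      · exact mul_le_mul_of_nonneg_left (pow_le_pow_left₀ hr' hr'R _) hC'
      · rw [zpow_add₀ (pow_ne_zero _ hq0), norm_mul, mul_inv, zpow_natCast, norm_pow _ k]
        exact mul_le_of_le_one_right (by positivity) (inv_le_one_of_one_le₀ (one_le_pow₀ hqn1))
    · have : C' * ‖((q : ℂ) ^ n) ^ m₀‖⁻¹ * b ≤ G := by
        have : 0 ≤ E * b := by positivity
        simp only [G]
        linarith
      calc _ = C' * ‖((q : ℂ) ^ n) ^ m₀‖⁻¹ * b * R ^ k := by ring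
        _ ≤ _ := mul_le_mul_of_nonneg_right this (by positivity)

end FormalSolution

/-! ### Meromorphic continuation of the solution to the whole plane. -/

section GlobalSolution

theorem IsExpansion.sum {ι : Type*} {s : Finset ι} {f : ι → LaurentSeries ℂ} {F : ι → ℂ → ℂ}
    (h : ∀ i ∈ s, IsExpansion (f i) (F i)) : IsExpansion (∑ i ∈ s, f i) (∑ i ∈ s, F i) := by
  classical
  induction s using Finset.induction_on with
  | empty => simpa using IsExpansion.zero
  | insert i s hi ih =>
    rw [Finset.sum_insert hi, Finset.sum_insert hi]
    exact (h i (Finset.mem_insert_self _ _)).add (ih fun j hj => h j (Finset.mem_insert_of_mem hj))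

theorem IsExpansion.eventuallyEq {f : LaurentSeries ℂ} {F G : ℂ → ℂ} (hF : IsExpansion f F)
    (hG : IsExpansion f G) : F =ᶠ[𝓝[≠] 0] G := by
  filter_upwards [hF, hG] with z h1 h2
  exact h1.unique h2

variable {q : ℂˣ} {n : ℕ}

/-- The operator `F(z) ↦ ∑ i < n, c i (q ^ (-n) z) F(q ^ (i - n) z) + u(q ^ (-n) z)`. -/
def backwardStep (q : ℂˣ) (n : ℕ) (c : ℕ → ℂ → ℂ) (u : ℂ → ℂ) (F : ℂ → ℂ) (z : ℂ) : ℂ :=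
  ∑ i ∈ Finset.range n, c i (z / (q : ℂ) ^ n) * F ((q : ℂ) ^ i * (z / (q : ℂ) ^ n)) +
    u (z / (q : ℂ) ^ n)

theorem backwardStep_congr {c : ℕ → ℂ → ℂ} {u F G : ℂ → ℂ} {z : ℂ}
    (h : ∀ i < n, F ((q : ℂ) ^ i * (z / (q : ℂ) ^ n)) = G ((q : ℂ) ^ i * (z / (q : ℂ) ^ n))) :
    backwardStep q n c u F z = backwardStep q n c u G z := by
  unfold backwardStep
  rw [Finset.sum_congr rfl fun i hi => by rw [h i (Finset.mem_range.1 hi)]]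

theorem norm_pow_mul_div_lt (hq : 1 < ‖(q : ℂ)‖) {i : ℕ} (hi : i < n) {R : ℝ} {z : ℂ}
    (hz : ‖z‖ < ‖(q : ℂ)‖ * R) : ‖(q : ℂ) ^ i * (z / (q : ℂ) ^ n)‖ < R := by
  have h0 : 0 < ‖(q : ℂ)‖ := by linarith
  have hR : 0 < R := pos_of_mul_pos_right ((norm_nonneg z).trans_lt hz) h0.le
  rw [norm_mul, norm_div, norm_pow, norm_pow, ← mul_div_assoc, div_lt_iff₀ (by positivity)]
  calc _ < ‖(q : ℂ)‖ ^ i * (‖(q : ℂ)‖ * R) := by gcongr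
    _ = R * ‖(q : ℂ)‖ ^ (i + 1) := by ring
    _ ≤ R * ‖(q : ℂ)‖ ^ n := by
      gcongr
      exacts [hq.le, hi]

/-- The operator evaluates `F` only at points of modulus at most `|z| / |q|`, so each application
enlarges the disc of validity by the factor `|q|`. -/
theorem backwardStep_iterate (hq : 1 < ‖(q : ℂ)‖) {c : ℕ → ℂ → ℂ} {u F : ℂ → ℂ}
    (hc : ∀ i < n, MeromorphicOn (c i) Set.univ) (hu : MeromorphicOn u Set.univ) {R : ℝ}
    (hF : ∀ z, ‖z‖ < R → MeromorphicAt F z)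
    (hT : ∀ z, z ≠ 0 → ‖z‖ < R → backwardStep q n c u F z = F z) (k : ℕ) :
    (∀ z, ‖z‖ < ‖(q : ℂ)‖ ^ k * R → MeromorphicAt ((backwardStep q n c u)^[k] F) z) ∧
      ∀ z, z ≠ 0 → ‖z‖ < ‖(q : ℂ)‖ ^ k * R →
        (backwardStep q n c u)^[k + 1] F z = (backwardStep q n c u)^[k] F z := by
  induction k with
  | zero => simpa using ⟨hF, hT⟩
  | succ k ih =>
    have hq0 : (q : ℂ) ≠ 0 := q.ne_zero
    have hlt : ∀ i < n, ∀ z, ‖z‖ < ‖(q : ℂ)‖ ^ (k + 1) * R →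
        ‖(q : ℂ) ^ i * (z / (q : ℂ) ^ n)‖ < ‖(q : ℂ)‖ ^ k * R := fun i hi z hz =>
      norm_pow_mul_div_lt hq hi (by rwa [pow_succ', mul_assoc] at hz)
    constructor
    · intro z hz
      rw [Function.iterate_succ_apply']
      have hdiv : ∀ i : ℕ, AnalyticAt ℂ (fun z : ℂ => (q : ℂ) ^ i * (z / (q : ℂ) ^ n)) z := fun i =>
        analyticAt_const.mul (analyticAt_id.div_const)
      have hdiv' : AnalyticAt ℂ (fun z : ℂ => z / (q : ℂ) ^ n) z := analyticAt_id.div_const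
      have hsum : MeromorphicAt (∑ i ∈ Finset.range n, fun z => c i (z / (q : ℂ) ^ n) *
          (backwardStep q n c u)^[k] F ((q : ℂ) ^ i * (z / (q : ℂ) ^ n))) z := by
        refine MeromorphicAt.sum fun i hi => ?_
        have hi := Finset.mem_range.1 hi
        exact ((hc i hi _ trivial).comp_analyticAt hdiv').mul
          (MeromorphicAt.comp_analyticAt (g := fun z : ℂ => (q : ℂ) ^ i * (z / (q : ℂ) ^ n))
            (ih.1 _ (hlt i hi z hz)) (hdiv i))
      convert hsum.add ((hu _ trivial).comp_analyticAt hdiv') using 1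
      ext z
      simp [backwardStep]
    · intro z hz0 hz
      rw [Function.iterate_succ_apply', Function.iterate_succ_apply' _ k]
      refine backwardStep_congr fun i hi => ?_
      rw [← Function.iterate_succ_apply' (backwardStep q n c u)]
      exact ih.2 _ (by simp [hz0]) (hlt i hi z hz)

/-- Read backwards, the equation expresses `f(z)` through values of `f` closer to `0`. Iterating
from a disc on which the germ is defined covers the plane. -/
theorem mem_global_of_solution (hq : 1 < ‖(q : ℂ)‖) {c : ℕ → LaurentSeries ℂ}
    {u f : LaurentSeries ℂ} (hc : ∀ i < n, c i ∈ meromorphicSubfield Set.univ trivial)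
    (hu : u ∈ meromorphicSubfield Set.univ trivial) (hf : f ∈ meromorphicSubfield {0} rfl)
    (heq : dilate (q ^ n) f = ∑ i ∈ Finset.range n, c i * dilate (q ^ i) f + u) :
    f ∈ meromorphicSubfield Set.univ trivial := by
  have hq0 : (q : ℂ) ≠ 0 := q.ne_zero
  obtain ⟨F, hF, hfF⟩ := hf
  obtain ⟨U, hU, huU⟩ := hu
  have : ∀ i, ∃ G : ℂ → ℂ, i < n → MeromorphicOn G Set.univ ∧ IsExpansion (c i) G := fun i => by
    by_cases hi : i < n
    · obtain ⟨G, hG⟩ := hc i hi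
      exact ⟨G, fun _ => hG⟩
    · exact ⟨0, fun h => absurd h hi⟩
  choose C hC using this
  have hev : ∀ᶠ z in 𝓝[≠] (0 : ℂ), backwardStep q n C U F z = F z := by
    have h1 : IsExpansion (∑ i ∈ Finset.range n, c i * dilate (q ^ i) f + u)
        (∑ i ∈ Finset.range n, C i * (F ∘ fun z => ((q ^ i : ℂˣ) : ℂ) * z) + U) :=
      (IsExpansion.sum fun i hi => (hC i (Finset.mem_range.1 hi)).2.mul (hfF.dilate _)).add huU
    rw [← heq] at h1
    have h2 := h1.eventuallyEq (hfF.dilate (q ^ n))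
    have ht : Tendsto (fun z : ℂ => z / (q : ℂ) ^ n) (𝓝[≠] 0) (𝓝[≠] 0) := by
      refine tendsto_nhdsWithin_iff.2 ⟨?_, ?_⟩
      · refine Tendsto.mono_left ?_ nhdsWithin_le_nhds
        exact Continuous.tendsto' (by fun_prop) _ _ (by simp)
      · filter_upwards [self_mem_nhdsWithin] with z hz
        simpa using hz
    filter_upwards [ht.eventually h2] with z hz
    simp only [Pi.add_apply, Finset.sum_apply, Pi.mul_apply, Function.comp_apply,
      Units.val_pow_eq_pow_val] at hz
    rw [mul_div_cancel₀ _ (pow_ne_zero n hq0)] at hz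
    exact hz
  obtain ⟨R, hR, hball⟩ := Metric.mem_nhdsWithin_iff.1
    (hev.and ((hF 0 rfl).eventually_analyticAt))
  -- Only punctured discs are available, as an expansion says nothing about the value at `0`.
  have hball : ∀ z, z ≠ 0 → ‖z‖ < R → backwardStep q n C U F z = F z ∧ AnalyticAt ℂ F z :=
    fun z hz0 hz => hball ⟨by simpa using hz, hz0⟩
  have hFR : ∀ z, ‖z‖ < R → MeromorphicAt F z := fun z hz => by
    by_cases hz0 : z = 0
    · exact hz0 ▸ hF 0 rfl
    · exact (hball z hz0 hz).2.meromorphicAt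
  have key := backwardStep_iterate hq (fun i hi => (hC i hi).1) hU hFR
    fun z hz0 hz => (hball z hz0 hz).1
  set S : ℕ → ℂ → ℂ := fun k => (backwardStep q n C U)^[k] F with hS
  have hmono : ∀ k j, k ≤ j → ∀ z, z ≠ 0 → ‖z‖ < ‖(q : ℂ)‖ ^ k * R → S j z = S k z := by
    intro k j hkj z hz0 hz
    induction j, hkj using Nat.le_induction with
    | base => rfl
    | succ j hkj ih =>
      rw [← ih]
      refine (key j).2 z hz0 (hz.trans_le ?_)
      gcongr
      exact hq.le
  have hex : ∀ z : ℂ, ∃ k : ℕ, ‖z‖ < ‖(q : ℂ)‖ ^ k * R := fun z => by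
    obtain ⟨k, hk⟩ := pow_unbounded_of_one_lt (‖z‖ / R) hq
    exact ⟨k, (div_lt_iff₀ hR).1 hk⟩
  choose κ hκ using hex
  have hG : ∀ k z, z ≠ 0 → ‖z‖ < ‖(q : ℂ)‖ ^ k * R → S (κ z) z = S k z := fun k z hz0 hz => by
    rcases le_total k (κ z) with h | h
    · exact hmono k _ h z hz0 hz
    · exact (hmono _ k h z hz0 (hκ z)).symm
  have hev : ∀ z k, ‖z‖ < ‖(q : ℂ)‖ ^ k * R → S k =ᶠ[𝓝[≠] z] fun z => S (κ z) z := by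
    intro z k hz
    have h1 : ∀ᶠ w in 𝓝[≠] z, ‖w‖ < ‖(q : ℂ)‖ ^ k * R :=
      nhdsWithin_le_nhds (continuous_norm.continuousAt.eventually_lt_const hz)
    have h2 : ∀ᶠ w in 𝓝[≠] z, w ≠ 0 := by
      by_cases hz0 : z = 0
      · subst hz0
        exact self_mem_nhdsWithin
      · exact nhdsWithin_le_nhds (continuousAt_id.eventually_ne hz0)
    filter_upwards [h1, h2] with w hw hw0
    exact (hG k w hw0 hw).symm
  -- The iterates are glued: on a punctured neighbourhood of `z` the new function agrees with the
  -- single iterate `S (κ z)`.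
  refine ⟨fun z => S (κ z) z, fun z _ => ((key (κ z)).1 z (hκ z)).congr (hev z _ (hκ z)), ?_⟩
  have := hev 0 0 (by simpa using hR)
  filter_upwards [hfF, this] with z h1 h2
  rw [← h2]
  exact h1

end GlobalSolution

/-- Solvability, in each of the three base fields, of `σ ^ n f = ∑ i < n, c i * σ ^ i f + u` with
integral coefficients `c i` and a nonresonance condition. -/
theorem BaseField.exists_solution (B : BaseField) {q : ℂˣ} (hq : 1 < ‖(q : ℂ)‖) {n : ℕ}
    (c : ℕ → B.Carrier) (u : B.Carrier) (m₀ : ℤ)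
    (hc : ∀ i < n, ∀ m < 0, (c i : LaurentSeries ℂ).coeff m = 0)
    (hu : ∀ m < m₀, (u : LaurentSeries ℂ).coeff m = 0)
    (hQ : ∀ m ≥ m₀, ((q : ℂ) ^ n) ^ m -
      ∑ i ∈ Finset.range n, (c i : LaurentSeries ℂ).coeff 0 * ((q : ℂ) ^ i) ^ m ≠ 0) :
    ∃ f : B.Carrier, (∀ m < m₀, (f : LaurentSeries ℂ).coeff m = 0) ∧
      B.shift (q ^ n) f = ∑ i ∈ Finset.range n, c i * B.shift (q ^ i) f + u := by
  let f := seriesOf m₀ (solutionCoeff q n (fun i => (c i : LaurentSeries ℂ)) u m₀)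
  have heq := seriesOf_solutionCoeff (c := fun i => (c i : LaurentSeries ℂ)) hc hu hQ
  have hconv : B ≠ .formal → f ∈ meromorphicSubfield {0} rfl := fun hB =>
    seriesOf_solutionCoeff_mem hq (fun i _ => toSubfield_le_convergent hB (c i).2)
      (toSubfield_le_convergent hB u.2)
  have hf : f ∈ B.toSubfield := by
    cases B with
    | global =>
      exact mem_global_of_solution hq (fun i _ => (c i).2) u.2 (hconv (by simp)) heq
    | convergent => exact hconv (by simp)
    | formal => trivial
  refine ⟨⟨f, hf⟩, fun m => seriesOf_coeff_of_lt _, Subtype.ext ?_⟩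
  push_cast
  exact heq

/-! ### Valuations and the splitting of extensions of rank one. -/

section Order

theorem order_eq_of_coeff {f : LaurentSeries ℂ} {m : ℤ} (h : f.coeff m ≠ 0)
    (h' : ∀ k < m, f.coeff k = 0) : f.order = m :=
  le_antisymm (HahnSeries.order_le_of_coeff_ne_zero h) <| by
    by_contra! hlt
    have h0 := HahnSeries.coeff_order_eq_zero.1 (h' _ hlt)
    simp [h0] at h

theorem order_dilate (q : ℂˣ) (f : LaurentSeries ℂ) : (dilate q f).order = f.order := by
  by_cases hf : f = 0
  · rw [hf, map_zero]
  · refine order_eq_of_coeff ?_ fun k hk => ?_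
    · rw [dilate_coeff]
      exact mul_ne_zero (Units.ne_zero _) (HahnSeries.coeff_order_eq_zero.not.2 hf)
    · rw [dilate_coeff, HahnSeries.coeff_eq_zero_of_lt_order hk, mul_zero]

theorem order_powSubst (l : ℕ+) (f : LaurentSeries ℂ) :
    (powSubst l f).order = ((l : ℕ) : ℤ) * f.order := by
  by_cases hf : f = 0
  · rw [hf, map_zero, HahnSeries.order_zero, mul_zero]
  · refine order_eq_of_coeff ?_ fun k hk => ?_
    · rw [powSubst_coeff_mul]
      exact HahnSeries.coeff_order_eq_zero.not.2 hf
    · by_cases hd : ((l : ℕ) : ℤ) ∣ k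
      · obtain ⟨j, rfl⟩ := hd
        rw [powSubst_coeff_mul]
        exact HahnSeries.coeff_eq_zero_of_lt_order (lt_of_mul_lt_mul_left hk (by positivity))
      · exact powSubst_coeff_of_not_dvd l f hd

theorem BaseField.valuation_mul (B : BaseField) (l : ℕ+) {a b : B.Ramified l} (ha : a ≠ 0)
    (hb : b ≠ 0) : B.valuation l (a * b) = B.valuation l a + B.valuation l b :=
  HahnSeries.order_mul (x := (Subtype.val a : LaurentSeries ℂ)) (y := Subtype.val b)
    (fun h => ha (Subtype.ext h)) (fun h => hb (Subtype.ext h))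

theorem BaseField.isInvariantValuation (B : BaseField) (l : ℕ+) (r : ℂˣ) :
    DiffMod.IsInvariantValuation (B.ramShift l r) (B.valuation l) where
  map_mul _ _ ha hb := B.valuation_mul l ha hb
  map_shift a := order_dilate r (Subtype.val a)

/-- Extensions of a module of rank one by one of smaller slope split. -/
theorem BaseField.exists_mul_shift_sub (B : BaseField) (l : ℕ+) {r : ℂˣ} (hr : 1 < ‖(r : ℂ)‖)
    {a b : B.Ramified l} (ha : a ≠ 0) (hb : b ≠ 0) (hab : B.valuation l a < B.valuation l b)
    (u : B.Ramified l) : ∃ f, a * B.ramShift l r f - b * f = u := by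
  have hv : B.valuation l a + B.valuation l (b / a) = B.valuation l b := by
    rw [← B.valuation_mul l ha (div_ne_zero hb ha), mul_div_cancel₀ _ ha]
  have hpos : ∀ m ≤ 0, (Subtype.val (b / a) : LaurentSeries ℂ).coeff m = 0 := fun m hm =>
    HahnSeries.coeff_eq_zero_of_lt_order
      (show m < B.valuation l (b / a) by omega)
  -- Divided by `a`, the equation reads `σ f = (b / a) f + u / a`. As `b / a` has positive
  -- valuation, the nonresonance factor is just `r ^ m`.
  obtain ⟨(f : B.Ramified l), -, hf⟩ := B.exists_solution (n := 1) hr (fun _ => b / a : ℕ → B.Ramified l)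
    (u / a : B.Ramified l) (B.valuation l (u / a)) (fun _ _ m hm => hpos m hm.le)
    (fun m hm => HahnSeries.coeff_eq_zero_of_lt_order hm) (fun m _ => by
      rw [Finset.sum_range_one, hpos 0 le_rfl, zero_mul, sub_zero]
      exact zpow_ne_zero _ (pow_ne_zero _ r.ne_zero))
  have h1 : B.shift (r ^ 0) f = f := Subtype.ext (by ext m; show (dilate (r ^ 0) _).coeff m = _; simp)
  rw [Finset.sum_range_one, pow_one, h1] at hf
  refine ⟨f, ?_⟩
  have hf : B.ramShift l r f = b / a * f + u / a := hf
  rw [hf]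
  field_simp
  ring

end Order

/-! ### Ramification levels and extension of scalars. -/

/-- The compatible family of roots of `q_l`. -/
def RootSystem.above {q : ℂˣ} (ρ : RootSystem q) (l : ℕ+) : RootSystem (ρ.root l) where
  root m := ρ.root (l * m)
  root_one := by rw [mul_one]
  root_mul_pow a b := by rw [mul_left_comm, ρ.root_mul_pow]

/-- The inclusion `K_l → K_{lm}`. -/
def BaseField.levelHom (B : BaseField) (l m : ℕ+) : B.Ramified l →+* B.Ramified (l * m) :=
  B.ramHom m

theorem BaseField.levelHom_ramHom (B : BaseField) (l m : ℕ+) (c : B.Carrier) :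
    B.levelHom l m (B.ramHom l c) = B.ramHom (l * m) c := by
  apply Subtype.ext
  show powSubst m (powSubst l (c : LaurentSeries ℂ)) = powSubst (l * m) c
  ext n
  by_cases h : ((m : ℕ) : ℤ) ∣ n
  · obtain ⟨n, rfl⟩ := h
    rw [powSubst_coeff_mul]
    by_cases h : ((l : ℕ) : ℤ) ∣ n
    · obtain ⟨n, rfl⟩ := h
      rw [powSubst_coeff_mul, ← mul_assoc,
        show ((m : ℕ) : ℤ) * ((l : ℕ) : ℤ) = ((l * m : ℕ+) : ℕ) by push_cast; ring,
        powSubst_coeff_mul]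
    · rw [powSubst_coeff_of_not_dvd l _ h, powSubst_coeff_of_not_dvd]
      rw [PNat.mul_coe, Nat.cast_mul, mul_comm]
      exact fun h' => h (Int.dvd_of_mul_dvd_mul_left (by positivity) h')
  · rw [powSubst_coeff_of_not_dvd m _ h, powSubst_coeff_of_not_dvd]
    rw [PNat.mul_coe, Nat.cast_mul]
    exact fun h' => h (dvd_of_mul_left_dvd h')

theorem BaseField.levelHom_ramShift (B : BaseField) {q : ℂˣ} (ρ : RootSystem q) (l m : ℕ+)
    (c : B.Ramified l) : B.levelHom l m (B.ramShift l (ρ.root l) c) =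
      B.ramShift (l * m) (ρ.root (l * m)) (B.levelHom l m c) :=
  (B.ramShift_ramHom (ρ.above l) m c).symm

theorem BaseField.valuation_levelHom (B : BaseField) (l m : ℕ+) (c : B.Ramified l) :
    B.valuation (l * m) (B.levelHom l m c) = ((m : ℕ) : ℤ) * B.valuation l c :=
  order_powSubst m (Subtype.val c)

section BaseChange

variable {R A L M N Y : Type} [CommRing R] [CommRing A] [Algebra R A] [CommRing L]
  [AddCommGroup M] [Module R M] [AddCommGroup N] [Module R N] [AddCommGroup Y] [Module L Y]
  {τ : A →+* L}

/-- The additive map `c ⊗ x ↦ τ c • γ x`. -/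
def semilinearLiftAux (γ : M →ₛₗ[τ.comp (algebraMap R A)] Y) : A ⊗[R] M →+ Y :=
  TensorProduct.liftAddHom
    (AddMonoidHom.mk' (fun c : A => AddMonoidHom.mk' (fun x : M => τ c • γ x)
      fun x y => by rw [map_add, smul_add])
      fun c d => by ext x; simp [add_smul])
    fun r c x => by simp [Algebra.smul_def, mul_smul, smul_comm (τ c)]

theorem semilinearLiftAux_tmul (γ : M →ₛₗ[τ.comp (algebraMap R A)] Y) (c : A) (x : M) :
    semilinearLiftAux γ (c ⊗ₜ[R] x) = τ c • γ x :=
  rfl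

/-- The semilinear form of the universal property of the extension of scalars. -/
def semilinearLift (γ : M →ₛₗ[τ.comp (algebraMap R A)] Y) : A ⊗[R] M →ₛₗ[τ] Y where
  toFun := semilinearLiftAux γ
  map_add' := map_add _
  map_smul' c t := by
    induction t using TensorProduct.induction_on with
    | zero => rw [smul_zero, map_zero, smul_zero]
    | tmul d x =>
      rw [TensorProduct.smul_tmul', semilinearLiftAux_tmul, semilinearLiftAux_tmul, smul_eq_mul,
        map_mul, mul_smul]
    | add s t hs ht => rw [smul_add, map_add, hs, ht, map_add, smul_add]

theorem semilinearLift_tmul (γ : M →ₛₗ[τ.comp (algebraMap R A)] Y) (c : A) (x : M) :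
    semilinearLift γ (c ⊗ₜ[R] x) = τ c • γ x :=
  rfl

variable (R A M N) in
/-- The bilinear map `(c ⊗ x, d ⊗ y) ↦ c d ⊗ (x ⊗ y)`. -/
def baseChangeMul : A ⊗[R] M →ₗ[A] A ⊗[R] N →ₗ[A] A ⊗[R] (M ⊗[R] N) :=
  TensorProduct.curry
    (TensorProduct.AlgebraTensorModule.distribBaseChange R A M N).symm.toLinearMap

theorem baseChangeMul_one_tmul (x : M) (y : N) :
    baseChangeMul R A M N (1 ⊗ₜ[R] x) (1 ⊗ₜ[R] y) = 1 ⊗ₜ[R] (x ⊗ₜ[R] y) := by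
  show (TensorProduct.AlgebraTensorModule.distribBaseChange R A M N).symm _ = _
  rw [LinearEquiv.symm_apply_eq]
  simp

end BaseChange

namespace DiffMod

variable {B : BaseField} {q : ℂˣ} (ρ : RootSystem q) (l : ℕ+)

/-- The map `M → K_l ⊗ M`. -/
def ramι (M : DiffMod B.Carrier (B.shift q)) : M →ₛₗ[B.ramHom l] M.ramify ρ l where
  toFun x := (1 : B.Ramified l) ⊗ₜ[B.Carrier] x
  map_add' x y := TensorProduct.tmul_add _ _ _
  map_smul' c x := by
    rw [← TensorProduct.smul_tmul, Algebra.smul_def]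
    exact (TensorProduct.smul_tmul' (B.ramHom l c) (1 : B.Ramified l) x).symm

variable {M N : DiffMod B.Carrier (B.shift q)}

theorem ramι_comm (x : M) : ramι ρ l M (M.Φ x) = (M.ramify ρ l).Φ (ramι ρ l M x) := by
  show (1 : B.Ramified l) ⊗ₜ[B.Carrier] M.Φ x = B.ramShift l (ρ.root l) 1 ⊗ₜ[B.Carrier] M.Φ x
  rw [map_one]

theorem tmul_eq_smul_ramι (c : B.Ramified l) (x : M) :
    (c ⊗ₜ[B.Carrier] x : M.ramify ρ l) = c • ramι ρ l M x := by
  show _ = c • ((1 : B.Ramified l) ⊗ₜ[B.Carrier] x)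
  rw [TensorProduct.smul_tmul', smul_eq_mul, mul_one]

theorem ramify_induction {P : M.ramify ρ l → Prop} (h0 : P 0)
    (hι : ∀ (c : B.Ramified l) x, P (c • ramι ρ l M x)) (hadd : ∀ s t, P s → P t → P (s + t))
    (t : M.ramify ρ l) : P t := by
  induction t using TensorProduct.induction_on with
  | zero => exact h0
  | tmul c x => exact tmul_eq_smul_ramι ρ l c x ▸ hι c x
  | add s t hs ht => exact hadd s t hs ht

theorem span_range_ramι : Submodule.span (B.Ramified l) (Set.range (ramι ρ l M)) = ⊤ := by
  refine eq_top_iff.2 fun t _ => ?_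
  induction t using ramify_induction with
  | h0 => exact zero_mem _
  | hι c x => exact Submodule.smul_mem _ _ (Submodule.subset_span ⟨x, rfl⟩)
  | hadd s t hs ht => exact add_mem (hs trivial) (ht trivial)

theorem ramι_injective : Function.Injective (ramι ρ l M) :=
  Module.FaithfullyFlat.tensorProduct_mk_injective (A := B.Carrier) (B := B.Ramified l) M

section Lift

variable {L : Type} [Field L] {σ' : L ≃+* L} {Y : DiffMod L σ'} {τ : B.Ramified l →+* L}

/-- The universal property of the extension of scalars. -/
def ramifyLift (γ : M →ₛₗ[τ.comp (B.ramHom l)] Y) : M.ramify ρ l →ₛₗ[τ] Y :=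
  semilinearLift (R := B.Carrier) (A := B.Ramified l) γ

theorem ramifyLift_ramι (γ : M →ₛₗ[τ.comp (B.ramHom l)] Y) (x : M) :
    ramifyLift ρ l γ (ramι ρ l M x) = γ x :=
  (semilinearLift_tmul (R := B.Carrier) (A := B.Ramified l) γ 1 x).trans
    (by rw [map_one, one_smul])

theorem ramifyLift_comm (hτ : ∀ c, τ (B.ramShift l (ρ.root l) c) = σ' (τ c))
    (γ : M →ₛₗ[τ.comp (B.ramHom l)] Y) (hγ : ∀ x, γ (M.Φ x) = Y.Φ (γ x)) (t : M.ramify ρ l) :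
    ramifyLift ρ l γ ((M.ramify ρ l).Φ t) = Y.Φ (ramifyLift ρ l γ t) := by
  induction t using ramify_induction with
  | h0 => simp
  | hι c x =>
    rw [map_smulₛₗ, map_smulₛₗ, map_smulₛₗ, ← ramι_comm, ramifyLift_ramι, ramifyLift_ramι, hγ,
      map_smulₛₗ]
    exact congrArg (· • _) (hτ c)
  | hadd s t hs ht => rw [map_add, map_add, hs, ht, map_add, map_add]

end Lift

theorem ramifyMap_ramι (f : M ⟶ N) (x : M) :
    (ramifyMap ρ l f).toLin (ramι ρ l M x) = ramι ρ l N (f.toLin x) := rfl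

theorem ramifyMap_surjective {f : M ⟶ N} (hf : Function.Surjective f.toLin) :
    Function.Surjective (ramifyMap ρ l f).toLin :=
  LinearMap.lTensor_surjective (B.Ramified l) hf

theorem ramifyMap_injective {f : M ⟶ N} (hf : Function.Injective f.toLin) :
    Function.Injective (ramifyMap ρ l f).toLin :=
  Module.Flat.lTensor_preserves_injective_linearMap (M := B.Ramified l) f.toLin hf

theorem ramifyMap_exact {A C : DiffMod B.Carrier (B.shift q)} {f : A ⟶ M} {g : M ⟶ C}
    (h : Function.Exact f.toLin g.toLin) :
    Function.Exact (ramifyMap ρ l f).toLin (ramifyMap ρ l g).toLin :=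
  fun y => Module.Flat.lTensor_exact (R := B.Carrier) (B.Ramified l) (f := f.toLin)
    (g := g.toLin) h y

/-- The bilinear map `(c ⊗ x, d ⊗ y) ↦ c d ⊗ (x ⊗ y)`. -/
def ramifyMul (M N : DiffMod B.Carrier (B.shift q)) :
    M.ramify ρ l →ₗ[B.Ramified l] N.ramify ρ l →ₗ[B.Ramified l] (M.tensor N).ramify ρ l :=
  baseChangeMul B.Carrier (B.Ramified l) M N

theorem ramifyMul_ramι (x : M) (y : N) :
    ramifyMul ρ l M N (ramι ρ l M x) (ramι ρ l N y) =
      ramι ρ l (M.tensor N) (x ⊗ₜ[B.Carrier] y) :=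
  baseChangeMul_one_tmul (R := B.Carrier) (A := B.Ramified l) x y

theorem ramifyMul_comm (s : M.ramify ρ l) (t : N.ramify ρ l) :
    ramifyMul ρ l M N ((M.ramify ρ l).Φ s) ((N.ramify ρ l).Φ t) =
      ((M.tensor N).ramify ρ l).Φ (ramifyMul ρ l M N s t) := by
  induction s using ramify_induction with
  | h0 => simp
  | hadd s s' hs hs' => simp only [map_add, LinearMap.add_apply, hs, hs']
  | hι c x =>
    induction t using ramify_induction with
    | h0 => simp
    | hadd s s' hs hs' => simp only [map_add, hs, hs']
    | hι d y =>
      have h : ((M.tensor N).ramify ρ l).Φ (ramι ρ l (M.tensor N) (x ⊗ₜ[B.Carrier] y)) =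
          ramι ρ l (M.tensor N) (M.Φ x ⊗ₜ[B.Carrier] N.Φ y) :=
        (ramι_comm (M := M.tensor N) ρ l (x ⊗ₜ[B.Carrier] y)).symm
      rw [map_smulₛₗ (M.ramify ρ l).Φ, map_smulₛₗ (N.ramify ρ l).Φ, ← ramι_comm, ← ramι_comm,
        map_smul, LinearMap.map_smul₂, ramifyMul_ramι, map_smul, LinearMap.map_smul₂,
        ramifyMul_ramι, map_smulₛₗ, map_smulₛₗ, h]

theorem map₂_ramifyMul : Submodule.map₂ (ramifyMul ρ l M N) ⊤ ⊤ = ⊤ := by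
  refine eq_top_iff.2 fun t _ => ?_
  induction t using ramify_induction with
  | h0 => exact zero_mem _
  | hadd s t hs ht => exact add_mem (hs trivial) (ht trivial)
  | hι c t =>
    refine Submodule.smul_mem _ _ ?_
    clear * -
    induction t using TensorProduct.induction_on with
    | zero => exact (map_zero (ramι ρ l (M.tensor N))).symm ▸ zero_mem _
    | add s t hs ht =>
      exact (map_add (ramι ρ l (M.tensor N)) s t).symm ▸ add_mem hs ht
    | tmul x y =>
      rw [← ramifyMul_ramι]
      exact Submodule.apply_mem_map₂ _ trivial trivial

theorem finrank_ramify :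
    Module.finrank (B.Ramified l) (M.ramify ρ l) = Module.finrank B.Carrier M :=
  Module.finrank_baseChange

end DiffMod

/-! ### Calculus of slopes: subquotients, extensions, tensor products, common slopes. -/

namespace DiffMod

theorem span_image_bot {K K' : Type} [Field K] [Field K'] {τ : K →+* K'} {V V' : Type}
    [AddCommGroup V] [Module K V] [AddCommGroup V'] [Module K' V'] (γ : V →ₛₗ[τ] V') :
    Submodule.span K' (γ '' (⊥ : Submodule K V)) = ⊥ := by
  rw [Submodule.bot_coe, Set.image_singleton, map_zero, Submodule.span_singleton_eq_bot]

variable {B : BaseField} {q : ℂˣ} (ρ : RootSystem q) (l : ℕ+)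

/-- The integers `k` such that `k / l ∈ I`. -/
def levelSet (l : ℕ+) (I : Set ℚ) : Set ℤ := {k | (k : ℚ) / (l : ℕ) ∈ I}

theorem mul_mem_levelSet {l : ℕ+} {I : Set ℚ} {k : ℤ} (m : ℕ+) (hk : k ∈ levelSet l I) :
    ((m : ℕ) : ℤ) * k ∈ levelSet (l * m) I := by
  have hm : ((m : ℕ) : ℚ) ≠ 0 := by exact_mod_cast m.ne_zero
  have : (((m : ℕ) : ℤ) * k : ℤ) / ((l * m : ℕ+) : ℕ) = (k : ℚ) / (l : ℕ) := by
    push_cast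
    rw [mul_comm, mul_div_mul_right _ _ hm]
  show _ ∈ I
  rw [this]
  exact hk

/-- At the ramification level `l`, the module `M` is triangularisable with slopes in `I`. -/
def TowerAt (M : DiffMod B.Carrier (B.shift q)) (I : Set ℚ) : Prop :=
  Tower (B.valuation l) (M.ramify ρ l) (levelSet l I) ⊥ ⊤

variable {ρ l} {M N : DiffMod B.Carrier (B.shift q)} {I J : Set ℚ}

theorem slopesIn_iff : SlopesIn ρ M I ↔ ∃ l, TowerAt ρ l M I := by
  simp only [SlopesIn, HasSlopes, TowerAt, tower_iff_devissage]
  constructor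
  · rintro ⟨_, ⟨l, s, hs, rfl⟩, h⟩
    exact ⟨l, s, hs, fun k hk => h _ (Multiset.mem_map_of_mem _ hk)⟩
  · rintro ⟨l, s, hs, h⟩
    refine ⟨_, ⟨l, s, hs, rfl⟩, fun ν hν => ?_⟩
    obtain ⟨k, hk, rfl⟩ := Multiset.mem_map.1 hν
    exact h k hk

/-- The map `K_l ⊗ M → K_{lm} ⊗ M`. -/
def levelMap (ρ : RootSystem q) (l m : ℕ+) (M : DiffMod B.Carrier (B.shift q)) :
    M.ramify ρ l →ₛₗ[B.levelHom l m] M.ramify ρ (l * m) :=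
  ramifyLift ρ l
    { toFun := ramι ρ (l * m) M
      map_add' := map_add _
      map_smul' := fun c x => by
        rw [map_smulₛₗ]
        exact congrArg (· • _) (B.levelHom_ramHom l m c).symm }

theorem levelMap_ramι (m : ℕ+) (x : M) :
    levelMap ρ l m M (ramι ρ l M x) = ramι ρ (l * m) M x :=
  ramifyLift_ramι ρ l _ x

theorem levelMap_comm (m : ℕ+) (t : M.ramify ρ l) :
    levelMap ρ l m M ((M.ramify ρ l).Φ t) = (M.ramify ρ (l * m)).Φ (levelMap ρ l m M t) :=
  ramifyLift_comm ρ l (B.levelHom_ramShift ρ l m) _ (ramι_comm ρ (l * m)) t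

theorem span_image_levelMap_top (m : ℕ+) : Submodule.span (B.Ramified (l * m))
    (levelMap ρ l m M '' (⊤ : Submodule (B.Ramified l) (M.ramify ρ l))) = ⊤ := by
  refine eq_top_iff.2 ((span_range_ramι ρ (l * m) (M := M)).ge.trans (Submodule.span_mono ?_))
  rintro _ ⟨x, rfl⟩
  exact ⟨ramι ρ l M x, trivial, levelMap_ramι m x⟩

theorem tower_levelMap (m : ℕ+) {N W : Submodule (B.Ramified l) (M.ramify ρ l)}
    (h : Tower (B.valuation l) (M.ramify ρ l) (levelSet l I) N W) :
    Tower (B.valuation (l * m)) (M.ramify ρ (l * m)) (levelSet (l * m) I)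
      (Submodule.span _ (levelMap ρ l m M '' N)) (Submodule.span _ (levelMap ρ l m M '' W)) :=
  h.span_image (levelMap ρ l m M) (levelMap_comm m) fun a _ ha => by
    rw [B.valuation_levelHom]
    exact mul_mem_levelSet m ha

/-- Serves to bring towers to a common level: from level `l` to `l m` the valuations are multiplied
by `m`, so the slopes do not change. -/
theorem TowerAt.mul (h : TowerAt ρ l M I) (m : ℕ+) : TowerAt ρ (l * m) M I := by
  have := tower_levelMap m h
  rwa [span_image_bot, span_image_levelMap_top] at this

theorem TowerAt.mul_left (h : TowerAt ρ l M I) (m : ℕ+) : TowerAt ρ (m * l) M I :=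
  mul_comm l m ▸ h.mul m

theorem SlopesIn.mono (h : SlopesIn ρ M I) (hIJ : I ⊆ J) : SlopesIn ρ M J := by
  obtain ⟨t, ht, h⟩ := h
  exact ⟨t, ht, fun ν hν => hIJ (h ν hν)⟩

theorem SlopesIn.of_injective (h : SlopesIn ρ N I) (f : M ⟶ N)
    (hf : Function.Injective f.toLin) : SlopesIn ρ M I := by
  obtain ⟨l, h⟩ := slopesIn_iff.1 h
  refine slopesIn_iff.2 ⟨l, ?_⟩
  have := h.comap (ramifyMap ρ l f) (stable_bot _)
  rwa [Submodule.comap_top, Submodule.comap_bot,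
    LinearMap.ker_eq_bot.2 (ramifyMap_injective ρ l hf)] at this

theorem SlopesIn.of_exact {A C : DiffMod B.Carrier (B.shift q)} (hA : SlopesIn ρ A I)
    (hC : SlopesIn ρ C I) (f : A ⟶ M) (g : M ⟶ C) (h : Function.Exact f.toLin g.toLin) :
    SlopesIn ρ M I := by
  obtain ⟨l, hA⟩ := slopesIn_iff.1 hA
  obtain ⟨m, hC⟩ := slopesIn_iff.1 hC
  refine slopesIn_iff.2 ⟨l * m, ?_⟩
  have h1 := (hA.mul m).map (ramifyMap ρ (l * m) f)
  have h2 := (hC.mul_left l).comap (ramifyMap ρ (l * m) g) (stable_bot _)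
  rw [Submodule.comap_top, Submodule.comap_bot,
    (ramifyMap_exact ρ (l * m) h).linearMap_ker_eq, ← Submodule.map_top] at h2
  rw [Submodule.map_bot] at h1
  exact h1.trans h2

theorem SlopesIn.tensor {L : Set ℚ} (hM : SlopesIn ρ M I) (hN : SlopesIn ρ N J)
    (hL : ∀ μ ∈ I, ∀ ν ∈ J, μ + ν ∈ L) : SlopesIn ρ (M.tensor N) L := by
  obtain ⟨l, hM⟩ := slopesIn_iff.1 hM
  obtain ⟨m, hN⟩ := slopesIn_iff.1 hN
  refine slopesIn_iff.2 ⟨l * m, ?_⟩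
  have := (hM.mul m).map₂ (L := levelSet (l * m) L) (fun a b ha hb hva hvb => ?_)
    (ramifyMul ρ (l * m) M N) (ramifyMul_comm ρ (l * m)) (hN.mul_left l)
  · rwa [map₂_ramifyMul] at this
  · rw [B.valuation_mul _ ha hb]
    have := hL _ hva _ hvb
    rw [← add_div] at this
    show ((_ : ℤ) : ℚ) / _ ∈ L
    exact_mod_cast this

/-- The two hypotheses may come from unrelated towers at different levels; at a common level
`Tower.inter` compares them. It plays the role of uniqueness of the slopes. -/
theorem SlopesIn.inter (hI : SlopesIn ρ M I) (hJ : SlopesIn ρ M J) : SlopesIn ρ M (I ∩ J) := by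
  obtain ⟨l, hI⟩ := slopesIn_iff.1 hI
  obtain ⟨m, hJ⟩ := slopesIn_iff.1 hJ
  exact slopesIn_iff.2 ⟨l * m, Tower.inter (B.isInvariantValuation _ _) (hI.mul m)
    (hJ.mul_left l) (stable_bot _)⟩

theorem subsingleton_of_ramify (h : (⊤ : Submodule (B.Ramified l) (M.ramify ρ l)) = ⊥) :
    Subsingleton M := by
  refine subsingleton_of_forall_eq 0 fun x => ramι_injective ρ l ?_
  rw [map_zero]
  exact (Submodule.mem_bot _).1 (h.le trivial)

theorem SlopesIn.subsingleton (h : SlopesIn ρ M ∅) : Subsingleton M := by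
  obtain ⟨l, h⟩ := slopesIn_iff.1 h
  exact subsingleton_of_ramify (ρ := ρ) (l := l) (Tower.eq_of_empty (v := B.valuation l) h)

theorem slopesIn_of_subsingleton [Subsingleton M] : SlopesIn ρ M I := by
  refine slopesIn_iff.2 ⟨1, ?_⟩
  have : (⊤ : Submodule (B.Ramified 1) (M.ramify ρ 1)) = ⊥ := by
    refine eq_bot_iff.2 fun t _ => ?_
    induction t using ramify_induction with
    | h0 => exact zero_mem _
    | hι c x => rw [Subsingleton.elim x 0, map_zero, smul_zero]; exact zero_mem _
    | hadd s t hs ht => exact add_mem (hs trivial) (ht trivial)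
  rw [TowerAt, this]
  exact .refl

/-- There are no nonzero morphisms between modules without common slopes. -/
theorem SlopesIn.hom_eq_zero (hM : SlopesIn ρ M I) (hN : SlopesIn ρ N J) (hIJ : I ∩ J = ∅)
    (f : M ⟶ N) : f.toLin = 0 := by
  have hst : N.IsStable (LinearMap.range f.toLin) := by
    rw [← Submodule.map_top]
    exact IsStable.map (M := M) f fun x => Iff.rfl
  -- The image is a quotient of `M` and a submodule of `N`, so its slopes lie in both sets.
  have h1 : SlopesIn ρ (N.sub _ hst) I :=
    hM.of_surjective (N := N.sub _ hst) ⟨f.toLin.rangeRestrict, fun x => Subtype.ext (f.comm x)⟩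
      f.toLin.surjective_rangeRestrict
  have h2 : SlopesIn ρ (N.sub _ hst) J := hN.of_injective (N.subι _ hst) Subtype.val_injective
  have h3 := h1.inter h2
  rw [hIJ] at h3
  have := h3.subsingleton
  ext x
  exact congrArg Subtype.val (this.elim (⟨f.toLin x, x, rfl⟩ : LinearMap.range f.toLin) 0)

theorem slopesIn_unit : SlopesIn ρ (unit : DiffMod B.Carrier (B.shift q)) {0} := by
  refine slopesIn_iff.2 ⟨1, ?_⟩
  obtain ⟨e, he, hspan⟩ : ∃ e : (unit : DiffMod B.Carrier (B.shift q)), unit.Φ e = e ∧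
      ∀ x, ∃ c : B.Carrier, x = c • e :=
    ⟨(1 : B.Carrier), map_one (B.shift q), fun x => ⟨x, (mul_one (M := B.Carrier) x).symm⟩⟩
  have hv : B.valuation 1 1 = 0 := HahnSeries.order_one
  have := (Tower.refl (v := B.valuation 1) (M := ramify ρ 1 unit) (I := levelSet 1 {0})
    (N := ⊥)).step (ramι ρ 1 unit e) 1 one_ne_zero (by simp [hv, levelSet]) (by
      rw [← ramι_comm, he, one_smul, sub_self]
      exact zero_mem _)
  rw [bot_sup_eq] at this
  suffices h : (⊤ : Submodule (B.Ramified 1) (ramify ρ 1 unit)) ≤ B.Ramified 1 ∙ ramι ρ 1 unit e by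
    rwa [top_le_iff.1 h] at this
  refine (span_range_ramι ρ 1 (M := unit)).ge.trans (Submodule.span_le.2 ?_)
  rintro _ ⟨x, rfl⟩
  obtain ⟨c, rfl⟩ := hspan x
  rw [map_smulₛₗ]
  exact Submodule.smul_mem _ _ (Submodule.mem_span_singleton_self _)

end DiffMod

/-! ### Newton polygon: solutions of q-difference equations twisted by a monomial. -/

section Monomials

theorem isExpansion_single (m : ℤ) (c : ℂ) :
    IsExpansion (HahnSeries.single m c) fun z => c * z ^ m := by
  filter_upwards with z
  convert! hasSum_single (α := ℂ) m fun n hn => ?_ using 1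
  · simp
  · rw [HahnSeries.coeff_single_of_ne hn, zero_mul]

theorem single_mem (B : BaseField) (m : ℤ) (c : ℂ) : HahnSeries.single m c ∈ B.toSubfield := by
  have h : MeromorphicOn (fun z : ℂ => c * z ^ m) Set.univ := fun z _ =>
    (MeromorphicAt.const c z).mul ((MeromorphicAt.id z).zpow m)
  cases B with
  | global => exact ⟨_, h, isExpansion_single m c⟩
  | convergent => exact ⟨_, fun z _ => h z trivial, isExpansion_single m c⟩
  | formal => trivial

theorem dilate_single (r : ℂˣ) (m : ℤ) (c : ℂ) :
    dilate r (HahnSeries.single m c) = HahnSeries.single m ((r : ℂ) ^ m * c) := by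
  ext n
  by_cases h : n = m
  · subst h; simp
  · rw [dilate_coeff, HahnSeries.coeff_single_of_ne h, HahnSeries.coeff_single_of_ne h, mul_zero]

/-- The element `c z_l ^ m` of `K_l`. -/
def BaseField.monomial (B : BaseField) (l : ℕ+) (m : ℤ) (c : ℂ) : B.Ramified l :=
  (⟨HahnSeries.single m c, single_mem B m c⟩ : B.Carrier)

theorem BaseField.monomial_ne_zero (B : BaseField) (l : ℕ+) (m : ℤ) {c : ℂ} (hc : c ≠ 0) :
    B.monomial l m c ≠ 0 := fun h =>
  hc (HahnSeries.single_eq_zero_iff.1 (congrArg Subtype.val h))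

theorem BaseField.monomial_mul (B : BaseField) (l : ℕ+) (m n : ℤ) (c d : ℂ) :
    B.monomial l m c * B.monomial l n d = B.monomial l (m + n) (c * d) :=
  Subtype.ext HahnSeries.single_mul_single

theorem BaseField.ramShift_monomial (B : BaseField) (l : ℕ+) (r : ℂˣ) (m : ℤ) (c : ℂ) :
    B.ramShift l r (B.monomial l m c) = B.monomial l m ((r : ℂ) ^ m * c) :=
  Subtype.ext (dilate_single r m c)

theorem coeff_mul_monomial (B : BaseField) (l : ℕ+) (f : B.Ramified l) (s m : ℤ) (c : ℂ) :
    (Subtype.val (f * B.monomial l s c) : LaurentSeries ℂ).coeff m =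
      (Subtype.val f : LaurentSeries ℂ).coeff (m - s) * c := by
  have := HahnSeries.coeff_mul_single_add (x := (Subtype.val f : LaurentSeries ℂ)) (r := c)
    (a := m - s) (b := s)
  rwa [sub_add_cancel] at this

end Monomials

/-- A nonzero root of maximal absolute value. -/
theorem exists_root_of_max_norm {p : Polynomial ℂ} (hp : p.Monic) {i : ℕ} (hi : i < p.natDegree)
    (hpi : p.coeff i ≠ 0) :
    ∃ c, c ≠ 0 ∧ p.eval c = 0 ∧ ∀ d, ‖c‖ < ‖d‖ → p.eval d ≠ 0 := by
  have h1 : ∃ c, c ≠ 0 ∧ p.eval c = 0 := by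
    by_contra! h
    -- If `0` were the only root, `p` would be a power of `X` and its coefficient `i` would vanish.
    have hr : p.roots = Multiset.replicate p.natDegree 0 := by
      refine Multiset.eq_replicate.2 ⟨(IsAlgClosed.splits p).natDegree_eq_card_roots.symm,
        fun c hc => ?_⟩
      by_contra hc0
      exact h c hc0 (Polynomial.isRoot_of_mem_roots hc)
    have := (IsAlgClosed.splits p).eq_prod_roots_of_monic hp
    rw [hr, Multiset.map_replicate, Multiset.prod_replicate, map_zero, sub_zero] at this
    rw [this, Polynomial.coeff_X_pow, if_neg hi.ne] at hpi
    exact hpi rfl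
  obtain ⟨c₀, hc₀, hr₀⟩ := h1
  have hmem : ∀ d, p.eval d = 0 ↔ d ∈ p.roots.toFinset := fun d => by
    rw [Multiset.mem_toFinset, Polynomial.mem_roots hp.ne_zero, Polynomial.IsRoot.def]
  obtain ⟨c, hc, hmax⟩ := p.roots.toFinset.exists_max_image (fun c => ‖c‖) ⟨c₀, (hmem _).1 hr₀⟩
  refine ⟨c, ?_, (hmem _).2 hc, fun d hd h => absurd (hmax d ((hmem _).1 h)) (not_le.2 hd)⟩
  rintro rfl
  have := hmax c₀ ((hmem _).1 hr₀)
  simp [hc₀] at this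

/-- The numbers `r ^ (k i (i - 1) / 2)`. -/
def thetaCoeff (r : ℂˣ) (k : ℤ) : ℕ → ℂ
  | 0 => 1
  | i + 1 => thetaCoeff r k i * (r : ℂ) ^ (k * i)

theorem thetaCoeff_ne_zero (r : ℂˣ) (k : ℤ) (i : ℕ) : thetaCoeff r k i ≠ 0 := by
  induction i with
  | zero => exact one_ne_zero
  | succ i ih => exact mul_ne_zero ih (zpow_ne_zero _ r.ne_zero)

/-- A `q`-difference equation whose Newton polygon has smallest slope `k` has a solution of the
form `ψ = e f`, where `e` is a solution of an equation `σ e = c z ^ k e` and `f` is in `K_l`. The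
sequence `ψ i` is `σ ^ i ψ / e`. -/
theorem BaseField.exists_twisted_solution (B : BaseField) (l : ℕ+) {r : ℂˣ} (hr : 1 < ‖(r : ℂ)‖)
    (n : ℕ) (A : ℕ → B.Ramified l) (k : ℤ)
    (hA : ∀ i < n, ∀ m < k * (n - i), (Subtype.val (A i) : LaurentSeries ℂ).coeff m = 0)
    {i₀ : ℕ} (hi₀ : i₀ < n) (hAi₀ : (Subtype.val (A i₀) : LaurentSeries ℂ).coeff (k * (n - i₀)) ≠ 0) :
    ∃ c : ℂ, c ≠ 0 ∧ ∃ ψ : ℕ → B.Ramified l, ψ 0 ≠ 0 ∧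
      (∀ i, ψ (i + 1) = B.monomial l k c * B.ramShift l r (ψ i)) ∧
        ψ n = ∑ i ∈ Finset.range n, A i * ψ i := by
  -- For `ψ i = c^i r^(k i(i-1)/2) z^(k i) σ^i f` with `f(0) = 1`, the terms of lowest degree `k n`
  -- in the equation give `c^n = ∑ α_i c^i`. So `X ^ n - Q` is the characteristic polynomial of the
  -- slope `k`, and `i₀` makes it different from `X ^ n`.
  let α : ℕ → ℂ := fun i => (Subtype.val (A i) : LaurentSeries ℂ).coeff (k * (n - i)) *
    (thetaCoeff r k i / thetaCoeff r k n)
  let Q : Polynomial ℂ := ∑ i ∈ Finset.range n, Polynomial.C (α i) * Polynomial.X ^ i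
  have hQdeg : Q.degree < n := by
    rw [← Polynomial.mem_degreeLT]
    refine Submodule.sum_mem _ fun i hi => Polynomial.mem_degreeLT.2 ?_
    exact (Polynomial.degree_C_mul_X_pow_le _ _).trans_lt
      (by exact_mod_cast Finset.mem_range.1 hi)
  have hQcoeff : Q.coeff i₀ = α i₀ := by
    rw [Polynomial.finsetSum_coeff, Finset.sum_eq_single i₀]
    · simp
    · intro i _ hi
      rw [Polynomial.coeff_C_mul_X_pow, if_neg hi.symm]
    · exact fun h => absurd (Finset.mem_range.2 hi₀) h
  have hmonic : (Polynomial.X ^ n - Q).Monic := Polynomial.monic_X_pow_sub hQdeg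
  have hdeg : (Polynomial.X ^ n - Q).natDegree = n := by
    rw [sub_eq_add_neg, Polynomial.natDegree_add_eq_left_of_degree_lt] <;> simp [hQdeg]
  -- Maximality of `|c|` provides nonresonance: for `m ≥ 1`, `c r ^ m` has larger modulus and is not
  -- a root.
  obtain ⟨c, hc, hroot, hmax⟩ := exists_root_of_max_norm hmonic (i := i₀) (by rwa [hdeg]) (by
    rw [Polynomial.coeff_sub, Polynomial.coeff_X_pow, if_neg hi₀.ne, hQcoeff, zero_sub, neg_ne_zero]
    exact mul_ne_zero hAi₀ (div_ne_zero (thetaCoeff_ne_zero _ _ _) (thetaCoeff_ne_zero _ _ _)))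
  have heval : ∀ d, (Polynomial.X ^ n - Q).eval d = d ^ n - ∑ i ∈ Finset.range n, α i * d ^ i :=
    fun d => by simp [Q, Polynomial.eval_finsetSum]
  rw [heval] at hroot
  have hn0 := thetaCoeff_ne_zero r k n
  -- The coefficients of the equation for `f`, obtained on dividing by `c^n r^(k n(n-1)/2) z^(k n)`;
  -- they are integral by `hA`.
  let C : ℕ → B.Ramified l := fun i => A i * B.monomial l (-(k * (n - i)))
    (c ^ i * thetaCoeff r k i / (c ^ n * thetaCoeff r k n))
  have hC : ∀ i m, (Subtype.val (C i) : LaurentSeries ℂ).coeff m =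
      (Subtype.val (A i) : LaurentSeries ℂ).coeff (m + k * (n - i)) *
        (c ^ i * thetaCoeff r k i / (c ^ n * thetaCoeff r k n)) := fun i m => by
    rw [coeff_mul_monomial, sub_neg_eq_add]
  have hC0 : ∀ i, (Subtype.val (C i) : LaurentSeries ℂ).coeff 0 = α i * c ^ i / c ^ n := fun i => by
    rw [hC, zero_add]
    simp only [α]
    field_simp
  have hCneg : ∀ i < n, ∀ m < 0, (Subtype.val (C i) : LaurentSeries ℂ).coeff m = 0 :=
    fun i hi m hm => by rw [hC, hA i hi _ (by linarith), zero_mul]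
  have hval : ∀ m : ℤ, (Subtype.val (∑ i ∈ Finset.range n, C i - 1) : LaurentSeries ℂ).coeff m =
      ∑ i ∈ Finset.range n, (Subtype.val (C i) : LaurentSeries ℂ).coeff m -
        (1 : LaurentSeries ℂ).coeff m := fun m => by
    have : (Subtype.val (∑ i ∈ Finset.range n, C i - 1) : LaurentSeries ℂ) =
        ∑ i ∈ Finset.range n, (Subtype.val (C i) : LaurentSeries ℂ) - 1 := by
      let ι : B.Ramified l →+* LaurentSeries ℂ := B.toSubfield.subtype
      have h : ι (∑ i ∈ Finset.range n, C i - 1) = ∑ i ∈ Finset.range n, ι (C i) - 1 := by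
        rw [map_sub, map_sum, map_one]
      exact h
    rw [this, HahnSeries.coeff_sub, HahnSeries.coeff_sum]
  -- With `f = 1 + g` and `g` starting in degree `1`, the inhomogeneous term is `∑ C_i - 1`; its
  -- constant coefficient vanishes because `c` is a root.
  obtain ⟨(g : B.Ramified l), hg, hsol⟩ := B.exists_solution hr (n := n) C
    (∑ i ∈ Finset.range n, C i - 1 : B.Ramified l) 1 hCneg (fun m hm => by
      refine (hval m).trans ?_
      rcases (Int.lt_add_one_iff.1 (zero_add (1 : ℤ) ▸ hm)).lt_or_eq with hm | rfl
      · rw [Finset.sum_eq_zero fun i hi => hCneg i (Finset.mem_range.1 hi) m hm,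
          HahnSeries.coeff_one, if_neg hm.ne, sub_zero]
      · rw [Finset.sum_congr rfl fun i _ => hC0 i, ← Finset.sum_div, HahnSeries.coeff_one, if_pos rfl,
          ← sub_eq_zero.1 hroot, div_self (pow_ne_zero _ hc), sub_self]) (fun m hm => by
      have h1 := hmax (c * (r : ℂ) ^ m) (by
        rw [norm_mul, norm_zpow]
        exact lt_mul_of_one_lt_right (norm_pos_iff.2 hc) (one_lt_zpow₀ hr (by omega)))
      rw [heval] at h1
      convert div_ne_zero h1 (pow_ne_zero n hc) using 1
      rw [sub_div, Finset.sum_div]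
      congr 1
      · rw [mul_pow, mul_div_cancel_left₀ _ (pow_ne_zero _ hc), ← zpow_natCast, ← zpow_natCast,
          zpow_comm]
      · refine Finset.sum_congr rfl fun i _ => ?_
        rw [hC0, mul_pow, ← zpow_natCast ((r : ℂ) ^ m), zpow_comm, zpow_natCast]
        ring)
  let S : ℕ → B.Ramified l ≃+* B.Ramified l := fun i => B.ramShift l (r ^ i)
  have hsol : S n g = ∑ i ∈ Finset.range n, C i * S i g + (∑ i ∈ Finset.range n, C i - 1) := hsol
  have hS : ∀ i f, S (i + 1) f = B.ramShift l r (S i f) := fun i f => Subtype.ext (by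
    ext m
    show (dilate _ _).coeff m = (dilate _ (dilate _ _)).coeff m
    simp only [dilate_coeff, pow_succ, mul_zpow]
    push_cast
    ring)
  have hf : S n (1 + g) = ∑ i ∈ Finset.range n, C i * S i (1 + g) := by
    simp only [map_add, map_one, mul_add, mul_one, Finset.sum_add_distrib]
    rw [hsol]
    ring
  have ht : ∀ i, B.monomial l (k * (i + 1 : ℕ)) (c ^ (i + 1) * thetaCoeff r k (i + 1)) =
      B.monomial l k c *
        B.ramShift l r (B.monomial l (k * i) (c ^ i * thetaCoeff r k i)) := fun i => by
    rw [B.ramShift_monomial, B.monomial_mul, thetaCoeff]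
    congr 1
    · push_cast; ring
    · ring
  refine ⟨c, hc, fun i => B.monomial l (k * i) (c ^ i * thetaCoeff r k i) * S i (1 + g), ?_, ?_, ?_⟩
  · refine mul_ne_zero (B.monomial_ne_zero _ _ (by simp [thetaCoeff])) ((map_ne_zero _).2 fun h => ?_)
    have h : (1 : LaurentSeries ℂ) + Subtype.val g = 0 := congrArg Subtype.val h
    have := congrArg (fun f : LaurentSeries ℂ => f.coeff 0) h
    simp [hg 0 one_pos] at this
  · intro i
    simp only
    rw [ht, hS, map_mul, mul_assoc]
  · simp only
    rw [hf, Finset.mul_sum]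
    refine Finset.sum_congr rfl fun i _ => ?_
    have : B.monomial l (k * n) (c ^ n * thetaCoeff r k n) * C i =
        A i * B.monomial l (k * i) (c ^ i * thetaCoeff r k i) := by
      rw [mul_left_comm, B.monomial_mul]
      congr 2
      · ring
      · field_simp
    rw [← mul_assoc, this, mul_assoc]

/-! ### Rank-one quotients and triangularisation. -/

namespace DiffMod

section RankOne

variable {K : Type} [Field K] {σ : K ≃+* K}

/-- The module `(K, a σ)` of rank one. -/
def rankOne (σ : K ≃+* K) (a : K) (ha : a ≠ 0) : DiffMod K σ where
  carrier := K
  Φ :=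
    { toFun := fun x => a * σ x
      map_add' := fun x y => by rw [map_add, mul_add]
      map_smul' := fun c x => by simp [mul_left_comm] }
  bijective := (mulLeft_bijective₀ a ha).comp σ.bijective

theorem tower_rankOne (v : K → ℤ) (a : K) (ha : a ≠ 0) :
    Tower v (rankOne σ a ha) Set.univ ⊥ ⊤ := by
  obtain ⟨e, he, hspan⟩ : ∃ e : rankOne σ a ha, (rankOne σ a ha).Φ e = a • e ∧
      ∀ x, ∃ c : K, c • e = x :=
    ⟨(1 : K), congrArg (a * ·) (map_one σ), fun x => ⟨x, mul_one (M := K) x⟩⟩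
  have := (Tower.refl (v := v) (M := rankOne σ a ha) (I := Set.univ) (N := ⊥)).step e a ha trivial
    (by rw [he, sub_self]; exact zero_mem _)
  rwa [bot_sup_eq, (Submodule.span_singleton_eq_top_iff K e).2 hspan] at this

/-- A subspace with `Φ N ⊆ N` is a submodule, by finiteness of the dimension. -/
theorem isStable_of_le {M : DiffMod K σ} {N : Submodule K M} (h : ∀ x ∈ N, M.Φ x ∈ N) :
    M.IsStable N := by
  refine fun x => ⟨fun hx => ?_, h x⟩
  -- The preimages of `N` under the iterates of `Φ` form an ascending chain, which becomes
  -- stationary at some `k`; writing `x = Φ^k y` turns this into the claim.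
  let C : ℕ →o Submodule K M := ⟨fun k => (fun V => V.comap M.Φ)^[k] N, monotone_nat_of_le_succ
    fun k => by
      induction k with
      | zero => exact h
      | succ k ih =>
        rw [Function.iterate_succ_apply', Function.iterate_succ_apply' _ (k + 1)]
        exact Submodule.comap_mono ih⟩
  obtain ⟨k, hk⟩ := monotone_stabilizes_iff_noetherian.2 (inferInstance : IsNoetherian K M) C
  have hmem : ∀ k x, x ∈ C k ↔ M.Φ^[k] x ∈ N := fun k => by
    induction k with
    | zero => exact fun x => Iff.rfl
    | succ k ih =>
      intro x
      rw [Function.iterate_succ_apply, ← ih]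
      show x ∈ (fun V => V.comap M.Φ)^[k + 1] N ↔ _
      rw [Function.iterate_succ_apply']
      rfl
  obtain ⟨y, rfl⟩ := M.bijective.2.iterate k x
  rw [← hmem k, hk (k + 1) (Nat.le_succ k), hmem, Function.iterate_succ_apply']
  exact hx

/-- A nonzero module without nontrivial submodules is generated by a cyclic basis. -/
theorem exists_cyclic (M : DiffMod K σ) [Nontrivial M] :
    (∃ N, M.IsStable N ∧ N ≠ ⊥ ∧ N ≠ ⊤) ∨
      ∃ (x : M) (n : ℕ) (b : Module.Basis (Fin n) K M) (a : ℕ → K), x ≠ 0 ∧ (∀ i, b i = M.Φ^[i] x) ∧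
        M.Φ^[n] x = ∑ i ∈ Finset.range n, a i • M.Φ^[i] x := by
  obtain ⟨x, hx⟩ := exists_ne (0 : M)
  have hex : ∃ n, ¬ LinearIndependent K fun i : Fin (n + 1) => M.Φ^[i] x := by
    refine ⟨Module.finrank K M, fun h => ?_⟩
    have := h.fintype_card_le_finrank
    simp at this
  classical
  let n := Nat.find hex
  have hn : ¬ LinearIndependent K fun i : Fin (n + 1) => M.Φ^[i] x := Nat.find_spec hex
  have hli : LinearIndependent K fun i : Fin n => M.Φ^[i] x := by
    rcases hn0 : n with _ | k
    · exact linearIndependent_empty_type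
    · exact not_not.1 (Nat.find_min hex (m := k) (by show k < n; omega))
  have hmem : M.Φ^[n] x ∈ Submodule.span K (Set.range fun i : Fin n => M.Φ^[i] x) := by
    by_contra h
    exact hn (linearIndependent_finSucc'.2 ⟨hli, h⟩)
  have hn0 : n ≠ 0 := by
    intro h
    rw [h] at hmem
    simp at hmem
    exact hx hmem
  obtain ⟨a, ha⟩ := (Submodule.mem_span_range_iff_exists_fun K).1 hmem
  have hst : M.IsStable (Submodule.span K (Set.range fun i : Fin n => M.Φ^[i] x)) := by
    refine isStable_of_le fun y hy => ?_
    induction hy using Submodule.span_induction with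
    | mem y hy =>
      obtain ⟨i, rfl⟩ := hy
      show M.Φ (M.Φ^[i] x) ∈ _
      rw [← Function.iterate_succ_apply' M.Φ]
      by_cases hi : (i : ℕ) + 1 = n
      · rw [show (i : ℕ).succ = n from hi]; exact hmem
      · exact Submodule.subset_span ⟨⟨i + 1, by omega⟩, rfl⟩
    | zero => rw [map_zero]; exact zero_mem _
    | add y z _ _ hy hz => rw [map_add]; exact add_mem hy hz
    | smul c y _ hy => rw [map_smulₛₗ]; exact Submodule.smul_mem _ _ hy
  by_cases htop : Submodule.span K (Set.range fun i : Fin n => M.Φ^[i] x) = ⊤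
  · refine Or.inr ⟨x, n, Module.Basis.mk hli htop.ge, fun i => if h : i < n then a ⟨i, h⟩ else 0,
      hx, fun i => by rw [Module.Basis.mk_apply], ?_⟩
    rw [← ha, Finset.sum_range]
    exact Finset.sum_congr rfl fun i _ => by simp only [dif_pos i.2]
  · refine Or.inl ⟨_, hst, fun h => hx ?_, htop⟩
    have : x ∈ Submodule.span K (Set.range fun i : Fin n => M.Φ^[i] x) :=
      Submodule.subset_span ⟨⟨0, Nat.pos_of_ne_zero hn0⟩, rfl⟩
    rw [h] at this
    exact (Submodule.mem_bot K).1 this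

end RankOne

end DiffMod

namespace DiffMod

variable {B : BaseField} {q : ℂˣ} {ρ : RootSystem q} {l : ℕ+} {M : DiffMod B.Carrier (B.shift q)}

theorem one_lt_norm_root (hq : 1 < ‖(q : ℂ)‖) (ρ : RootSystem q) (l : ℕ+) :
    1 < ‖(ρ.root l : ℂ)‖ := by
  by_contra! h
  refine absurd hq (not_lt.2 ?_)
  rw [← ρ.root_pow l, Units.val_pow_eq_pow_val, norm_pow]
  exact pow_le_one₀ (norm_nonneg _) h

/-- A cyclic module has, after ramification, a quotient of rank one. -/
theorem exists_hom_rankOne (hq : 1 < ‖(q : ℂ)‖) (ρ : RootSystem q) {x : M} {n : ℕ}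
    (b : Module.Basis (Fin n) B.Carrier M) {a : ℕ → B.Carrier} (hx : x ≠ 0)
    (hb : ∀ i, b i = M.Φ^[i] x)
    (hrel : M.Φ^[n] x = ∑ i ∈ Finset.range n, a i • M.Φ^[i] x) :
    ∃ (l : ℕ+) (e : B.Ramified l) (he : e ≠ 0)
      (φ : M.ramify ρ l ⟶ rankOne (B.ramShift l (ρ.root l)) e he), φ.toLin ≠ 0 := by
  classical
  -- If all the `a i` vanished, then `Φ^n x = 0`, against the injectivity of `Φ`.
  have hne : ((Finset.range n).filter fun i => a i ≠ 0).Nonempty := by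
    by_contra h
    rw [Finset.not_nonempty_iff_eq_empty, Finset.filter_eq_empty_iff] at h
    have h0 : M.Φ^[n] x = 0 := by
      rw [hrel]
      exact Finset.sum_eq_zero fun i hi => by rw [not_not.1 (h hi), zero_smul]
    have hzero : ∀ k, M.Φ^[k] 0 = 0 := fun k => by
      induction k with
      | zero => rfl
      | succ k ih => rw [Function.iterate_succ_apply', ih, map_zero]
    exact hx (M.bijective.1.iterate n (h0.trans (hzero n).symm))
  -- The index `i₀` realises the smallest slope `ord(a i) / (n - i)` of the Newton polygon.
  -- Ramification of order `n - i₀` turns it into the integer `ord(a i₀)`.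
  obtain ⟨i₀, hi₀, hmin⟩ := Finset.exists_min_image _
    (fun i => ((a i : LaurentSeries ℂ).order : ℚ) / (n - i)) hne
  obtain ⟨hi₀n, hai₀⟩ := Finset.mem_filter.1 hi₀
  have hi₀n := Finset.mem_range.1 hi₀n
  have hord : ∀ i < n, a i ≠ 0 → (a i₀ : LaurentSeries ℂ).order * ((n : ℤ) - i) ≤
      ((n : ℤ) - i₀) * (a i : LaurentSeries ℂ).order := fun i hi hai => by
    have h := hmin i (Finset.mem_filter.2 ⟨Finset.mem_range.2 hi, hai⟩)
    have h1 : (0 : ℚ) < n - i₀ := sub_pos.2 (by exact_mod_cast hi₀n)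
    have h2 : (0 : ℚ) < n - i := sub_pos.2 (by exact_mod_cast hi)
    rw [div_le_div_iff₀ h1 h2] at h
    have h : (a i₀ : LaurentSeries ℂ).order * ((n : ℤ) - i) ≤
      (a i : LaurentSeries ℂ).order * ((n : ℤ) - i₀) := by exact_mod_cast h
    linarith
  let l : ℕ+ := ⟨n - i₀, by omega⟩
  have hl : ((l : ℕ) : ℤ) = (n : ℤ) - i₀ := by
    show ((n - i₀ : ℕ) : ℤ) = _
    omega
  have hram : ∀ i, (Subtype.val (B.ramHom l (a i)) : LaurentSeries ℂ) = powSubst l (a i) :=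
    fun i => rfl
  obtain ⟨c, hc, ψ, hψ0, hψ, hψn⟩ := B.exists_twisted_solution l (one_lt_norm_root hq ρ l) n
    (fun i => B.ramHom l (a i)) (a i₀ : LaurentSeries ℂ).order (fun i hi m hm => by
      rw [hram]
      by_cases hai : a i = 0
      · rw [hai]
        exact congrArg (fun f : LaurentSeries ℂ => f.coeff m) (map_zero (powSubst l))
      · refine HahnSeries.coeff_eq_zero_of_lt_order (hm.trans_le ?_)
        rw [order_powSubst, hl]
        exact hord i hi hai) hi₀n (by
      rw [hram, ← hl, mul_comm, powSubst_coeff_mul]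
      exact HahnSeries.coeff_order_eq_zero.not.2 fun h => hai₀ (Subtype.ext h))
  have he := B.monomial_ne_zero l (a i₀ : LaurentSeries ℂ).order hc
  set e := B.monomial l (a i₀ : LaurentSeries ℂ).order c
  -- A solution sequence `ψ` is a linear form on the cyclic module with values in `K_l`; the two
  -- relations satisfied by `ψ` make it intertwine `Φ` with `e σ`.
  let φ₀ : M →ₗ[B.Carrier] B.Ramified l := b.constr B.Carrier fun i => ψ i
  have hφ₀ : ∀ i < n, φ₀ (M.Φ^[i] x) = ψ i := fun i hi => by
    rw [← hb ⟨i, hi⟩]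
    exact b.constr_basis _ _ _
  have hφn : φ₀ (M.Φ^[n] x) = ψ n := by
    rw [hrel, hψn, map_sum]
    refine Finset.sum_congr rfl fun i hi => ?_
    rw [map_smul, hφ₀ i (Finset.mem_range.1 hi), Algebra.smul_def]
    rfl
  have hcomm : ∀ y, φ₀ (M.Φ y) = e * B.ramShift l (ρ.root l) (φ₀ y) := fun y => by
    have hy : y ∈ Submodule.span B.Carrier (Set.range b) := b.span_eq.symm ▸ Submodule.mem_top
    induction hy using Submodule.span_induction with
    | mem y hy =>
      obtain ⟨i, rfl⟩ := hy
      rw [hb, hφ₀ i i.2, ← hψ, ← Function.iterate_succ_apply' M.Φ]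
      by_cases hi : (i : ℕ) + 1 < n
      · exact hφ₀ _ hi
      · rw [show (i : ℕ).succ = n by omega, show (i : ℕ) + 1 = n by omega, hφn]
    | zero => simp
    | add y z _ _ hy hz => simp only [map_add, hy, hz, mul_add]
    | smul c y _ hy =>
      rw [map_smulₛₗ, map_smul, Algebra.smul_def, map_smul, hy, Algebra.smul_def, map_mul]
      have : B.ramShift l (ρ.root l) (algebraMap B.Carrier (B.Ramified l) c) =
          algebraMap B.Carrier (B.Ramified l) (B.shift q c) := B.ramShift_ramHom ρ l c
      rw [this, RingHom.coe_coe]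
      exact mul_left_comm _ _ _
  let γ : M →ₛₗ[(RingHom.id (B.Ramified l)).comp (B.ramHom l)]
      rankOne (B.ramShift l (ρ.root l)) e he :=
    { toFun := φ₀
      map_add' := map_add φ₀
      map_smul' := fun c y => (map_smul φ₀ c y).trans (Algebra.smul_def _ _) }
  refine ⟨l, e, he, ⟨ramifyLift ρ l γ, ramifyLift_comm ρ l (fun _ => rfl) γ hcomm⟩, fun h => ?_⟩
  have h1 : ramifyLift ρ l γ (ramι ρ l M x) = 0 := LinearMap.congr_fun h (ramι ρ l M x)
  rw [ramifyLift_ramι] at h1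
  refine hψ0 (Eq.trans ?_ h1)
  refine (hφ₀ 0 ?_).symm
  omega

/-- Base change of towers to an arbitrary module over `K_m`. -/
theorem TowerAt.span_range {X : DiffMod B.Carrier (B.shift q)} (h : TowerAt ρ l X Set.univ)
    {Y : DiffMod (B.Ramified l) (B.ramShift l (ρ.root l))} (γ : X →ₛₗ[B.ramHom l] Y)
    (hγ : ∀ x, γ (X.Φ x) = Y.Φ (γ x)) :
    Tower (B.valuation l) Y Set.univ ⊥ (Submodule.span _ (Set.range γ)) := by
  let γ' : X →ₛₗ[(RingHom.id (B.Ramified l)).comp (B.ramHom l)] Y := γ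
  let f : X.ramify ρ l ⟶ Y :=
    ⟨ramifyLift ρ l γ', ramifyLift_comm ρ l (fun _ => rfl) γ' hγ⟩
  have h : Tower (B.valuation l) (X.ramify ρ l) _ ⊥ ⊤ := h
  have h1 := (h.map f).mono (Set.subset_univ _)
  rw [Submodule.map_bot] at h1
  convert h1
  rw [← span_range_ramι, Submodule.map_span, ← Set.range_comp]
  congr 2
  ext x
  exact (ramifyLift_ramι ρ l γ' x).symm

/-- Every module is triangularisable after ramification. -/
theorem exists_towerAt (n : ℕ) : ∀ {q : ℂˣ}, 1 < ‖(q : ℂ)‖ → ∀ (ρ : RootSystem q)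
    (M : DiffMod B.Carrier (B.shift q)), Module.finrank B.Carrier M = n →
      ∃ l, TowerAt ρ l M Set.univ := by
  induction n using Nat.strong_induction_on with
  | _ n ih =>
    intro q hq ρ M hM
    rcases subsingleton_or_nontrivial M with hs | hn
    · exact slopesIn_iff.1 slopesIn_of_subsingleton
    rcases M.exists_cyclic with ⟨N, hN, hbot, htop⟩ | ⟨x, k, b, a, hx, hb, hrel⟩
    · have h1 : SlopesIn ρ (M.sub N hN) Set.univ :=
        slopesIn_iff.2 (ih _ (hM ▸ Submodule.finrank_lt htop) hq ρ _ rfl)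
      have h2 : SlopesIn ρ (M.quot N hN) Set.univ := by
        refine slopesIn_iff.2 (ih _ (hM ▸ ?_) hq ρ _ rfl)
        have h3 := Submodule.finrank_quotient_add_finrank N
        have h4 := Submodule.one_le_finrank_iff.2 hbot
        show Module.finrank B.Carrier (M ⧸ N) < _
        omega
      exact slopesIn_iff.1 (h1.of_exact h2 (M.subι N hN) (M.quotπ N hN)
        (LinearMap.exact_subtype_mkQ N))
    · obtain ⟨l, e, he, φ, hφ⟩ := exists_hom_rankOne hq ρ b hx hb hrel
      have hker := (tower_rankOne (B.valuation l) e he).comap φ (stable_bot _)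
      rw [Submodule.comap_top, Submodule.comap_bot] at hker
      have hst : (M.ramify ρ l).IsStable (LinearMap.ker φ.toLin) := by
        rw [← Submodule.comap_bot]
        intro t
        rw [Submodule.mem_comap, φ.comm]
        exact stable_bot _ _
      have hlt : Module.finrank (B.Ramified l) (LinearMap.ker φ.toLin) < n := by
        rw [← hM, ← finrank_ramify ρ l]
        exact Submodule.finrank_lt fun h => hφ (LinearMap.ker_eq_top.1 h)
      -- As a type, `K_l` is `K` in the variable `z_l`, so the kernel of `φ` is a `q_l`-difference
      -- module over `K` of smaller rank. This is why the induction runs over all `q` and `ρ`; level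
      -- `m` for the kernel becomes level `l m` for `M`.
      let X : DiffMod B.Carrier (B.shift (ρ.root l)) := (M.ramify ρ l).sub _ hst
      obtain ⟨m, hm⟩ := ih _ hlt (one_lt_norm_root hq ρ l) (ρ.above l) X rfl
      let Y : DiffMod (B.Ramified m) (B.ramShift m ((ρ.above l).root m)) := M.ramify ρ (l * m)
      let γ : X →ₛₗ[B.ramHom m] Y :=
        { toFun := fun t => levelMap ρ l m M (Subtype.val t)
          map_add' := fun s t => map_add (levelMap ρ l m M) _ _
          map_smul' := fun c t => map_smulₛₗ (levelMap ρ l m M) (c : B.Ramified l) _ }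
      have h1 := hm.span_range γ fun t => levelMap_comm m _
      have h2 := tower_levelMap (ρ := ρ) (I := Set.univ) m (hker.mono (Set.subset_univ _))
      rw [span_image_levelMap_top] at h2
      have h3 : Set.range γ = levelMap ρ l m M '' (LinearMap.ker φ.toLin) := by
        ext y
        constructor
        · rintro ⟨t, rfl⟩
          exact ⟨_, t.2, rfl⟩
        · rintro ⟨t, ht, rfl⟩
          exact ⟨⟨t, ht⟩, rfl⟩
      rw [h3] at h1
      exact ⟨l * m, Tower.trans (N := ⊥) h1 h2⟩

/-- Every module has slopes. -/
theorem slopesIn_univ (hq : 1 < ‖(q : ℂ)‖) (ρ : RootSystem q)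
    (M : DiffMod B.Carrier (B.shift q)) : SlopesIn ρ M Set.univ :=
  slopesIn_iff.2 (exists_towerAt _ hq ρ M rfl)

end DiffMod

/-! ### Series `g` for which `g(z^l)` lies in the base field. -/

section RootExtraction

theorem cpow_root_pow (l : ℕ+) (w : ℂ) : (w ^ (((l : ℕ) : ℂ)⁻¹)) ^ (l : ℕ) = w :=
  Complex.cpow_nat_inv_pow w l.ne_zero

theorem convergent_of_powSubst {l : ℕ+} {g : LaurentSeries ℂ}
    (h : powSubst l g ∈ meromorphicSubfield {0} rfl) : g ∈ meromorphicSubfield {0} rfl := by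
  obtain ⟨C, r, -, -, hb⟩ := exists_coeff_bound_of_mem h (((l : ℕ) : ℤ) * g.order)
  refine mem_of_coeff_bound (m₀ := g.order) (C := C) (r := r ^ (l : ℕ))
    (fun m hm => HahnSeries.coeff_eq_zero_of_lt_order hm) fun k => ?_
  have := hb ((l : ℕ) * k)
  rwa [Nat.cast_mul, ← mul_add, powSubst_coeff_mul, pow_mul] at this

/-- The principal root may jump at `w`. The branch `s` is analytic at `w` and differs from the
principal one by an `l`-th root of unity, which `F` does not see. -/
theorem meromorphicAt_comp_root {l : ℕ+} {F : ℂ → ℂ} (hF : MeromorphicOn F Set.univ)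
    (hinv : ∀ z ω : ℂ, ω ^ (l : ℕ) = 1 → F (ω * z) = F z) {w : ℂ} (hw : w ≠ 0) :
    MeromorphicAt (fun w => F (w ^ (((l : ℕ) : ℂ)⁻¹))) w := by
  let s : ℂ → ℂ := fun v => w ^ (((l : ℕ) : ℂ)⁻¹) * (v / w) ^ (((l : ℕ) : ℂ)⁻¹)
  have hs : AnalyticAt ℂ s w := by
    refine analyticAt_const.mul ((analyticAt_id.div_const).cpow analyticAt_const ?_)
    simp [div_self hw]
  have hsl : ∀ v, s v ^ (l : ℕ) = v := fun v => by
    rw [mul_pow, cpow_root_pow, cpow_root_pow, mul_div_cancel₀ _ hw]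
  refine ((hF (s w) trivial).comp_analyticAt hs).congr ?_
  have : ∀ᶠ v in 𝓝[≠] w, v ≠ 0 := nhdsWithin_le_nhds (continuousAt_id.eventually_ne hw)
  filter_upwards [this] with v hv
  have h0 : v ^ (((l : ℕ) : ℂ)⁻¹) ≠ 0 := fun h => hv (by
    rw [← cpow_root_pow l v, h, zero_pow l.ne_zero])
  rw [Function.comp_apply, ← hinv (v ^ (((l : ℕ) : ℂ)⁻¹)) (s v / v ^ (((l : ℕ) : ℂ)⁻¹)),
    div_mul_cancel₀ _ h0]
  rw [div_pow, hsl, cpow_root_pow, div_self hv]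

/-- `F` itself may fail to be invariant pointwise, since a meromorphic function has arbitrary values
on a discrete set. Its average over the `l`-th roots of unity is invariant and has the same
expansion, because each dilation by a root of unity fixes `g(z^l)`. -/
theorem exists_invariant_expansion {l : ℕ+} {g : LaurentSeries ℂ} {F : ℂ → ℂ}
    (hF : MeromorphicOn F Set.univ) (hg : IsExpansion (powSubst l g) F) :
    ∃ G : ℂ → ℂ, MeromorphicOn G Set.univ ∧ IsExpansion (powSubst l g) G ∧
      ∀ z ω : ℂ, ω ^ (l : ℕ) = 1 → G (ω * z) = G z := by
  have hprim := Complex.isPrimitiveRoot_exp (l : ℕ) l.ne_zero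
  set ζ := Complex.exp (2 * Real.pi * Complex.I / (l : ℕ)) with hζ
  have hζ0 : ζ ≠ 0 := Complex.exp_ne_zero _
  have hl : ((l : ℕ) : ℂ) ≠ 0 := by exact_mod_cast l.ne_zero
  let G : ℂ → ℂ := fun z => ((l : ℕ) : ℂ)⁻¹ * ∑ j ∈ Finset.range l, F (ζ ^ j * z)
  have hG1 : ∀ z, G (ζ * z) = G z := fun z => by
    have h1 := Finset.sum_range_succ (fun j => F (ζ ^ j * z)) l
    rw [Finset.sum_range_succ', hprim.pow_eq_one, pow_zero, add_left_inj] at h1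
    simp only [G]
    rw [← h1]
    congr 1
    exact Finset.sum_congr rfl fun j _ => by rw [pow_succ, mul_assoc]
  refine ⟨G, fun z _ => ?_, ?_, fun z ω hω => ?_⟩
  · have : MeromorphicAt (∑ j ∈ Finset.range l, fun z => F (ζ ^ j * z)) z :=
      MeromorphicAt.sum fun j _ => (hF _ trivial).comp_analyticAt (by fun_prop)
    convert! (MeromorphicAt.const ((l : ℕ) : ℂ)⁻¹ z).mul this using 1
    ext z
    simp [G]
  · have hj : ∀ j ∈ Finset.range l, IsExpansion (powSubst l g) fun z => F (ζ ^ j * z) := by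
      intro j _
      have h := hg.dilate (Units.mk0 ζ hζ0 ^ j)
      have h2 : dilate (Units.mk0 ζ hζ0 ^ j) (powSubst l g) = powSubst l g := by
        ext n
        rw [dilate_coeff]
        by_cases hd : ((l : ℕ) : ℤ) ∣ n
        · obtain ⟨n, rfl⟩ := hd
          push_cast
          rw [Units.val_mk0, zpow_mul, zpow_natCast, ← pow_mul, mul_comm j, pow_mul,
            hprim.pow_eq_one, one_pow, one_zpow, one_mul]
        · rw [powSubst_coeff_of_not_dvd l _ hd, mul_zero]
      rw [h2] at h
      simpa [Function.comp_def] using h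
    have h := IsExpansion.sum hj
    filter_upwards [h] with z hz
    convert! hz.mul_left (((l : ℕ) : ℂ)⁻¹) using 1
    · ext n
      rw [Finset.sum_const, Finset.card_range, HahnSeries.coeff_smul, nsmul_eq_mul, ← mul_assoc,
        ← mul_assoc, inv_mul_cancel₀ hl, one_mul]
    · simp [G]
  · obtain ⟨j, -, rfl⟩ := hprim.eq_pow_of_pow_eq_one hω
    induction j generalizing z with
    | zero => simp
    | succ j ih =>
      rw [pow_succ', mul_assoc, hG1]
      exact ih z (by rw [← pow_mul, mul_comm, pow_mul, hprim.pow_eq_one, one_pow])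

/-- Away from `0` the function is `F` composed with a root; at `0`, where no branch exists,
meromorphy comes from the convergence of the series `g`. -/
theorem global_of_powSubst {l : ℕ+} {g : LaurentSeries ℂ}
    (h : powSubst l g ∈ meromorphicSubfield Set.univ trivial) :
    g ∈ meromorphicSubfield Set.univ trivial := by
  obtain ⟨F, hF, hgF⟩ := h
  obtain ⟨G₀, hG₀, hgG₀⟩ := convergent_of_powSubst (l := l) (g := g)
    ⟨F, fun z _ => hF z trivial, hgF⟩
  obtain ⟨F, hF, hgF, hinv⟩ := exists_invariant_expansion hF hgF
  have hexp : IsExpansion g fun w => F (w ^ (((l : ℕ) : ℂ)⁻¹)) := by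
    obtain ⟨R, hR, hball⟩ := Metric.mem_nhdsWithin_iff.1 hgF
    have hev : ∀ᶠ w : ℂ in 𝓝[≠] 0, ‖w‖ < R ^ (l : ℕ) :=
      nhdsWithin_le_nhds (continuous_norm.continuousAt.eventually_lt_const (by
        show ‖(0 : ℂ)‖ < _
        rw [norm_zero]
        positivity))
    filter_upwards [hev, self_mem_nhdsWithin] with w hw hw0
    have hw0 : w ≠ 0 := hw0
    set z := w ^ (((l : ℕ) : ℂ)⁻¹) with hz
    have hzl : z ^ (l : ℕ) = w := cpow_root_pow l w
    have hz0 : z ≠ 0 := fun h => hw0 (by rw [← hzl, h, zero_pow l.ne_zero])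
    have hzR : ‖z‖ < R := by
      rw [← hzl, norm_pow] at hw
      exact lt_of_pow_lt_pow_left₀ _ hR.le hw
    have h : HasSum (fun n : ℤ => (powSubst l g).coeff n * z ^ n) (F z) :=
      hball ⟨by simpa using hzR, hz0⟩
    have hinj : Function.Injective (fun k : ℤ => ((l : ℕ) : ℤ) * k) := fun a b h => by
      simpa using h
    rw [← hinj.hasSum_iff] at h
    · convert! h using 1
      ext n
      rw [Function.comp_apply, powSubst_coeff_mul, zpow_mul, zpow_natCast, hzl]
    · intro n hn
      rw [powSubst_coeff_of_not_dvd l _ fun ⟨m, hm⟩ => hn ⟨m, hm.symm⟩, zero_mul]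
  refine ⟨_, fun w _ => ?_, hexp⟩
  by_cases hw : w = 0
  · subst hw
    exact (hG₀ 0 rfl).congr (hgG₀.eventuallyEq hexp)
  · exact meromorphicAt_comp_root hF hinv hw

theorem mem_of_powSubst_mem {B : BaseField} {l : ℕ+} {g : LaurentSeries ℂ}
    (h : powSubst l g ∈ B.toSubfield) : g ∈ B.toSubfield := by
  cases B with
  | global => exact global_of_powSubst h
  | convergent => exact convergent_of_powSubst h
  | formal => trivial

end RootExtraction

/-! ### Decomposition of `K_l` over `K` by residues of the exponent modulo `l`. -/

section Sections

/-- The series `∑ f_{l n + j} z ^ n`. -/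
def residueSection (l : ℕ+) (j : ℤ) (f : LaurentSeries ℂ) : LaurentSeries ℂ :=
  HahnSeries.ofSuppBddBelow (fun n : ℤ => f.coeff (((l : ℕ) : ℤ) * n + j)) (by
    refine ⟨-(|f.order| + |j|), fun n hn => ?_⟩
    by_contra! h
    refine hn (HahnSeries.coeff_eq_zero_of_lt_order ?_)
    have h1 : (1 : ℤ) ≤ ((l : ℕ) : ℤ) := by exact_mod_cast l.pos
    have h2 := neg_abs_le f.order
    have h3 := le_abs_self j
    have h4 : 0 ≤ |f.order| := abs_nonneg _
    have h5 : 0 ≤ |j| := abs_nonneg _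
    nlinarith)

theorem residueSection_coeff (l : ℕ+) (j : ℤ) (f : LaurentSeries ℂ) (n : ℤ) :
    (residueSection l j f).coeff n = f.coeff (((l : ℕ) : ℤ) * n + j) := rfl

variable {l : ℕ+} {ζ : ℂˣ}

theorem sum_pow_div_pow (hζ : IsPrimitiveRoot (ζ : ℂ) l) (m j : ℤ) :
    ∑ i ∈ Finset.range l, ((ζ : ℂ) ^ m / (ζ : ℂ) ^ j) ^ i =
      if ((l : ℕ) : ℤ) ∣ m - j then ((l : ℕ) : ℂ) else 0 := by
  have h0 : (ζ : ℂ) ≠ 0 := ζ.ne_zero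
  rw [← zpow_sub₀ h0]
  split_ifs with h
  · rw [(hζ.zpow_eq_one_iff_dvd _).2 h]
    simp
  · have hne : (ζ : ℂ) ^ (m - j) - 1 ≠ 0 := fun h' =>
      h ((hζ.zpow_eq_one_iff_dvd _).1 (sub_eq_zero.1 h'))
    have := geom_sum_mul ((ζ : ℂ) ^ (m - j)) l
    rw [← zpow_natCast, ← zpow_mul, mul_comm (m - j), zpow_mul, zpow_natCast, hζ.pow_eq_one, one_zpow,
      sub_self] at this
    exact (mul_eq_zero.1 this).resolve_right hne

/-- Discrete Fourier inversion: averaging `ζ^(-ij) f(ζ^i z)` over `i` keeps exactly the exponents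
congruent to `j` modulo `l`. -/
theorem powSubst_residueSection (hζ : IsPrimitiveRoot (ζ : ℂ) l) (j : ℤ) (f : LaurentSeries ℂ) :
    powSubst l (residueSection l j f) = HahnSeries.single (-j) ((l : ℕ) : ℂ)⁻¹ *
      ∑ i ∈ Finset.range l, HahnSeries.single 0 (((ζ : ℂ) ^ j)⁻¹ ^ i) * dilate (ζ ^ i) f := by
  have hl : ((l : ℕ) : ℂ) ≠ 0 := by exact_mod_cast l.ne_zero
  ext n
  have h1 := HahnSeries.coeff_single_mul_add (r := ((l : ℕ) : ℂ)⁻¹) (x := ∑ i ∈ Finset.range l,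
    HahnSeries.single (0 : ℤ) (((ζ : ℂ) ^ j)⁻¹ ^ i) * dilate (ζ ^ i) f) (a := n + j) (b := -j)
  rw [add_neg_cancel_right] at h1
  have h2 : (∑ i ∈ Finset.range l, HahnSeries.single (0 : ℤ) (((ζ : ℂ) ^ j)⁻¹ ^ i) *
      dilate (ζ ^ i) f).coeff (n + j) =
        (if ((l : ℕ) : ℤ) ∣ n then ((l : ℕ) : ℂ) else 0) * f.coeff (n + j) := by
    rw [HahnSeries.coeff_sum]
    have h3 := sum_pow_div_pow hζ (n + j) j
    rw [add_sub_cancel_right] at h3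
    rw [← h3, Finset.sum_mul]
    refine Finset.sum_congr rfl fun i _ => ?_
    rw [HahnSeries.coeff_single_zero_mul, dilate_coeff]
    push_cast
    rw [div_pow, ← zpow_natCast (((ζ : ℂ) ^ (n + j))), zpow_comm, zpow_natCast]
    rw [inv_pow]
    ring
  rw [h1, h2]
  by_cases h : ((l : ℕ) : ℤ) ∣ n
  · rw [if_pos h]
    obtain ⟨n, rfl⟩ := h
    rw [powSubst_coeff_mul, residueSection_coeff]
    field_simp
  · rw [if_neg h, powSubst_coeff_of_not_dvd l _ h, zero_mul, mul_zero]

/-- The Fourier formula stays in the base field but gives the section only after `z ↦ z^l`; root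
extraction undoes the substitution. -/
theorem residueSection_mem {B : BaseField} (hζ : IsPrimitiveRoot (ζ : ℂ) l) (j : ℤ)
    {f : LaurentSeries ℂ} (hf : f ∈ B.toSubfield) : residueSection l j f ∈ B.toSubfield := by
  refine mem_of_powSubst_mem (l := l) ?_
  rw [powSubst_residueSection hζ]
  exact mul_mem (single_mem B _ _) (sum_mem fun i _ => mul_mem (single_mem B _ _) (dilate_mem B _ hf))

theorem eq_sum_residueSection (l : ℕ+) (f : LaurentSeries ℂ) :
    f = ∑ j ∈ Finset.range l, HahnSeries.single (j : ℤ) 1 * powSubst l (residueSection l j f) := by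
  ext n
  have hcoeff : ∀ j : ℕ, (HahnSeries.single (j : ℤ) (1 : ℂ) *
      powSubst l (residueSection l j f)).coeff n =
        if ((l : ℕ) : ℤ) ∣ n - j then f.coeff n else 0 := fun j => by
    have h1 := HahnSeries.coeff_single_mul_add (r := (1 : ℂ))
      (x := powSubst l (residueSection l j f)) (a := n - j) (b := (j : ℤ))
    rw [sub_add_cancel, one_mul] at h1
    rw [h1]
    split_ifs with h
    · obtain ⟨m, hm⟩ := h
      rw [hm, powSubst_coeff_mul, residueSection_coeff, ← hm, sub_add_cancel]
    · exact powSubst_coeff_of_not_dvd l _ h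
  have hl : (0 : ℤ) < ((l : ℕ) : ℤ) := by exact_mod_cast l.pos
  have hmod := Int.emod_nonneg n hl.ne'
  have hlt := Int.emod_lt_of_pos n hl
  rw [HahnSeries.coeff_sum, Finset.sum_congr rfl fun j _ => hcoeff j,
    Finset.sum_eq_single (n % ((l : ℕ) : ℤ)).toNat, if_pos]
  · rw [Int.toNat_of_nonneg hmod]
    exact Int.dvd_self_sub_emod
  · intro j hj hne
    refine if_neg fun h => hne ?_
    have hj := Finset.mem_range.1 hj
    have h3 : (j : ℤ) % ((l : ℕ) : ℤ) = n % ((l : ℕ) : ℤ) := Int.modEq_iff_dvd.2 h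
    rw [Int.emod_eq_of_lt (by positivity) (by exact_mod_cast hj)] at h3
    omega
  · intro h
    refine absurd (Finset.mem_range.2 ?_) h
    omega

end Sections

/-! ### Action of the roots of unity and Galois descent of the splitting. -/

section Galois

variable {l : ℕ+} {ζ : ℂˣ}

theorem dilate_powSubst_of_pow_eq_one (hζ : ζ ^ (l : ℕ) = 1) (f : LaurentSeries ℂ) :
    dilate ζ (powSubst l f) = powSubst l f := by
  ext n
  rw [dilate_coeff]
  by_cases h : ((l : ℕ) : ℤ) ∣ n
  · obtain ⟨n, rfl⟩ := h
    rw [zpow_mul, zpow_natCast, hζ, one_zpow, Units.val_one, one_mul]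
  · rw [powSubst_coeff_of_not_dvd l _ h, mul_zero]

theorem BaseField.ramShift_comm (B : BaseField) (l : ℕ+) (r s : ℂˣ) (f : B.Ramified l) :
    B.ramShift l r (B.ramShift l s f) = B.ramShift l s (B.ramShift l r f) :=
  Subtype.ext (by
    ext n
    show (dilate r (dilate s _)).coeff n = (dilate s (dilate r _)).coeff n
    simp only [dilate_coeff]
    ring)

theorem BaseField.ramShift_ramHom_of_pow_eq_one (B : BaseField) (hζ : ζ ^ (l : ℕ) = 1)
    (c : B.Carrier) : B.ramShift l ζ (B.ramHom l c) = B.ramHom l c :=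
  Subtype.ext (dilate_powSubst_of_pow_eq_one hζ (c : LaurentSeries ℂ))

/-- The powers `1, z_l, …, z_l ^ (l - 1)` span `K_l` over `K`. -/
theorem BaseField.exists_eq_sum_monomial (B : BaseField) (hζ : IsPrimitiveRoot (ζ : ℂ) l)
    (f : B.Ramified l) : ∃ g : ℕ → B.Carrier,
      f = ∑ j ∈ Finset.range l, B.monomial l j 1 * B.ramHom l (g j) := by
  refine ⟨fun j => ⟨residueSection l j (Subtype.val f), residueSection_mem hζ j (Subtype.prop f)⟩,
    Subtype.ext ?_⟩
  let ι : B.Ramified l →+* LaurentSeries ℂ := B.toSubfield.subtype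
  show ι f = ι _
  rw [map_sum]
  exact eq_sum_residueSection l (Subtype.val f)

theorem BaseField.sum_monomial (B : BaseField) (l : ℕ+) (s : Finset ℕ) (c : ℕ → ℂ) :
    ∑ i ∈ s, B.monomial l 0 (c i) = B.monomial l 0 (∑ i ∈ s, c i) := by
  let ι : B.Ramified l →+* LaurentSeries ℂ := B.toSubfield.subtype
  apply Subtype.ext
  show ι (∑ i ∈ s, B.monomial l 0 (c i)) = ι (B.monomial l 0 (∑ i ∈ s, c i))
  rw [map_sum]
  exact (map_sum (HahnSeries.single.addMonoidHom (0 : ℤ) : ℂ →+ LaurentSeries ℂ) c s).symm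

end Galois

namespace DiffMod

variable {B : BaseField} {q : ℂˣ} {ρ : RootSystem q} {l : ℕ+} {M : DiffMod B.Carrier (B.shift q)}
  {ζ : ℂˣ}

/-- The action of a root of unity on `K_l ⊗ M`. -/
def galoisMap (ρ : RootSystem q) (M : DiffMod B.Carrier (B.shift q)) (hζ : ζ ^ (l : ℕ) = 1) :
    M.ramify ρ l →ₛₗ[(B.ramShift l ζ : B.Ramified l →+* B.Ramified l)] M.ramify ρ l :=
  ramifyLift ρ l
    { toFun := ramι ρ l M
      map_add' := map_add _
      map_smul' := fun c x => by
        rw [map_smulₛₗ]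
        exact congrArg (· • _) (B.ramShift_ramHom_of_pow_eq_one hζ c).symm }

theorem galoisMap_ramι (hζ : ζ ^ (l : ℕ) = 1) (x : M) :
    galoisMap ρ M hζ (ramι ρ l M x) = ramι ρ l M x :=
  ramifyLift_ramι ρ l _ x

theorem galoisMap_comm (hζ : ζ ^ (l : ℕ) = 1) (t : M.ramify ρ l) :
    galoisMap ρ M hζ ((M.ramify ρ l).Φ t) = (M.ramify ρ l).Φ (galoisMap ρ M hζ t) :=
  ramifyLift_comm ρ l (fun c => B.ramShift_comm l ζ (ρ.root l) c) _ (ramι_comm ρ l) t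

theorem exists_eq_sum_ramι (hζ : IsPrimitiveRoot (ζ : ℂ) l) (t : M.ramify ρ l) :
    ∃ m : ℕ → M, t = ∑ j ∈ Finset.range l, B.monomial l j 1 • ramι ρ l M (m j) := by
  induction t using ramify_induction with
  | h0 => exact ⟨0, by simp⟩
  | hι c x =>
    obtain ⟨g, hg⟩ := B.exists_eq_sum_monomial hζ c
    refine ⟨fun j => g j • x, ?_⟩
    rw [hg, Finset.sum_smul]
    exact Finset.sum_congr rfl fun j _ => by rw [map_smulₛₗ, mul_smul]
  | hadd s t hs ht =>
    obtain ⟨m, rfl⟩ := hs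
    obtain ⟨n, rfl⟩ := ht
    refine ⟨m + n, ?_⟩
    rw [← Finset.sum_add_distrib]
    exact Finset.sum_congr rfl fun j _ => by rw [Pi.add_apply, map_add, smul_add]

/-- Galois descent for subspaces of `K_l ⊗ M`. -/
theorem le_span_of_galois_invariant (hζ : IsPrimitiveRoot (ζ : ℂ) l)
    {W : Submodule (B.Ramified l) (M.ramify ρ l)}
    (hW : ∀ (ω : ℂˣ) (hω : ω ^ (l : ℕ) = 1), ∀ t ∈ W, galoisMap ρ M hω t ∈ W) :
    W ≤ Submodule.span (B.Ramified l) (ramι ρ l M '' {x | ramι ρ l M x ∈ W}) := by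
  intro t ht
  obtain ⟨m, rfl⟩ := exists_eq_sum_ramι hζ t
  have hl : ((l : ℕ) : ℂ) ≠ 0 := by exact_mod_cast l.ne_zero
  have hζl : ζ ^ (l : ℕ) = 1 := Units.ext (by push_cast; exact hζ.pow_eq_one)
  have hpow : ∀ i : ℕ, (ζ ^ i) ^ (l : ℕ) = 1 := fun i => by
    rw [← pow_mul, mul_comm, pow_mul, hζl, one_pow]
  refine Submodule.sum_mem _ fun j hj => Submodule.smul_mem _ _ (Submodule.subset_span ⟨m j, ?_, rfl⟩)
  -- The projector onto the character `j` of the group of roots of unity isolates the term `z_l^j ⊗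
  -- m_j` of `t`, up to the factor `l`, and it preserves `W`.
  have hsum : ∑ i ∈ Finset.range l, B.monomial l 0 (((ζ : ℂ) ^ (j : ℤ))⁻¹ ^ i) •
      galoisMap ρ M (hpow i) (∑ k ∈ Finset.range l, B.monomial l k 1 • ramι ρ l M (m k)) =
        B.monomial l j (l : ℕ) • ramι ρ l M (m j) := by
    have h1 : ∀ i k : ℕ, B.monomial l 0 (((ζ : ℂ) ^ (j : ℤ))⁻¹ ^ i) •
        galoisMap ρ M (hpow i) (B.monomial l k 1 • ramι ρ l M (m k)) =
          B.monomial l 0 (((ζ : ℂ) ^ (k : ℤ) / (ζ : ℂ) ^ (j : ℤ)) ^ i) •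
            B.monomial l k 1 • ramι ρ l M (m k) := fun i k => by
      rw [map_smulₛₗ, galoisMap_ramι, RingHom.coe_coe, B.ramShift_monomial, smul_smul, smul_smul,
        B.monomial_mul, B.monomial_mul]
      congr 2
      push_cast
      rw [zpow_natCast, zpow_natCast, zpow_natCast, div_pow, inv_pow, ← pow_mul, ← pow_mul,
        ← pow_mul, mul_comm k]
      ring
    simp only [map_sum, Finset.smul_sum]
    rw [Finset.sum_comm, Finset.sum_congr rfl fun k _ => Finset.sum_congr rfl fun i _ => h1 i k]
    rw [Finset.sum_eq_single j]
    · rw [← Finset.sum_smul, BaseField.sum_monomial, sum_pow_div_pow hζ, sub_self,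
        if_pos (dvd_zero _), smul_smul, B.monomial_mul, zero_add, mul_one]
    · intro k hk hkj
      rw [← Finset.sum_smul, BaseField.sum_monomial, sum_pow_div_pow hζ, if_neg]
      · have : B.monomial l 0 0 = 0 := Subtype.ext (HahnSeries.single_eq_zero)
        rw [this, zero_smul]
      · intro h
        have h1 := Finset.mem_range.1 hk
        have h2 := Finset.mem_range.1 hj
        have := Int.eq_zero_of_abs_lt_dvd h (by rw [abs_lt]; constructor <;> omega)
        omega
    · exact fun h => absurd hj h
  have hmem : B.monomial l j (l : ℕ) • ramι ρ l M (m j) ∈ W :=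
    hsum ▸ Submodule.sum_mem _ fun i _ => W.smul_mem _ (hW _ _ _ ht)
  exact (W.smul_mem_iff (B.monomial_ne_zero l j hl)).1 hmem

/-- The canonical submodule with slopes in an upper set `I`, whose cokernel has its slopes outside
`I`. -/
theorem exists_slope_splitting (hq : 1 < ‖(q : ℂ)‖) (ρ : RootSystem q)
    (M : DiffMod B.Carrier (B.shift q)) {I : Set ℚ} (hI : IsUpperSet I) :
    ∃ (N : Submodule B.Carrier M) (h : M.IsStable N), SlopesIn ρ (M.sub N h) I ∧
      SlopesIn ρ (M.quot N h) Iᶜ := by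
  obtain ⟨l, hl⟩ := exists_towerAt _ hq ρ M rfl
  have hJ : IsUpperSet (levelSet l I) := fun a b hab ha => hI (by gcongr) ha
  have hval := B.isInvariantValuation l (ρ.root l)
  obtain ⟨N, -, hN, hN'⟩ := Tower.exists_split
    (fun a b ha hb hab u => B.exists_mul_shift_sub l (one_lt_norm_root hq ρ l) ha hb hab u) hJ hl
  have hNst := hN.isStable (stable_bot _)
  have hgal : ∀ (ω : ℂˣ) (hω : ω ^ (l : ℕ) = 1), ∀ t ∈ N, galoisMap ρ M hω t ∈ N := by
    intro ω hω t ht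
    -- The action of `ω` commutes with `Φ` and preserves valuations, so the image of `N` again has
    -- slopes in `I`. The slopes above `N` lie outside `I`, hence the image is contained in `N`.
    have h1 := hN.span_image (v' := B.valuation l) (I' := levelSet l I) (galoisMap ρ M hω)
      (galoisMap_comm hω) fun a _ ha => by
        have : B.valuation l (B.ramShift l ω a) = B.valuation l a := order_dilate ω (Subtype.val a)
        rw [RingHom.coe_coe, this]
        exact ha
    rw [span_image_bot] at h1
    exact h1.le_of_disjoint hval hN' hNst (Set.inter_compl_self _)
      (Submodule.subset_span ⟨t, ht, rfl⟩)
  let N₀ : Submodule B.Carrier M := N.comap (ramι ρ l M)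
  have hst : M.IsStable N₀ := fun x => by
    rw [Submodule.mem_comap, Submodule.mem_comap, ramι_comm]
    exact hNst _
  refine ⟨N₀, hst, slopesIn_iff.2 ⟨l, ?_⟩, slopesIn_iff.2 ⟨l, ?_⟩⟩
  · have h1 := hN.comap (ramifyMap ρ l (M.subι N₀ hst)) (stable_bot _)
    rw [Submodule.comap_bot,
      LinearMap.ker_eq_bot.2 (ramifyMap_injective ρ l (f := M.subι N₀ hst) Subtype.val_injective)] at h1
    have h2 : N.comap (ramifyMap ρ l (M.subι N₀ hst)).toLin = ⊤ := by
      refine eq_top_iff.2 ((span_range_ramι ρ l).ge.trans (Submodule.span_le.2 ?_))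
      rintro _ ⟨x, rfl⟩
      exact Subtype.prop x
    rwa [h2] at h1
  · have h1 := hN'.map (ramifyMap ρ l (M.quotπ N₀ hst))
    rw [Submodule.map_top, LinearMap.range_eq_top.2
      (ramifyMap_surjective ρ l (f := M.quotπ N₀ hst) N₀.mkQ_surjective)] at h1
    have h2 : N.map (ramifyMap ρ l (M.quotπ N₀ hst)).toLin = ⊥ := by
      have hζ := Complex.isPrimitiveRoot_exp (l : ℕ) l.ne_zero
      -- By descent, `N` is spanned by its vectors coming from `M`. These form `N₀`, which dies in
      -- the quotient.
      rw [eq_bot_iff, Submodule.map_le_iff_le_comap]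
      refine (le_span_of_galois_invariant (ζ := Units.mk0 _ (Complex.exp_ne_zero _)) hζ hgal).trans
        (Submodule.span_le.2 ?_)
      rintro _ ⟨x, hx, rfl⟩
      show (ramifyMap ρ l (M.quotπ N₀ hst)).toLin (ramι ρ l M x) = 0
      rw [ramifyMap_ramι, show (M.quotπ N₀ hst).toLin x = 0 from
        (Submodule.Quotient.mk_eq_zero N₀).2 hx, map_zero]
    rwa [h2] at h1

end DiffMod

/-! ### The slope filtration and the dimension of its graded module. -/

namespace DiffMod

variable {B : BaseField} {q : ℂˣ} {ρ : RootSystem q} {M N : DiffMod B.Carrier (B.shift q)}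
  {I J : Set ℚ}

theorem le_largestSub {W : Submodule B.Carrier M} (hW : M.IsStable W)
    (h : SlopesIn ρ (M.sub W hW) I) : W ≤ M.largestSub ρ I :=
  le_sSup ⟨hW, h⟩

theorem isStable_range (f : M ⟶ N) : N.IsStable (LinearMap.range f.toLin) := by
  rw [← Submodule.map_top]
  exact IsStable.map (M := M) f fun x => Iff.rfl

theorem SlopesIn.range (h : SlopesIn ρ M I) (f : M ⟶ N) :
    SlopesIn ρ (N.sub _ (isStable_range f)) I :=
  h.of_surjective (N := N.sub _ (isStable_range f))
    ⟨f.toLin.rangeRestrict, fun x => Subtype.ext (f.comm x)⟩ f.toLin.surjective_rangeRestrict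

theorem SlopesIn.range_le (h : SlopesIn ρ M I) (f : M ⟶ N) :
    LinearMap.range f.toLin ≤ N.largestSub ρ I :=
  le_largestSub (isStable_range f) (h.range f)

theorem SlopesIn.sub_of_le {V W : Submodule B.Carrier M} (hV : M.IsStable V) (hW : M.IsStable W)
    (hVW : V ≤ W) (h : SlopesIn ρ (M.sub W hW) I) : SlopesIn ρ (M.sub V hV) I :=
  h.of_injective (M := M.sub V hV) ⟨Submodule.inclusion hVW, fun _ => rfl⟩
    (Submodule.inclusion_injective hVW)

section Splitting

/-- A submodule with slopes in `I` maps to zero in the quotient of `exists_slope_splitting`, whose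
slopes lie outside `I`. So the submodule given there is the largest one. -/
theorem slopesIn_largestSub_and_quot (hq : 1 < ‖(q : ℂ)‖) (M : DiffMod B.Carrier (B.shift q))
    (hI : IsUpperSet I) :
    SlopesIn ρ (M.sub _ (M.largestSub_stable ρ I)) I ∧
      SlopesIn ρ (M.quot _ (M.largestSub_stable ρ I)) Iᶜ := by
  obtain ⟨W, hW, h1, h2⟩ := exists_slope_splitting hq ρ M hI
  have : M.largestSub ρ I = W := by
    refine le_antisymm (sSup_le fun V ⟨hV, h⟩ x hx => ?_) (le_largestSub hW h1)
    have h3 := h.hom_eq_zero h2 (Set.inter_compl_self I) (M.subι V hV ≫ M.quotπ W hW)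
    exact (Submodule.Quotient.mk_eq_zero W).1 (LinearMap.congr_fun h3 (⟨x, hx⟩ : V))
  subst this
  exact ⟨h1, h2⟩

theorem slopesIn_largestSub (hq : 1 < ‖(q : ℂ)‖) (M : DiffMod B.Carrier (B.shift q))
    (hI : IsUpperSet I) :
    SlopesIn ρ (M.sub _ (M.largestSub_stable ρ I)) I :=
  (slopesIn_largestSub_and_quot hq M hI).1

theorem slopesIn_quot_largestSub (hq : 1 < ‖(q : ℂ)‖) (M : DiffMod B.Carrier (B.shift q))
    (hI : IsUpperSet I) :
    SlopesIn ρ (M.quot _ (M.largestSub_stable ρ I)) Iᶜ :=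
  (slopesIn_largestSub_and_quot hq M hI).2

theorem filtGT_le_filtGE (ρ : RootSystem q) (M : DiffMod B.Carrier (B.shift q)) (μ : ℚ) :
    M.filtGT ρ μ ≤ M.filtGE ρ μ :=
  M.largestSub_mono ρ Set.Ioi_subset_Ici_self

/-- The injection `M^{(μ)} → M / F^{> μ}(M)`. -/
def slopePartι (ρ : RootSystem q) (M : DiffMod B.Carrier (B.shift q)) (μ : ℚ) :
    M.slopePart ρ μ ⟶ M.quot (M.filtGT ρ μ) (M.largestSub_stable ρ _) :=
  ⟨Submodule.mapQ _ _ (M.filtGE ρ μ).subtype le_rfl, fun x => by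
    obtain ⟨x, rfl⟩ := Submodule.mkQ_surjective _ x
    rfl⟩

theorem slopePartι_injective (ρ : RootSystem q) (M : DiffMod B.Carrier (B.shift q)) (μ : ℚ) :
    Function.Injective (slopePartι ρ M μ).toLin := by
  refine (injective_iff_map_eq_zero _).2 fun x hx => ?_
  obtain ⟨x, rfl⟩ := Submodule.mkQ_surjective _ x
  exact (Submodule.Quotient.mk_eq_zero _).2 ((Submodule.Quotient.mk_eq_zero (M.filtGT ρ μ)).1 hx)

/-- As a quotient of `F^{≥ μ}(M)` it has slopes `≥ μ`; as a submodule of `M / F^{> μ}(M)` it has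
slopes `≤ μ`. -/
theorem slopesIn_slopePart (hq : 1 < ‖(q : ℂ)‖) (M : DiffMod B.Carrier (B.shift q)) (μ : ℚ) :
    SlopesIn ρ (M.slopePart ρ μ) {μ} := by
  have h1 : SlopesIn ρ (M.slopePart ρ μ) (Set.Ici μ) :=
    (slopesIn_largestSub hq M (isUpperSet_Ici μ)).of_surjective (N := M.slopePart ρ μ)
      (quotπ _ _ _) (Submodule.mkQ_surjective _)
  have h2 : SlopesIn ρ (M.slopePart ρ μ) (Set.Ioi μ)ᶜ :=
    (slopesIn_quot_largestSub hq M (isUpperSet_Ioi μ)).of_injective _ (slopePartι_injective ρ M μ)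
  refine (h1.inter h2).mono fun ν hν => ?_
  exact le_antisymm (not_lt.1 hν.2) hν.1

/-- A set of slopes of least cardinality makes multiplicities irrelevant: if its minimum could be
avoided, `SlopesIn.inter` would give a smaller set. -/
theorem exists_min_slope (hq : 1 < ‖(q : ℂ)‖) (ρ : RootSystem q)
    (M : DiffMod B.Carrier (B.shift q)) [Nontrivial M] :
    ∃ μ, SlopesIn ρ M (Set.Ici μ) ∧ ¬ SlopesIn ρ M (Set.Ioi μ) := by
  classical
  have hex : ∃ n, ∃ T : Finset ℚ, T.card = n ∧ SlopesIn ρ M T := by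
    obtain ⟨t, ht, -⟩ := slopesIn_univ hq ρ M
    exact ⟨_, t.toFinset, rfl, t, ht, fun ν hν => by simpa using hν⟩
  obtain ⟨T, hT, hs⟩ := Nat.find_spec hex
  have hne : T.Nonempty := by
    rw [Finset.nonempty_iff_ne_empty]
    rintro rfl
    rw [Finset.coe_empty] at hs
    exact not_subsingleton M hs.subsingleton
  refine ⟨T.min' hne, hs.mono fun ν hν => T.min'_le ν hν, fun h => ?_⟩
  refine Nat.find_min hex (m := (T.erase (T.min' hne)).card) ?_ ⟨_, rfl, (hs.inter h).mono ?_⟩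
  · rw [← hT]
    exact Finset.card_erase_lt_of_mem (T.min'_mem hne)
  · rintro ν ⟨hν, hlt⟩
    rw [Finset.coe_erase]
    exact ⟨hν, (Set.mem_Ioi.1 hlt).ne'⟩

/-- A subspace containing representatives of all the slope parts contains all the steps of the
filtration. -/
theorem largestSub_le_of_slopeParts (hq : 1 < ‖(q : ℂ)‖) {R : Submodule B.Carrier M}
    (hR : ∀ μ, ∀ x ∈ M.filtGE ρ μ, ∃ y ∈ R, x - y ∈ M.filtGT ρ μ) (n : ℕ) :
    ∀ I, IsUpperSet I → Module.finrank B.Carrier (M.largestSub ρ I) = n →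
      M.largestSub ρ I ≤ R := by
  induction n using Nat.strong_induction_on with
  | _ n ih =>
    intro I hI hn
    by_cases hbot : M.largestSub ρ I = ⊥
    · rw [hbot]; exact bot_le
    have hnt : Nontrivial (M.sub _ (M.largestSub_stable ρ I)) :=
      Submodule.nontrivial_iff_ne_bot.2 hbot
    obtain ⟨μ, h1, h2⟩ := exists_min_slope hq ρ (M.sub _ (M.largestSub_stable ρ I))
    have h3 := slopesIn_largestSub (ρ := ρ) hq M hI
    have hμ : μ ∈ I := by
      by_contra hμ
      exact h2 (h3.mono fun ν hν => lt_of_not_ge fun hle => hμ (hI hle hν))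
    -- The submodule for `I` is exactly `F^{≥ μ}(M)`, and `F^{> μ}(M)` is strictly smaller by the
    -- choice of `μ`, so the induction applies to it.
    have hle : M.largestSub ρ I ≤ M.filtGE ρ μ := le_largestSub _ h1
    have hge : M.filtGE ρ μ ≤ M.largestSub ρ I := M.largestSub_mono ρ fun ν hν => hI hν hμ
    have hlt : M.filtGT ρ μ < M.largestSub ρ I := by
      refine lt_of_le_of_ne ((M.filtGT_le_filtGE ρ μ).trans hge) fun h => h2 ?_
      exact SlopesIn.sub_of_le _ (M.largestSub_stable ρ _) h.ge
        (slopesIn_largestSub (ρ := ρ) hq M (isUpperSet_Ioi μ))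
    have hsub := ih _ (hn ▸ Submodule.finrank_lt_finrank_of_lt hlt) (Set.Ioi μ) (isUpperSet_Ioi μ) rfl
    intro x hx
    obtain ⟨y, hy, hxy⟩ := hR μ x (hle hx)
    rw [← sub_add_cancel x y]
    exact R.add_mem (hsub hxy) hy

theorem largestSub_univ (hq : 1 < ‖(q : ℂ)‖) (M : DiffMod B.Carrier (B.shift q)) :
    M.largestSub ρ Set.univ = ⊤ :=
  top_le_iff.1 (le_largestSub (fun _ => Iff.rfl) (slopesIn_univ hq ρ _))

theorem filtGE_le_filtGT (ρ : RootSystem q) (M : DiffMod B.Carrier (B.shift q)) {μ ν : ℚ}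
    (h : μ < ν) : M.filtGE ρ ν ≤ M.filtGT ρ μ :=
  M.largestSub_mono ρ fun _ hx => lt_of_lt_of_le h hx

/-- As a vector space, `gr(M)` is isomorphic to `M`. -/
theorem finrank_gr (hq : 1 < ‖(q : ℂ)‖) (ρ : RootSystem q) (M : DiffMod B.Carrier (B.shift q)) :
    Module.finrank B.Carrier ((gr B ρ).obj M) = Module.finrank B.Carrier M := by
  classical
  let p : ∀ μ, M.filtGE ρ μ →ₗ[B.Carrier] M.slopePart ρ μ := fun μ =>
    ((M.filtGT ρ μ).comap (M.filtGE ρ μ).subtype).mkQ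
  have hp : ∀ μ x, p μ x = 0 ↔ (x : M) ∈ M.filtGT ρ μ := fun μ x =>
    Submodule.Quotient.mk_eq_zero _
  have hex : ∀ μ, ∃ s : M.slopePart ρ μ →ₗ[B.Carrier] M.filtGE ρ μ, p μ ∘ₗ s = LinearMap.id :=
    fun μ => LinearMap.exists_rightInverse_of_surjective _
      (LinearMap.range_eq_top.2 (Submodule.mkQ_surjective _))
  choose s hs using hex
  have hs : ∀ μ x, p μ (s μ x) = x := fun μ => LinearMap.congr_fun (hs μ)
  -- The sections `s μ` are only `K`-linear and need not commute with `Φ`, so `S` compares vector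
  -- spaces, not difference modules.
  let S : (⨁ μ, M.slopePart ρ μ) →ₗ[B.Carrier] M :=
    DirectSum.toModule B.Carrier ℚ M fun μ => (M.filtGE ρ μ).subtype ∘ₗ s μ
  have hS : ∀ μ x, S (DirectSum.lof B.Carrier ℚ (fun μ => M.slopePart ρ μ) μ x) = s μ x :=
    fun μ x => DirectSum.toModule_lof _ _ _
  have hinj : Function.Injective S := by
    refine (injective_iff_map_eq_zero S).2 fun x hx => ?_
    by_contra hx0
    have hne : (DFinsupp.support x).Nonempty := by
      rw [Finset.nonempty_iff_ne_empty]
      exact fun h => hx0 (DFinsupp.support_eq_empty.1 h)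
    -- In the lowest degree `μ` of `x` the term `s μ (x μ)` is minus a sum of terms in `F^{> μ}(M)`,
    -- which forces `x μ = 0`.
    set μ := (DFinsupp.support x).min' hne with hμ
    have hmem := (DFinsupp.support x).min'_mem hne
    have hsum : S x = ∑ ν ∈ DFinsupp.support x, (s ν (x ν) : M) := by
      conv_lhs => rw [← DirectSum.sum_support_of x]
      rw [map_sum]
      exact Finset.sum_congr rfl fun ν _ => hS ν (x ν)
    rw [hx, ← Finset.add_sum_erase _ _ hmem] at hsum
    have h1 : (s μ (x μ) : M) ∈ M.filtGT ρ μ := by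
      rw [eq_neg_of_add_eq_zero_left hsum.symm]
      refine neg_mem (sum_mem fun ν hν => ?_)
      have hν := Finset.mem_erase.1 hν
      exact M.filtGE_le_filtGT ρ (lt_of_le_of_ne ((DFinsupp.support x).min'_le ν hν.2) hν.1.symm)
        (s ν (x ν)).2
    rw [← hp, hs] at h1
    exact (DFinsupp.mem_support_iff.1 hmem) h1
  have hsurj : Function.Surjective S := by
    rw [← LinearMap.range_eq_top, ← top_le_iff, ← largestSub_univ (ρ := ρ) hq M]
    refine largestSub_le_of_slopeParts hq (fun μ x hx => ?_) _ _ isUpperSet_univ rfl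
    refine ⟨s μ (p μ ⟨x, hx⟩), ⟨_, hS μ _⟩, ?_⟩
    exact (hp μ (⟨x, hx⟩ - s μ (p μ ⟨x, hx⟩))).1 (by rw [map_sub, hs, sub_self])
  exact (LinearEquiv.ofBijective S ⟨hinj, hsurj⟩).finrank_eq

end Splitting

/-! ### Faithfulness. -/

section Faithful

/-- Two morphisms with the same image, from modules without common slopes, vanish. -/
theorem SlopesIn.eq_zero_of_range_le {M' C : DiffMod B.Carrier (B.shift q)} (hM : SlopesIn ρ M I)
    (hM' : SlopesIn ρ M' J) (hIJ : I ∩ J = ∅) (f : M ⟶ C) (g : M' ⟶ C)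
    (h : LinearMap.range f.toLin ≤ LinearMap.range g.toLin) : f.toLin = 0 := by
  have h1 := (hM.range f).hom_eq_zero (hM'.range g) hIJ
    ⟨Submodule.inclusion h, fun _ => rfl⟩
  ext x
  exact congrArg Subtype.val (LinearMap.congr_fun h1 ⟨f.toLin x, x, rfl⟩)

/-- Let `μ` be the smallest slope of `f(M)`. Modulo `f(F^{≥ μ}(M))` the image has slopes `≥ μ`, but
it is also covered by `M / F^{≥ μ}(M)`, whose slopes are `< μ`. Hence `f(M)` lies in `F^{> μ}(N)`,
against the choice of `μ`. -/
theorem eq_zero_of_map_filtGE_le (hq : 1 < ‖(q : ℂ)‖) (f : M ⟶ N)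
    (h : ∀ μ, ∀ x ∈ M.filtGE ρ μ, f.toLin x ∈ N.filtGT ρ μ) : f.toLin = 0 := by
  by_contra hne
  have hst := isStable_range f
  have hnt : Nontrivial (N.sub _ hst) :=
    Submodule.nontrivial_iff_ne_bot.2 fun h => hne (LinearMap.range_eq_bot.1 h)
  obtain ⟨μ, h1, h2⟩ := exists_min_slope hq ρ (N.sub _ hst)
  have hP : N.IsStable ((M.filtGE ρ μ).map f.toLin) := (M.largestSub_stable ρ _).map f
  let g : M.quot (M.filtGE ρ μ) (M.largestSub_stable ρ _) ⟶ N.quot _ hP :=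
    ⟨Submodule.mapQ _ _ f.toLin (Submodule.le_comap_map _ _), fun x => by
      obtain ⟨x, rfl⟩ := Submodule.mkQ_surjective _ x
      exact congrArg (Submodule.mkQ _) (f.comm x)⟩
  have h3 := h1.eq_zero_of_range_le (slopesIn_quot_largestSub hq M (isUpperSet_Ici μ))
    (Set.inter_compl_self _) (N.subι _ hst ≫ N.quotπ _ hP) g (by
      rintro _ ⟨⟨_, x, rfl⟩, rfl⟩
      exact ⟨Submodule.Quotient.mk x, rfl⟩)
  have hle : LinearMap.range f.toLin ≤ N.filtGT ρ μ := by
    rintro _ ⟨x, rfl⟩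
    have h4 : f.toLin x ∈ (M.filtGE ρ μ).map f.toLin := (Submodule.Quotient.mk_eq_zero _).1
      (LinearMap.congr_fun h3 (⟨f.toLin x, x, rfl⟩ : LinearMap.range f.toLin))
    obtain ⟨y, hy, hxy⟩ := h4
    exact hxy ▸ h μ y hy
  exact h2 (SlopesIn.sub_of_le hst (N.largestSub_stable ρ _) hle
    (slopesIn_largestSub hq N (isUpperSet_Ioi μ)))

theorem lof_injective (X : ℚ → DiffMod B.Carrier (B.shift q)) (μ : ℚ) :
    Function.Injective (DirectSum.lof B.Carrier ℚ (fun μ => X μ) μ) :=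
  DirectSum.of_injective (β := fun μ => X μ) μ

theorem grMk_eq_zero_iff (μ : ℚ) (x : M.filtGE ρ μ) :
    M.grMk ρ μ x = 0 ↔ (x : M) ∈ M.filtGT ρ μ :=
  (map_eq_zero_iff _ (lof_injective _ μ)).trans (Submodule.Quotient.mk_eq_zero _)

theorem gr_map_grMk (f : M ⟶ N) (μ : ℚ) (x : M.filtGE ρ μ) :
    ((gr B ρ).map f).toLin (M.grMk ρ μ x) =
      N.grMk ρ μ ⟨f.toLin x, map_largestSub ρ f (Set.Ici μ) x.2⟩ :=
  DirectSum.lmap_lof _ _ _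

theorem gr_faithful (hq : 1 < ‖(q : ℂ)‖) (ρ : RootSystem q) : (gr B ρ).Faithful where
  map_injective {M N} f g h := by
    let d : M ⟶ N := ⟨f.toLin - g.toLin, fun x => by
      rw [LinearMap.sub_apply, LinearMap.sub_apply, f.comm, g.comm, map_sub]⟩
    have hd : d.toLin = 0 := eq_zero_of_map_filtGE_le (ρ := ρ) hq d fun μ x hx => by
      have h1 := LinearMap.congr_fun (congrArg Hom.toLin h) (M.grMk ρ μ ⟨x, hx⟩)
      rw [gr_map_grMk, gr_map_grMk, ← sub_eq_zero, ← map_sub, grMk_eq_zero_iff] at h1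
      exact h1
    exact hom_ext (sub_eq_zero.1 hd)

end Faithful

/-! ### Purity of the graded pieces. -/

section Graded

theorem isPure_of_slopesIn [Nontrivial M] {μ : ℚ} (h : SlopesIn ρ M {μ}) : IsPure ρ M μ := by
  obtain ⟨t, ht, hμ⟩ := h
  refine ⟨t, ht, ?_, hμ⟩
  rintro rfl
  have h : SlopesIn ρ M ∅ := ⟨0, ht, by simp⟩
  exact not_subsingleton M h.subsingleton

/-- The inclusion `M^{(μ)} → gr(M)`. -/
def slopePartToGr (ρ : RootSystem q) (M : DiffMod B.Carrier (B.shift q)) (μ : ℚ) :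
    M.slopePart ρ μ ⟶ (gr B ρ).obj M :=
  ⟨DirectSum.lof B.Carrier ℚ (fun μ => M.slopePart ρ μ) μ, fun x =>
    (DFinsupp.mapRange_single (f := fun μ => (M.slopePart ρ μ).Φ)
      (hf := fun _ => map_zero _) (i := μ) (b := x)).symm⟩

theorem iSupIndep_range_slopePartToGr (ρ : RootSystem q) (M : DiffMod B.Carrier (B.shift q)) :
    iSupIndep fun μ => LinearMap.range (slopePartToGr ρ M μ).toLin := by
  refine iSupIndep_def.2 fun μ => Submodule.disjoint_def.2 ?_
  rintro _ ⟨x, rfl⟩ hx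
  let c : (⨁ μ, M.slopePart ρ μ) →ₗ[B.Carrier] M.slopePart ρ μ := DirectSum.component _ _ _ μ
  have hle : ⨆ ν ≠ μ, LinearMap.range (slopePartToGr ρ M ν).toLin ≤ LinearMap.ker c := by
    refine iSup₂_le fun ν hν => ?_
    rintro _ ⟨y, rfl⟩
    exact DFinsupp.single_eq_of_ne hν.symm
  have h0 : x = 0 := (DirectSum.component.lof_self (M := fun μ => M.slopePart ρ μ)
    B.Carrier μ x).symm.trans (hle hx)
  rw [h0, map_zero]

theorem iSup_range_slopePartToGr (ρ : RootSystem q) (M : DiffMod B.Carrier (B.shift q)) :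
    ⨆ μ, LinearMap.range (slopePartToGr ρ M μ).toLin = ⊤ := by
  refine eq_top_iff.2 fun (x : ⨁ μ, M.slopePart ρ μ) _ => ?_
  induction x using DirectSum.induction_on with
  | zero => exact zero_mem _
  | of _ x => exact Submodule.mem_iSup_of_mem _ ⟨x, rfl⟩
  | add x y hx hy => exact add_mem (hx trivial) (hy trivial)

/-- A pure module is nonzero, so only the nonzero slope parts are kept; being independent, they are
finite in number. -/
theorem isModeratelyIrregular_gr (hq : 1 < ‖(q : ℂ)‖) (ρ : RootSystem q)
    (M : DiffMod B.Carrier (B.shift q)) : IsModeratelyIrregular ρ ((gr B ρ).obj M) := by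
  classical
  have hind := iSupIndep_range_slopePartToGr ρ M
  have hS := WellFoundedGT.finite_ne_bot_of_iSupIndep hind
  let e : Fin hS.toFinset.card ≃ hS.toFinset := hS.toFinset.equivFin.symm
  refine ⟨_, fun i => LinearMap.range (slopePartToGr ρ M (e i)).toLin,
    fun i => isStable_range _, ?_, fun i => ⟨e i, ?_⟩⟩
  · refine (DirectSum.isInternal_submodule_iff_iSupIndep_and_iSup_eq_top _).2
      ⟨hind.comp (Subtype.val_injective.comp e.injective), ?_⟩
    refine top_le_iff.1 ((iSup_range_slopePartToGr ρ M).ge.trans (iSup_le fun μ => ?_))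
    by_cases hμ : LinearMap.range (slopePartToGr ρ M μ).toLin = ⊥
    · rw [hμ]
      exact bot_le
    · obtain ⟨i, hi⟩ := e.surjective ⟨μ, hS.mem_toFinset.2 hμ⟩
      refine le_iSup_of_le i ?_
      rw [hi]
  · have : Nontrivial (((gr B ρ).obj M).sub _ (isStable_range (slopePartToGr ρ M (e i)))) :=
      Submodule.nontrivial_iff_ne_bot.2 (hS.mem_toFinset.1 (e i).2)
    exact isPure_of_slopesIn ((slopesIn_slopePart hq M _).range _)

end Graded

end DiffMod

/-! ### Generators of the graded module and comparison with tensor products. -/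

namespace DiffMod

variable {B : BaseField} {q : ℂˣ} {ρ : RootSystem q}
  {M N M₁ M₂ M₃ : DiffMod B.Carrier (B.shift q)}

section Generators

variable {V : Type} [AddCommGroup V] [Module B.Carrier V]

/-- Degrees such as `(μ₁ + μ₂) + μ₃` and `μ₁ + (μ₂ + μ₃)` index different types of representatives;
this compares their classes inside `gr(M)`. -/
theorem grMk_congr {μ ν : ℚ} (h : μ = ν) {x : M.filtGE ρ μ} {y : M.filtGE ρ ν}
    (hxy : (x : M) = y) : M.grMk ρ μ x = M.grMk ρ ν y := by
  subst h
  rw [Subtype.ext hxy]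

theorem gr_hom_ext {f g : (gr B ρ).obj M →ₗ[B.Carrier] V}
    (h : ∀ μ x, f (M.grMk ρ μ x) = g (M.grMk ρ μ x)) : f = g :=
  DirectSum.linearMap_ext (M := fun μ => M.slopePart ρ μ) B.Carrier fun μ =>
    Submodule.linearMap_qext _ (LinearMap.ext (h μ))

theorem gr_tensor_ext {f g : (gr B ρ).obj M₁ ⊗[B.Carrier] (gr B ρ).obj M₂ →ₗ[B.Carrier] V}
    (h : ∀ μ x ν y, f (M₁.grMk ρ μ x ⊗ₜ M₂.grMk ρ ν y) = g (M₁.grMk ρ μ x ⊗ₜ M₂.grMk ρ ν y)) :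
    f = g :=
  TensorProduct.ext (gr_hom_ext fun μ x => gr_hom_ext fun ν y => h μ x ν y)

theorem gr_tensor_ext_threefold
    {f g : ((gr B ρ).obj M₁ ⊗[B.Carrier] (gr B ρ).obj M₂) ⊗[B.Carrier] (gr B ρ).obj M₃
      →ₗ[B.Carrier] V}
    (h : ∀ μ₁ x₁ μ₂ x₂ μ₃ x₃,
      f ((M₁.grMk ρ μ₁ x₁ ⊗ₜ M₂.grMk ρ μ₂ x₂) ⊗ₜ M₃.grMk ρ μ₃ x₃) =
        g ((M₁.grMk ρ μ₁ x₁ ⊗ₜ M₂.grMk ρ μ₂ x₂) ⊗ₜ M₃.grMk ρ μ₃ x₃)) :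
    f = g :=
  TensorProduct.ext (gr_tensor_ext fun μ₁ x₁ μ₂ x₂ => gr_hom_ext fun μ₃ x₃ => h μ₁ x₁ μ₂ x₂ μ₃ x₃)

theorem gr_induction {p : (gr B ρ).obj M → Prop} (x : (gr B ρ).obj M)
    (grMk : ∀ μ x, p (M.grMk ρ μ x)) (add : ∀ x y, p x → p y → p (x + y)) : p x := by
  have h : ∀ x : ⨁ μ, M.slopePart ρ μ, p x := fun x => by
    induction x using DirectSum.induction_on with
    | zero => exact (map_zero (M.grMk ρ 0)) ▸ grMk 0 0
    | of μ x =>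
      obtain ⟨x, rfl⟩ := Submodule.mkQ_surjective _ x
      exact grMk μ x
    | add x y hx hy => exact add x y hx hy
  exact h x

theorem gr_Φ_grMk (μ : ℚ) (x : M.filtGE ρ μ) :
    ((gr B ρ).obj M).Φ (M.grMk ρ μ x) = M.grMk ρ μ ⟨M.Φ x, (M.largestSub_stable ρ _ x.1).2 x.2⟩ :=
  ((slopePartToGr ρ M μ).comm (Submodule.Quotient.mk x)).symm

/-- Linear maps on the steps of the filtration which vanish on the next steps define a linear map
on `gr(M)`. -/
def grLift (f : ∀ μ, M.filtGE ρ μ →ₗ[B.Carrier] V)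
    (hf : ∀ μ (x : M.filtGE ρ μ), (x : M) ∈ M.filtGT ρ μ → f μ x = 0) : (gr B ρ).obj M →ₗ[B.Carrier] V :=
  DirectSum.toModule B.Carrier ℚ V fun μ => Submodule.liftQ _ (f μ) (hf μ)

theorem grLift_grMk (f : ∀ μ, M.filtGE ρ μ →ₗ[B.Carrier] V)
    (hf : ∀ μ (x : M.filtGE ρ μ), (x : M) ∈ M.filtGT ρ μ → f μ x = 0) (μ : ℚ) (x : M.filtGE ρ μ) :
    grLift f hf (M.grMk ρ μ x) = f μ x :=
  DirectSum.toModule_lof (M := fun μ => M.slopePart ρ μ) B.Carrier μ (Submodule.Quotient.mk x)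

end Generators

section Tensor

/-- Slopes add, so the image of the tensor product of the two submodules has slopes in `L`. With an
open half-line for `I` or `J` it also shows that the class of `x ⊗ y` depends only on the classes of
`x` and `y`. -/
theorem tmul_mem_largestSub (hq : 1 < ‖(q : ℂ)‖) {I J L : Set ℚ} (hI : IsUpperSet I)
    (hJ : IsUpperSet J) (hL : ∀ μ ∈ I, ∀ ν ∈ J, μ + ν ∈ L) {x : M₁} {y : M₂}
    (hx : x ∈ M₁.largestSub ρ I) (hy : y ∈ M₂.largestSub ρ J) :
    (x ⊗ₜ[B.Carrier] y : M₁.tensor M₂) ∈ (M₁.tensor M₂).largestSub ρ L :=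
  ((slopesIn_largestSub hq M₁ hI).tensor (slopesIn_largestSub hq M₂ hJ) hL).range_le
    (tensorMap (M₁.subι _ _) (M₂.subι _ _))
    ⟨(⟨x, hx⟩ : M₁.largestSub ρ I) ⊗ₜ (⟨y, hy⟩ : M₂.largestSub ρ J), rfl⟩

theorem tmul_mem_filtGE (hq : 1 < ‖(q : ℂ)‖) {μ ν : ℚ} (x : M₁.filtGE ρ μ) (y : M₂.filtGE ρ ν) :
    ((x : M₁) ⊗ₜ[B.Carrier] (y : M₂) : M₁.tensor M₂) ∈ (M₁.tensor M₂).filtGE ρ (μ + ν) :=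
  tmul_mem_largestSub hq (isUpperSet_Ici _) (isUpperSet_Ici _)
    (fun _ h _ h' => add_le_add (Set.mem_Ici.1 h) h') x.2 y.2

/-- The map `gr(M₂) → gr(M₁ ⊗ M₂)` given by the tensor product with an element of
`F^{≥ μ}(M₁)`. -/
def grTensorLeft (hq : 1 < ‖(q : ℂ)‖) (M₂ : DiffMod B.Carrier (B.shift q)) {μ : ℚ}
    (x : M₁.filtGE ρ μ) : (gr B ρ).obj M₂ →ₗ[B.Carrier] (gr B ρ).obj (M₁.tensor M₂) :=
  grLift (fun ν => (M₁.tensor M₂).grMk ρ (μ + ν) ∘ₗ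
      LinearMap.codRestrict _ (TensorProduct.mk B.Carrier M₁ M₂ x ∘ₗ (M₂.filtGE ρ ν).subtype)
        (tmul_mem_filtGE hq x))
    fun ν _ hy => (grMk_eq_zero_iff _ _).2 (tmul_mem_largestSub hq (isUpperSet_Ici μ)
      (isUpperSet_Ioi ν) (fun _ h _ h' => add_lt_add_of_le_of_lt (Set.mem_Ici.1 h) h') x.2 hy)

theorem grTensorLeft_grMk (hq : 1 < ‖(q : ℂ)‖) {μ ν : ℚ} (x : M₁.filtGE ρ μ) (y : M₂.filtGE ρ ν) :
    grTensorLeft hq M₂ x (M₂.grMk ρ ν y) =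
      (M₁.tensor M₂).grMk ρ (μ + ν) ⟨_, tmul_mem_filtGE hq x y⟩ :=
  grLift_grMk _ _ ν y

theorem grTensorLeft_smul (hq : 1 < ‖(q : ℂ)‖) {μ : ℚ} (c : B.Carrier) (x : M₁.filtGE ρ μ) :
    grTensorLeft hq M₂ (c • x) = c • grTensorLeft hq M₂ x := by
  refine gr_hom_ext fun ν y => ?_
  rw [LinearMap.smul_apply, grTensorLeft_grMk, grTensorLeft_grMk]
  have h : (⟨_, tmul_mem_filtGE hq (c • x) y⟩ : (M₁.tensor M₂).filtGE ρ (μ + ν)) =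
      c • ⟨_, tmul_mem_filtGE hq x y⟩ :=
    Subtype.ext (TensorProduct.smul_tmul' c (x : M₁) (y : M₂)).symm
  rw [h, LinearMap.map_smul]

/-- The bilinear map `gr(M₁) × gr(M₂) → gr(M₁ ⊗ M₂)`. -/
def grTensor₂ (hq : 1 < ‖(q : ℂ)‖) (ρ : RootSystem q) (M₁ M₂ : DiffMod B.Carrier (B.shift q)) :
    (gr B ρ).obj M₁ →ₗ[B.Carrier] (gr B ρ).obj M₂ →ₗ[B.Carrier] (gr B ρ).obj (M₁.tensor M₂) :=
  grLift (V := (gr B ρ).obj M₂ →ₗ[B.Carrier] (gr B ρ).obj (M₁.tensor M₂)) (fun μ =>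
    { toFun := grTensorLeft hq M₂
      map_add' := fun x x' => gr_hom_ext fun ν y => by
        rw [LinearMap.add_apply, grTensorLeft_grMk, grTensorLeft_grMk, grTensorLeft_grMk, ← map_add]
        exact grMk_congr rfl (TensorProduct.add_tmul _ _ _)
      map_smul' := grTensorLeft_smul hq })
    fun μ x hx => gr_hom_ext fun ν y => (grTensorLeft_grMk hq x y).trans <|
      (grMk_eq_zero_iff _ _).2 (tmul_mem_largestSub hq (isUpperSet_Ioi μ) (isUpperSet_Ici ν)
        (fun _ h _ h' => add_lt_add_of_lt_of_le (Set.mem_Ioi.1 h) h') hx y.2)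

theorem grTensor₂_grMk (hq : 1 < ‖(q : ℂ)‖) {μ : ℚ} (x : M₁.filtGE ρ μ) :
    grTensor₂ hq ρ M₁ M₂ (M₁.grMk ρ μ x) = grTensorLeft hq M₂ x :=
  grLift_grMk _ _ μ x

/-- The linear map `gr(M₁) ⊗ gr(M₂) → gr(M₁ ⊗ M₂)`. -/
def grTensor (hq : 1 < ‖(q : ℂ)‖) (ρ : RootSystem q) (M₁ M₂ : DiffMod B.Carrier (B.shift q)) :
    (gr B ρ).obj M₁ ⊗[B.Carrier] (gr B ρ).obj M₂ →ₗ[B.Carrier] (gr B ρ).obj (M₁.tensor M₂) :=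
  TensorProduct.lift (grTensor₂ hq ρ M₁ M₂)

theorem grTensor_tmul (hq : 1 < ‖(q : ℂ)‖) {μ ν : ℚ} (x : M₁.filtGE ρ μ) (y : M₂.filtGE ρ ν) :
    grTensor hq ρ M₁ M₂ (M₁.grMk ρ μ x ⊗ₜ M₂.grMk ρ ν y) =
      (M₁.tensor M₂).grMk ρ (μ + ν) ⟨_, tmul_mem_filtGE hq x y⟩ := by
  rw [grTensor, TensorProduct.lift.tmul, grTensor₂_grMk, grTensorLeft_grMk]

/-- The projection `gr(M) → M^{(ν)}`, followed by the inclusion in `M / F^{> ν}(M)`. -/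
def grProj (ρ : RootSystem q) (M : DiffMod B.Carrier (B.shift q)) (ν : ℚ) :
    (gr B ρ).obj M →ₗ[B.Carrier] M ⧸ M.filtGT ρ ν :=
  (slopePartι ρ M ν).toLin ∘ₗ
    DirectSum.component B.Carrier ℚ (fun μ => M.slopePart ρ μ) ν

theorem grProj_grMk_self (ν : ℚ) (x : M.filtGE ρ ν) :
    grProj ρ M ν (M.grMk ρ ν x) = (M.filtGT ρ ν).mkQ x :=
  congrArg (slopePartι ρ M ν).toLin
    (DirectSum.component.lof_self (M := fun μ => M.slopePart ρ μ) B.Carrier ν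
      (Submodule.Quotient.mk x))

theorem grProj_grMk_of_ne {μ ν : ℚ} (h : μ ≠ ν) (x : M.filtGE ρ μ) :
    grProj ρ M ν (M.grMk ρ μ x) = 0 :=
  (congrArg (slopePartι ρ M ν).toLin
    (DFinsupp.single_eq_of_ne (β := fun μ => M.slopePart ρ μ) h.symm)).trans (map_zero _)

/-- Tensor products commute with direct sums, so the components in `M₁^{(μ)} ⊗ M₂^{(ν)}` determine
`z`. Nothing is lost on embedding these parts in the quotients by `F^{>}`, as injections stay
injective under tensor products over a field. -/
theorem eq_zero_of_map_grProj (z : (gr B ρ).obj M₁ ⊗[B.Carrier] (gr B ρ).obj M₂)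
    (hz : ∀ μ ν, TensorProduct.map (grProj ρ M₁ μ) (grProj ρ M₂ ν) z = 0) : z = 0 := by
  let e := TensorProduct.directSum B.Carrier B.Carrier (fun μ => M₁.slopePart ρ μ)
    (fun μ => M₂.slopePart ρ μ)
  have key : ∀ p : ℚ × ℚ, TensorProduct.map
      (DirectSum.component B.Carrier ℚ (fun μ => M₁.slopePart ρ μ) p.1)
      (DirectSum.component B.Carrier ℚ (fun μ => M₂.slopePart ρ μ) p.2) =
        DirectSum.component B.Carrier (ℚ × ℚ)
          (fun p => M₁.slopePart ρ p.1 ⊗[B.Carrier] M₂.slopePart ρ p.2) p ∘ₗ e.toLinearMap := by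
    intro p
    refine TensorProduct.ext (DirectSum.linearMap_ext _ fun μ => LinearMap.ext fun x =>
      DirectSum.linearMap_ext _ fun ν => LinearMap.ext fun y => ?_)
    refine Eq.trans ?_ (congrArg (DirectSum.component B.Carrier (ℚ × ℚ)
      (fun p => M₁.slopePart ρ p.1 ⊗[B.Carrier] M₂.slopePart ρ p.2) p)
      (TensorProduct.directSum_lof_tmul_lof (R := B.Carrier) (S := B.Carrier)
        (M₁ := fun μ => M₁.slopePart ρ μ) (M₂ := fun μ => M₂.slopePart ρ μ) μ x ν y)).symm
    show DirectSum.component B.Carrier ℚ (fun μ => M₁.slopePart ρ μ) p.1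
      (DirectSum.lof B.Carrier ℚ (fun μ => M₁.slopePart ρ μ) μ x) ⊗ₜ[B.Carrier]
      DirectSum.component B.Carrier ℚ (fun μ => M₂.slopePart ρ μ) p.2
      (DirectSum.lof B.Carrier ℚ (fun μ => M₂.slopePart ρ μ) ν y) = _
    by_cases h1 : μ = p.1
    · by_cases h2 : ν = p.2
      · subst h1 h2
        rw [DirectSum.component.lof_self, DirectSum.component.lof_self]
        exact (DirectSum.component.lof_self
          (M := fun p : ℚ × ℚ => M₁.slopePart ρ p.1 ⊗[B.Carrier] M₂.slopePart ρ p.2)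
          B.Carrier p (x ⊗ₜ y)).symm
      · refine (congrArg _ (DFinsupp.single_eq_of_ne (β := fun μ => M₂.slopePart ρ μ)
          (Ne.symm h2))).trans ((TensorProduct.tmul_zero _ _).trans ?_)
        exact (DFinsupp.single_eq_of_ne
          (β := fun p : ℚ × ℚ => M₁.slopePart ρ p.1 ⊗[B.Carrier] M₂.slopePart ρ p.2)
          fun h : p = (μ, ν) => h2 (congrArg Prod.snd h).symm).symm
    · refine (congrArg (· ⊗ₜ[B.Carrier] _) (DFinsupp.single_eq_of_ne
        (β := fun μ => M₁.slopePart ρ μ) (Ne.symm h1))).trans ((TensorProduct.zero_tmul _ _).trans ?_)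
      exact (DFinsupp.single_eq_of_ne
          (β := fun p : ℚ × ℚ => M₁.slopePart ρ p.1 ⊗[B.Carrier] M₂.slopePart ρ p.2)
          fun h : p = (μ, ν) => h1 (congrArg Prod.fst h).symm).symm
  refine e.map_eq_zero_iff.1 (DFinsupp.ext fun p => ?_)
  have hinj : Function.Injective
      (TensorProduct.map (slopePartι ρ M₁ p.1).toLin (slopePartι ρ M₂ p.2).toLin) :=
    TensorProduct.map_injective_of_flat_flat _ _ (slopePartι_injective _ _ _)
      (slopePartι_injective _ _ _)
  refine (map_eq_zero_iff _ hinj).1 (Eq.trans ?_ (hz p.1 p.2))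
  refine Eq.trans ?_ (LinearMap.congr_fun (TensorProduct.map_comp _ _ _ _) z).symm
  exact congrArg _ (LinearMap.congr_fun (key p) z).symm

/-- The map is the composition of the projection of `gr(M₁ ⊗ M₂)` in degree `μ + ν` with the
quotient map. -/
theorem exists_comp_grTensor (hq : 1 < ‖(q : ℂ)‖) (ρ : RootSystem q)
    (M₁ M₂ : DiffMod B.Carrier (B.shift q)) (μ ν : ℚ) :
    ∃ f : (gr B ρ).obj (M₁.tensor M₂) →ₗ[B.Carrier]
        (M₁ ⧸ M₁.filtGT ρ μ) ⊗[B.Carrier] (M₂ ⧸ M₂.filtGT ρ ν),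
      f ∘ₗ grTensor hq ρ M₁ M₂ = TensorProduct.map (grProj ρ M₁ μ) (grProj ρ M₂ ν) := by
  let g : M₁.tensor M₂ →ₗ[B.Carrier]
      (M₁ ⧸ M₁.filtGT ρ μ) ⊗[B.Carrier] (M₂ ⧸ M₂.filtGT ρ ν) :=
    TensorProduct.map (M₁.filtGT ρ μ).mkQ (M₂.filtGT ρ ν).mkQ
  -- The target of `g` has slopes `≤ μ + ν`, so a submodule with slopes `> μ + ν` maps to zero.
  have hker : (M₁.tensor M₂).filtGT ρ (μ + ν) ≤ LinearMap.ker g := by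
    have h := (slopesIn_quot_largestSub hq M₁ (isUpperSet_Ioi μ)).tensor
      (slopesIn_quot_largestSub (ρ := ρ) hq M₂ (isUpperSet_Ioi ν)) (L := (Set.Ioi (μ + ν))ᶜ)
      fun _ h _ h' => not_lt.2 (add_le_add (not_lt.1 (Set.mem_Ioi.not.1 h))
        (not_lt.1 (Set.mem_Ioi.not.1 h')))
    have h0 := (slopesIn_largestSub hq (M₁.tensor M₂) (isUpperSet_Ioi (μ + ν))).hom_eq_zero h
      (Set.inter_compl_self _)
      ((M₁.tensor M₂).subι _ _ ≫ tensorMap (M₁.quotπ _ _) (M₂.quotπ _ _))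
    exact fun t ht => LinearMap.congr_fun h0 (⟨t, ht⟩ : (M₁.tensor M₂).filtGT ρ (μ + ν))
  refine ⟨Submodule.liftQ _ g hker ∘ₗ grProj ρ (M₁.tensor M₂) (μ + ν),
    gr_tensor_ext fun μ' x ν' y => ?_⟩
  rw [LinearMap.comp_apply, grTensor_tmul, TensorProduct.map_tmul, LinearMap.comp_apply]
  by_cases hs : μ' + ν' = μ + ν
  · have hmem := tmul_mem_filtGE hq x y
    rw [hs] at hmem
    rw [grMk_congr (M := M₁.tensor M₂) hs (y := ⟨_, hmem⟩) rfl]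
    refine (congrArg (Submodule.liftQ _ g hker) (grProj_grMk_self _ _)).trans ?_
    refine (TensorProduct.map_tmul _ _ _ _).trans ?_
    -- Other bidegrees of the same total degree contribute nothing: one of `μ' > μ`, `ν' > ν` holds,
    -- and that factor dies in its quotient.
    rcases lt_trichotomy μ' μ with h | h | h
    · have hν : ν < ν' := by linarith
      have h0 : (M₂.filtGT ρ ν).mkQ y = 0 :=
        (Submodule.Quotient.mk_eq_zero _).2 (M₂.filtGE_le_filtGT ρ hν y.2)
      rw [grProj_grMk_of_ne hν.ne', h0, tmul_zero, tmul_zero]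
    · obtain rfl := h
      obtain rfl := add_left_cancel hs
      rw [grProj_grMk_self, grProj_grMk_self]
    · have h0 : (M₁.filtGT ρ μ).mkQ x = 0 :=
        (Submodule.Quotient.mk_eq_zero _).2 (M₁.filtGE_le_filtGT ρ h x.2)
      rw [grProj_grMk_of_ne h.ne', h0, zero_tmul, zero_tmul]
  · rw [grProj_grMk_of_ne hs, map_zero]
    by_cases h : μ' = μ
    · have h' : ν' ≠ ν := fun h' => hs (by rw [h, h'])
      rw [grProj_grMk_of_ne h' y, tmul_zero]
    · rw [grProj_grMk_of_ne h, zero_tmul]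

theorem grTensor_injective (hq : 1 < ‖(q : ℂ)‖) (ρ : RootSystem q)
    (M₁ M₂ : DiffMod B.Carrier (B.shift q)) : Function.Injective (grTensor hq ρ M₁ M₂) := by
  refine (injective_iff_map_eq_zero _).2 fun z hz => eq_zero_of_map_grProj z fun μ ν => ?_
  obtain ⟨f, hf⟩ := exists_comp_grTensor hq ρ M₁ M₂ μ ν
  rw [← hf, LinearMap.comp_apply, hz, map_zero]

/-- Injectivity suffices, since both sides have dimension `dim M₁ · dim M₂` by `finrank_gr`. -/
theorem grTensor_bijective (hq : 1 < ‖(q : ℂ)‖) (ρ : RootSystem q)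
    (M₁ M₂ : DiffMod B.Carrier (B.shift q)) : Function.Bijective (grTensor hq ρ M₁ M₂) := by
  have h := grTensor_injective hq ρ M₁ M₂
  refine ⟨h, (LinearMap.injective_iff_surjective_of_finrank_eq_finrank ?_).1 h⟩
  rw [Module.finrank_tensorProduct, finrank_gr hq, finrank_gr hq, finrank_gr hq]
  exact (Module.finrank_tensorProduct (R := B.Carrier) (S := B.Carrier)).symm

theorem grTensor_comm (hq : 1 < ‖(q : ℂ)‖) (ρ : RootSystem q)
    (M₁ M₂ : DiffMod B.Carrier (B.shift q)) (z : ((gr B ρ).obj M₁).tensor ((gr B ρ).obj M₂)) :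
    grTensor hq ρ M₁ M₂ ((((gr B ρ).obj M₁).tensor ((gr B ρ).obj M₂)).Φ z) =
      ((gr B ρ).obj (M₁.tensor M₂)).Φ (grTensor hq ρ M₁ M₂ z) := by
  refine semilinear_ext ((gr B ρ).obj M₁).Φ ((gr B ρ).obj M₂).Φ ((gr B ρ).obj (M₁.tensor M₂)).Φ
    (grTensor hq ρ M₁ M₂) (fun x y => ?_) z
  induction x using gr_induction with
  | add x x' h h' =>
    rw [map_add, TensorProduct.add_tmul, TensorProduct.add_tmul, map_add, map_add, map_add, h, h']
  | grMk μ x =>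
    induction y using gr_induction with
    | add y y' h h' =>
      rw [map_add, TensorProduct.tmul_add, TensorProduct.tmul_add, map_add, map_add, map_add, h, h']
    | grMk ν y =>
      rw [gr_Φ_grMk, gr_Φ_grMk, grTensor_tmul, grTensor_tmul, gr_Φ_grMk]
      exact grMk_congr rfl rfl

end Tensor

end DiffMod

/-! ### The symmetric monoidal structure of `gr`. -/

namespace DiffMod

variable {B : BaseField} {q : ℂˣ} {ρ : RootSystem q}
  {M N M₁ M₂ M₃ : DiffMod B.Carrier (B.shift q)}

section Monoidal

/-- The isomorphism `gr(M₁) ⊗ gr(M₂) ≅ gr(M₁ ⊗ M₂)`. -/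
def grTensorIso (hq : 1 < ‖(q : ℂ)‖) (ρ : RootSystem q) (M₁ M₂ : DiffMod B.Carrier (B.shift q)) :
    (gr B ρ).obj M₁ ⊗ (gr B ρ).obj M₂ ≅ (gr B ρ).obj (M₁ ⊗ M₂) :=
  isoMk (M := ((gr B ρ).obj M₁).tensor ((gr B ρ).obj M₂))
    (LinearEquiv.ofBijective (grTensor hq ρ M₁ M₂) (grTensor_bijective hq ρ M₁ M₂))
    (grTensor_comm hq ρ M₁ M₂)

theorem filtGE_unit (ρ : RootSystem q) (x : (unit : DiffMod B.Carrier (B.shift q))) :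
    x ∈ (unit : DiffMod B.Carrier (B.shift q)).filtGE ρ 0 :=
  (slopesIn_unit.mono (by simp)).range_le (𝟙 unit) ⟨x, rfl⟩

/-- The unit has only the slope `0`, so the inclusion of a submodule with positive slopes is zero.
This makes `grUnit` injective. -/
theorem filtGT_unit (hq : 1 < ‖(q : ℂ)‖) (ρ : RootSystem q) :
    (unit : DiffMod B.Carrier (B.shift q)).filtGT ρ 0 = ⊥ := by
  have h := (slopesIn_largestSub (ρ := ρ) (B := B) hq unit (isUpperSet_Ioi 0)).hom_eq_zero
    (J := {0}) slopesIn_unit (by simp) (unit.subι _ (unit.largestSub_stable ρ (Set.Ioi 0)))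
  exact (Submodule.eq_bot_iff _).2 fun x hx =>
    LinearMap.congr_fun h (⟨x, hx⟩ : (unit : DiffMod B.Carrier (B.shift q)).filtGT ρ 0)

/-- The linear map from the unit to its associated graded module. -/
def grUnit (B : BaseField) (ρ : RootSystem q) :
    (unit : DiffMod B.Carrier (B.shift q)) →ₗ[B.Carrier] (gr B ρ).obj unit :=
  grMk ρ unit 0 ∘ₗ LinearMap.codRestrict _ LinearMap.id (filtGE_unit ρ)

theorem grUnit_bijective (hq : 1 < ‖(q : ℂ)‖) (B : BaseField) (ρ : RootSystem q) :
    Function.Bijective (grUnit B ρ) := by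
  have h : Function.Injective (grUnit B ρ) := by
    refine (injective_iff_map_eq_zero _).2 fun x hx => ?_
    have := (grMk_eq_zero_iff _ _).1 hx
    rwa [filtGT_unit hq] at this
  exact ⟨h, (LinearMap.injective_iff_surjective_of_finrank_eq_finrank
    (finrank_gr hq ρ unit).symm).1 h⟩

/-- The isomorphism of the unit with its associated graded module. -/
def grUnitIso (hq : 1 < ‖(q : ℂ)‖) (B : BaseField) (ρ : RootSystem q) :
    𝟙_ (DiffMod B.Carrier (B.shift q)) ≅ (gr B ρ).obj (𝟙_ _) :=
  isoMk (M := unit) (LinearEquiv.ofBijective (grUnit B ρ) (grUnit_bijective hq B ρ))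
    fun x => (gr_Φ_grMk (M := unit) 0 ⟨x, filtGE_unit ρ x⟩).symm

/-- The monoidal structure of `gr`. -/
def grCoreMonoidal (hq : 1 < ‖(q : ℂ)‖) (B : BaseField) (ρ : RootSystem q) :
    (gr B ρ).CoreMonoidal where
  εIso := grUnitIso hq B ρ
  μIso := grTensorIso hq ρ
  μIso_hom_natural_left {M N} f P := hom_ext <| gr_tensor_ext (M₁ := M) (M₂ := P)
    fun μ x ν y => by
      show grTensor hq ρ N P (((gr B ρ).map f).toLin (M.grMk ρ μ x) ⊗ₜ P.grMk ρ ν y) =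
        ((gr B ρ).map (tensorMap f (𝟙 P))).toLin
          (grTensor hq ρ M P (M.grMk ρ μ x ⊗ₜ P.grMk ρ ν y))
      rw [gr_map_grMk, grTensor_tmul, grTensor_tmul, gr_map_grMk]
      exact grMk_congr rfl rfl
  μIso_hom_natural_right {M N} P f := hom_ext <| gr_tensor_ext (M₁ := P) (M₂ := M)
    fun μ x ν y => by
      show grTensor hq ρ P N (P.grMk ρ μ x ⊗ₜ ((gr B ρ).map f).toLin (M.grMk ρ ν y)) =
        ((gr B ρ).map (tensorMap (𝟙 P) f)).toLin
          (grTensor hq ρ P M (P.grMk ρ μ x ⊗ₜ M.grMk ρ ν y))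
      rw [gr_map_grMk, grTensor_tmul, grTensor_tmul, gr_map_grMk]
      exact grMk_congr rfl rfl
  associativity M₁ M₂ M₃ := hom_ext <| gr_tensor_ext_threefold (M₁ := M₁) (M₂ := M₂) (M₃ := M₃)
    fun μ₁ x₁ μ₂ x₂ μ₃ x₃ => by
      show ((gr B ρ).map (assoc M₁ M₂ M₃).hom).toLin (grTensor hq ρ (M₁.tensor M₂) M₃
          (grTensor hq ρ M₁ M₂ (M₁.grMk ρ μ₁ x₁ ⊗ₜ M₂.grMk ρ μ₂ x₂) ⊗ₜ M₃.grMk ρ μ₃ x₃)) =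
        grTensor hq ρ M₁ (M₂.tensor M₃)
          (M₁.grMk ρ μ₁ x₁ ⊗ₜ grTensor hq ρ M₂ M₃ (M₂.grMk ρ μ₂ x₂ ⊗ₜ M₃.grMk ρ μ₃ x₃))
      rw [grTensor_tmul, grTensor_tmul, grTensor_tmul, grTensor_tmul, gr_map_grMk]
      exact grMk_congr (add_assoc _ _ _) rfl
  left_unitality M := hom_ext <| TensorProduct.ext <| LinearMap.ext fun (c : B.Carrier) =>
    gr_hom_ext fun μ x => by
      show c • M.grMk ρ μ x = ((gr B ρ).map (leftUnit M).hom).toLin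
        (grTensor hq ρ unit M (grMk ρ unit 0 ⟨c, filtGE_unit ρ c⟩ ⊗ₜ M.grMk ρ μ x))
      rw [grTensor_tmul, gr_map_grMk, ← map_smul]
      exact grMk_congr (zero_add _).symm rfl
  right_unitality M := hom_ext <| TensorProduct.ext <| gr_hom_ext fun μ x =>
    LinearMap.ext fun (c : B.Carrier) => by
      show c • M.grMk ρ μ x = ((gr B ρ).map (rightUnit M).hom).toLin
        (grTensor hq ρ M unit (M.grMk ρ μ x ⊗ₜ grMk ρ unit 0 ⟨c, filtGE_unit ρ c⟩))
      rw [grTensor_tmul, gr_map_grMk, ← map_smul]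
      exact grMk_congr (add_zero _).symm rfl

/-- The symmetric monoidal structure of `gr`. -/
abbrev grBraided (hq : 1 < ‖(q : ℂ)‖) (B : BaseField) (ρ : RootSystem q) : (gr B ρ).Braided where
  toMonoidal := (grCoreMonoidal hq B ρ).toMonoidal
  braided M N := hom_ext <| gr_tensor_ext (M₁ := M) (M₂ := N) fun μ x ν y => by
    show ((gr B ρ).map (swap M N).hom).toLin
        (grTensor hq ρ M N (M.grMk ρ μ x ⊗ₜ N.grMk ρ ν y)) =
      grTensor hq ρ N M (N.grMk ρ ν y ⊗ₜ M.grMk ρ μ x)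
    rw [grTensor_tmul, grTensor_tmul, gr_map_grMk]
    exact grMk_congr (add_comm _ _) rfl

end Monoidal

end DiffMod

end QDiff

end

open CategoryTheory TensorProduct QDiff in
theorem mainTheorem8 (B : BaseField) (q : ℂˣ) (hq : 1 < ‖(q : ℂ)‖) (ρ : RootSystem q) :
    (∀ M, DiffMod.IsModeratelyIrregular ρ ((DiffMod.gr B ρ).obj M)) ∧
    (DiffMod.gr B ρ).Faithful ∧
    ∃ _ : (DiffMod.gr B ρ).Braided,
      ∀ (M₁ M₂ : DiffMod B.Carrier (B.shift q)) (μ₁ μ₂ : ℚ)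
        (x : M₁.filtGE ρ μ₁) (y : M₂.filtGE ρ μ₂),
        ∃ h : ((x : M₁) ⊗ₜ[B.Carrier] (y : M₂) : M₁.tensor M₂) ∈
            (M₁.tensor M₂).filtGE ρ (μ₁ + μ₂),
          (Functor.LaxMonoidal.μ (DiffMod.gr B ρ) M₁ M₂).toLin
              (M₁.grMk ρ μ₁ x ⊗ₜ[B.Carrier] M₂.grMk ρ μ₂ y) =
            (M₁.tensor M₂).grMk ρ (μ₁ + μ₂) ⟨_, h⟩ := by
  exact ⟨DiffMod.isModeratelyIrregular_gr hq ρ, DiffMod.gr_faithful hq ρ,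
    DiffMod.grBraided hq B ρ, fun _ _ _ _ x y =>
      ⟨DiffMod.tmul_mem_filtGE hq x y, DiffMod.grTensor_tmul hq x y⟩⟩
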